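/- Let $X$ be a (real or complex) Banach space and let $A$ be the infinitesimal generator of an analytic semigroup $e^{tA}$, $t\ge 0$, on $X$ (on a real space: analytic after complexification). Let $g:X\to X$, $t_0<T$, and let $u:[t_0,T]\to X$ be a solution of $$u'(t)=F(u(t))=Au(t)+g(u(t)),\qquad t_0\le t\le T .$$ Suppose that $u\in C^5([t_0,T];X)$ and that, for some $r>0$, $g$ is five times continuously (real) Fréchet differentiable in the strip $\{x:\ \|x-u(t)\|<r \text{ for some } t\in[t_0,T]\}$, with derivatives of orders $1,\dots,5$ uniformly bounded there. Let $\varphi_0(z)=e^z$ and $\varphi_k(z)=\int_0^1 e^{(1-\theta)z}\frac{\theta^{k-1}}{(k-1)!}\,d\theta$ for $k\ge1$. Consider an explicit exponential Runge–Kutta method with $s$ stages, nodes $c_i\ge 0$ and coefficient functions $a_{ij}(z)$, $b_i(z)$ that are finite real linear combinations of functions $\varphi_k(\sigma z)$ with $k\ge 0$, $\sigma\ge0$. With constant step size $h>0$ and $u_0=u(t_0)$ it reads $$U_{ni}=u_n+c_ih\varphi_1(c_ihA)F(u_n)+h\sum_{j=2}^{i-1}a_{ij}(hA)D_{nj},\qquad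 u_{n+1}=u_n+h\varphi_1(hA)F(u_n)+h\sum_{i=2}^{s}b_i(hA)D_{ni},$$ with $D_{ni}=g(U_{ni})-g(u_n)$, where for $\tau\ge0$ the term $\tau\varphi_1(\tau A)F(w)$ is understood as $(e^{\tau A}-I)w+\tau\varphi_1(\tau A)g(w)$ (the same thing if $w$ lies in the domain of $A$). Put $$\psi_{j,i}(Z)=\sum_{k=2}^{i-1}a_{ik}(Z)\frac{c_k^{j-1}}{(j-1)!}-c_i^j\varphi_j(c_iZ).$$ Assume that for all real square matrices $Z,J,K$ of the same (arbitrary) format 1. $\sum_{i=2}^s b_i(Z)c_i=\varphi_2(Z)$, 2. $\sum_{i=2}^s b_i(Z)\frac{c_i^2}{2!}=\varphi_3(Z)$, 3. $\sum_{i=2}^s b_i(Z)J\psi_{2,i}(Z)=0$, 4. $\sum_{i=2}^s b_i(Z)\frac{c_i^3}{3!}=\varphi_4(Z)$, 5. $\sum_{i=2}^s b_i(Z)J\psi_{3,i}(Z)=0$, 6. $\sum_{i=2}^s b_i(Z)J\sum_{j=2}^{i-1}a_{ij}(Z)J\psi_{2,j}(Z)=0$, 7. $\sum_{i=2}^s b_i(Z)c_iK\psi_{2,i}(Z)=0$,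 and that, for all real square matrices $Z,J,K,L$ of the same (arbitrary) format and all bilinear maps $B$ of the corresponding dimension, 8. $\sum_{i=2}^s b_i(0)\frac{c_i^4}{4!}=\varphi_5(0)$, 9. $\sum_{i=2}^s b_i(0)J\psi_{4,i}(Z)=0$, 10. $\sum_{i=2}^s b_i(0)J\sum_{j=2}^{i-1}a_{ij}(Z)J\psi_{3,j}(Z)=0$, 11. $\sum_{i=2}^s b_i(0)J\sum_{j=2}^{i-1}a_{ij}(Z)J\sum_{k=2}^{j-1}a_{jk}(Z)J\psi_{2,k}(Z)=0$, 12. $\sum_{i=2}^s b_i(0)J\sum_{j=2}^{i-1}a_{ij}(Z)c_jK\psi_{2,j}(Z)=0$, 13. $\sum_{i=2}^s b_i(0)c_iK\psi_{3,i}(Z)=0$, 14. $\sum_{i=2}^s b_i(0)c_iK\sum_{j=2}^{i-1}a_{ij}(Z)J\psi_{2,j}(Z)=0$, 15. $\sum_{i=2}^s b_i(0)B\big(\psi_{2,i}(Z),\psi_{2,i}(Z)\big)=0$, 16. $\sum_{i=2}^s b_i(0)c_i^2L\psi_{2,i}(Z)=0$. Then the method converges with order $5$: there are constants $h_0>0$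 and $C$, independent of $n$ and $h$, such that for all $0<h\le h_0$ and all integers $n\ge0$ with $t_n=t_0+nh\le T$, $$\|u_n-u(t_n)\|\le C h^5 .$$ -/

import Mathlib

open Set Filter Topology
open scoped NNReal Nat

namespace ExpRK

noncomputable section

universe v

/-! ### Analytic semigroups -/

/-- The open sector of half-angle `δ` around the positive real axis (without the vertex). -/
def sector (δ : ℝ) : Set ℂ := {z | z ≠ 0 ∧ |z.arg| < δ}

/-- `S` is a semigroup of bounded operators on the complex Banach space `Y` that is analytic in
the sector of half-angle `δ` and strongly continuous at the vertex of the sector. -/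
structure IsSectorialSemigroup {Y : Type v} [NormedAddCommGroup Y] [NormedSpace ℂ Y]
    (δ : ℝ) (S : ℂ → Y →L[ℂ] Y) : Prop where
  map_zero : S 0 = 1
  map_add : ∀ z ∈ sector δ, ∀ w ∈ sector δ, S (z + w) = S z * S w
  analytic : DifferentiableOn ℂ S (sector δ)
  tendsto_zero : ∀ y, Tendsto (fun z => S z y) (𝓝[sector δ] 0) (𝓝 y)

/-- Strongly continuous (`C₀`) semigroups `(T t)_{t ≥ 0}` of bounded operators; the values of `T`
at negative times are irrelevant. -/
structure IsC0Semigroup {X : Type v} [NormedAddCommGroup X] [NormedSpace ℝ X]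
    (T : ℝ → X →L[ℝ] X) : Prop where
  map_zero : T 0 = 1
  map_add : ∀ s t, 0 ≤ s → 0 ≤ t → T (s + t) = T s * T t
  continuousOn : ∀ x, ContinuousOn (fun t => T t x) (Ici 0)

/-- A `C₀`-semigroup on a Banach space `X` is analytic if it extends analytically to a sector
around the positive real axis. Analyticity in a sector needs complex scalars: if `X` is a complex
Banach space, take `Y = X` and `ι = id`; if `X` is real, the extension lives on a complexification
`Y` of `X`, which contains `X` as a closed real subspace through `ι`. -/
def IsAnalyticSemigroup {X : Type v} [NormedAddCommGroup X] [NormedSpace ℝ X]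
    (T : ℝ → X →L[ℝ] X) : Prop :=
  IsC0Semigroup T ∧
    ∃ (Y : Type v) (_ : NormedAddCommGroup Y) (_ : NormedSpace ℂ Y) (_ : CompleteSpace Y)
      (ι : X →ₗᵢ[ℝ] Y) (δ : ℝ) (S : ℂ → Y →L[ℂ] Y),
      0 < δ ∧ δ ≤ Real.pi / 2 ∧ IsSectorialSemigroup δ S ∧
        ∀ t : ℝ, 0 ≤ t → ∀ x, S (t : ℂ) (ι x) = ι (T t x)

/-- The (possibly unbounded) linear operator `A` is the infinitesimal generator of `T`: its graph
consists of the pairs `(x, y)` with `y = lim_{t → 0+} (T t x - x) / t`. -/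
def IsGenerator {X : Type v} [NormedAddCommGroup X] [NormedSpace ℝ X]
    (A : X →ₗ.[ℝ] X) (T : ℝ → X →L[ℝ] X) : Prop :=
  ∀ x y, (x, y) ∈ A.graph ↔ Tendsto (fun t : ℝ => t⁻¹ • (T t x - x)) (𝓝[>] 0) (𝓝 y)

/-! ### The functions `φ_k` and the coefficients of a method -/

/-- `phi T k τ = φ_k(τ A)` for `T t = e^{tA}`: `φ_0(τ A) = e^{τ A}` and
`φ_k(τ A) x = ∫_0^1 e^{(1-θ) τ A} x θ^{k-1}/(k-1)! dθ` for `k ≥ 1`. -/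
def phi {X : Type v} [NormedAddCommGroup X] [NormedSpace ℝ X] (T : ℝ → X →L[ℝ] X) :
    ℕ → ℝ → X → X
  | 0, τ, x => T τ x
  | k + 1, τ, x => ∫ θ in (0 : ℝ)..1, (θ ^ k / (k ! : ℝ)) • T ((1 - θ) * τ) x

/-- A coefficient function: a finite linear combination `z ↦ ∑ r • φ_k(σ z)` of the functions
`φ_k` and scaled versions thereof; `f (k, σ)` is the factor of `φ_k(σ z)`. -/
abbrev Coeff := ℕ × ℝ≥0 →₀ ℝ

/-- The operator `f(τ A)` for `T t = e^{tA}`. -/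
def Coeff.op {X : Type v} [NormedAddCommGroup X] [NormedSpace ℝ X] (f : Coeff)
    (T : ℝ → X →L[ℝ] X) (τ : ℝ) (x : X) : X :=
  f.sum fun p r => r • phi T p.1 ((p.2 : ℝ) * τ) x

/-- An explicit exponential Runge–Kutta method with `s` stages. Only `c i`, `b i` with
`2 ≤ i ≤ s` and `a i j` with `2 ≤ j < i ≤ s` are used. -/
structure Method where
  s : ℕ
  c : ℕ → ℝ≥0
  a : ℕ → ℕ → Coeff
  b : ℕ → Coeff

/-! ### The numerical scheme -/

section Scheme

variable {X : Type v} [NormedAddCommGroup X] [NormedSpace ℝ X]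

/-- The term `τ φ_1(τ A) F(w)` with `F(w) = A w + g(w)`. The operator `τ φ_1(τ A) A = e^{τ A} - 1`
extends continuously from the domain of `A` to all of `X`; see `phiF_eq`. -/
def phiF (T : ℝ → X →L[ℝ] X) (g : X → X) (τ : ℝ) (w : X) : X :=
  (T τ w - w) + τ • phi T 1 τ (g w)

/-- For `w` in the domain of the generator `A`, `phiF` is literally `τ φ_1(τ A) (A w + g w)`. -/
theorem phiF_eq [CompleteSpace X] {T : ℝ → X →L[ℝ] X} {A : X →ₗ.[ℝ] X} (hT : IsC0Semigroup T)
    (hA : IsGenerator A T) (g : X → X) {τ : ℝ} (hτ : 0 ≤ τ) (w : A.domain) :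
    phiF T g τ w = τ • phi T 1 τ (A w + g w) := by
  have hci : ∀ x : X, ContinuousOn (fun θ : ℝ => T ((1 - θ) * τ) x) (uIcc (0 : ℝ) 1) := by
    intro x
    refine (hT.continuousOn x).comp (by fun_prop) ?_
    intro θ hθ
    rw [uIcc_of_le zero_le_one] at hθ
    exact mul_nonneg (by linarith [hθ.2]) hτ
  have hint : ∀ x : X, IntervalIntegrable (fun θ : ℝ => T ((1 - θ) * τ) x)
      MeasureTheory.volume 0 1 := fun x => (hci x).intervalIntegrable
  have hphi : ∀ x : X, phi T 1 τ x = ∫ θ in (0 : ℝ)..1, T ((1 - θ) * τ) x := by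
    intro x; simp [phi]
  have hlin : T τ (w : X) - w = τ • ∫ θ in (0 : ℝ)..1, T ((1 - θ) * τ) (A w) := by
    have hsub : τ • ∫ θ in (0 : ℝ)..1, T ((1 - θ) * τ) (A w) = ∫ t in (0 : ℝ)..τ, T t (A w) := by
      have h1 := intervalIntegral.integral_comp_sub_left (a := 0) (b := 1)
        (fun θ : ℝ => T (θ * τ) (A w)) 1
      rw [h1]
      simpa using intervalIntegral.smul_integral_comp_mul_right (a := 0) (b := 1)
        (fun t : ℝ => T t (A w)) τ
    have hcont : ∀ x : X, ContinuousOn (fun t => T t x) (Icc 0 τ) := fun x =>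
      (hT.continuousOn x).mono fun t ht => ht.1
    rw [hsub, intervalIntegral.integral_eq_sub_of_hasDeriv_right_of_le hτ (hcont w) (f' :=
      fun t => T t (A w))]
    · simp [hT.map_zero]
    · intro t ht
      have hgen := (hA w (A w)).1 (A.mem_graph w)
      have hlim : Tendsto (fun r : ℝ => T t (r⁻¹ • (T r w - (w : X)))) (𝓝[>] 0) (𝓝 (T t (A w))) :=
        ((T t).continuous.tendsto _).comp hgen
      rw [hasDerivWithinAt_iff_tendsto_slope' (by simp)]
      have hshift : Tendsto (fun y : ℝ => y - t) (𝓝[>] t) (𝓝[>] 0) := by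
        refine tendsto_nhdsWithin_iff.2 ⟨?_, ?_⟩
        · have : Tendsto (fun y : ℝ => y - t) (𝓝 t) (𝓝 (t - t)) := by
            exact (continuous_id.sub continuous_const).tendsto t
          rw [sub_self] at this
          exact this.mono_left nhdsWithin_le_nhds
        · filter_upwards [self_mem_nhdsWithin] with y hy
          exact sub_pos.2 (mem_Ioi.1 hy)
      refine (hlim.comp hshift).congr' ?_
      filter_upwards [self_mem_nhdsWithin] with y hy
      have hy' : 0 ≤ y - t := (sub_pos.2 (mem_Ioi.1 hy)).le
      have hadd : T y = T t * T (y - t) := by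
        rw [← hT.map_add t (y - t) ht.1.le hy']; congr 1; ring
      simp [slope, hadd]
    · exact ((hcont (A w)).mono (by rw [uIcc_of_le hτ])).intervalIntegrable
  rw [phiF, hphi, hphi, hlin, ← smul_add, ← intervalIntegral.integral_add (hint _) (hint _)]
  simp

/-- The internal stages
`U_i = w + c_i h φ_1(c_i h A) F(w) + h ∑_{j=2}^{i-1} a_{ij}(h A) (g(U_j) - g(w))`
of one step of size `h` from `w`. -/
def stage (M : Method) (T : ℝ → X →L[ℝ] X) (g : X → X) (h : ℝ) (w : X) (i : ℕ) : X :=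
  w + phiF T g ((M.c i : ℝ) * h) w +
    h • ∑ j : Finset.Ico 2 i, (M.a i j).op T h (g (stage M T g h w j) - g w)
termination_by i
decreasing_by exact (Finset.mem_Ico.1 j.2).2

theorem stage_eq (M : Method) (T : ℝ → X →L[ℝ] X) (g : X → X) (h : ℝ) (w : X) (i : ℕ) :
    stage M T g h w i = w + phiF T g ((M.c i : ℝ) * h) w +
      h • ∑ j ∈ Finset.Ico 2 i, (M.a i j).op T h (g (stage M T g h w j) - g w) := by
  rw [stage, Finset.sum_coe_sort (Finset.Ico 2 i)
    (fun j => (M.a i j).op T h (g (stage M T g h w j) - g w))]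

/-- One step of size `h`:
`w ↦ w + h φ_1(h A) F(w) + h ∑_{i=2}^{s} b_i(h A) (g(U_i) - g(w))`. -/
def step (M : Method) (T : ℝ → X →L[ℝ] X) (g : X → X) (h : ℝ) (w : X) : X :=
  w + phiF T g h w + h • ∑ i ∈ Finset.Icc 2 M.s, (M.b i).op T h (g (stage M T g h w i) - g w)

/-- The numerical solution `u_n` with constant step size `h` and initial value `u₀`. -/
def numSol (M : Method) (T : ℝ → X →L[ℝ] X) (g : X → X) (h : ℝ) (u₀ : X) : ℕ → X
  | 0 => u₀
  | n + 1 => step M T g h (numSol M T g h u₀ n)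

end Scheme

/-! ### The stiff order conditions -/

/-- `Mat d`: square matrices of format `d`, as linear maps of `ℝ^d`. -/
abbrev Mat (d : ℕ) := EuclideanSpace ℝ (Fin d) →L[ℝ] EuclideanSpace ℝ (Fin d)

/-- `t ↦ e^{tZ}`. -/
def expSG {d : ℕ} (Z : Mat d) (t : ℝ) : Mat d := NormedSpace.exp (t • Z)

/-- `φ_k(Z)` for a square matrix `Z`. -/
def phiMat {d : ℕ} (k : ℕ) (Z : Mat d) : EuclideanSpace ℝ (Fin d) → EuclideanSpace ℝ (Fin d) :=
  phi (expSG Z) k 1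

/-- `f(Z)` for a coefficient function `f` and a square matrix `Z`. -/
def Coeff.mat {d : ℕ} (f : Coeff) (Z : Mat d) :
    EuclideanSpace ℝ (Fin d) → EuclideanSpace ℝ (Fin d) :=
  f.op (expSG Z) 1

namespace Method

variable (M : Method) {d : ℕ}

/-- `ψ_{j,i}(Z) = ∑_{k=2}^{i-1} a_{ik}(Z) c_k^{j-1}/(j-1)! - c_i^j φ_j(c_i Z)`. -/
def psi (j i : ℕ) (Z : Mat d) (x : EuclideanSpace ℝ (Fin d)) : EuclideanSpace ℝ (Fin d) :=
  ∑ k ∈ Finset.Ico 2 i, ((M.c k : ℝ) ^ (j - 1) / ((j - 1)! : ℝ)) • (M.a i k).mat Z x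
    - (M.c i : ℝ) ^ j • phiMat j ((M.c i : ℝ) • Z) x

/-- Quadrature condition `∑ b_i(Z) c_i^m / m! = φ_{m+1}(Z)` at the matrix `Z`. -/
def QuadCond (m : ℕ) (Z : Mat d) : Prop :=
  ∀ x, ∑ i ∈ Finset.Icc 2 M.s, ((M.c i : ℝ) ^ m / (m ! : ℝ)) • (M.b i).mat Z x = phiMat (m + 1) Z x

/-- The stiff order conditions 1–7 (up to order four), for arbitrary square matrices. -/
structure FullConditions : Prop where
  cond1 : ∀ (d : ℕ) (Z : Mat d), M.QuadCond 1 Z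
  cond2 : ∀ (d : ℕ) (Z : Mat d), M.QuadCond 2 Z
  cond3 : ∀ (d : ℕ) (Z J : Mat d) x,
    ∑ i ∈ Finset.Icc 2 M.s, (M.b i).mat Z (J (M.psi 2 i Z x)) = 0
  cond4 : ∀ (d : ℕ) (Z : Mat d), M.QuadCond 3 Z
  cond5 : ∀ (d : ℕ) (Z J : Mat d) x,
    ∑ i ∈ Finset.Icc 2 M.s, (M.b i).mat Z (J (M.psi 3 i Z x)) = 0
  cond6 : ∀ (d : ℕ) (Z J : Mat d) x,
    ∑ i ∈ Finset.Icc 2 M.s, (M.b i).mat Z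
      (J (∑ j ∈ Finset.Ico 2 i, (M.a i j).mat Z (J (M.psi 2 j Z x)))) = 0
  cond7 : ∀ (d : ℕ) (Z K : Mat d) x,
    ∑ i ∈ Finset.Icc 2 M.s, (M.b i).mat Z ((M.c i : ℝ) • K (M.psi 2 i Z x)) = 0

/-- The weakened conditions 8–16 of order five: condition 8 only at `Z = 0`, and conditions 9–16
with `b_i(0)` in place of `b_i(Z)`. -/
structure WeakConditions : Prop where
  cond8 : ∀ d : ℕ, M.QuadCond 4 (0 : Mat d)
  cond9 : ∀ (d : ℕ) (Z J : Mat d) x,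
    ∑ i ∈ Finset.Icc 2 M.s, (M.b i).mat 0 (J (M.psi 4 i Z x)) = 0
  cond10 : ∀ (d : ℕ) (Z J : Mat d) x,
    ∑ i ∈ Finset.Icc 2 M.s, (M.b i).mat 0
      (J (∑ j ∈ Finset.Ico 2 i, (M.a i j).mat Z (J (M.psi 3 j Z x)))) = 0
  cond11 : ∀ (d : ℕ) (Z J : Mat d) x,
    ∑ i ∈ Finset.Icc 2 M.s, (M.b i).mat 0
      (J (∑ j ∈ Finset.Ico 2 i, (M.a i j).mat Z
        (J (∑ k ∈ Finset.Ico 2 j, (M.a j k).mat Z (J (M.psi 2 k Z x)))))) = 0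
  cond12 : ∀ (d : ℕ) (Z J K : Mat d) x,
    ∑ i ∈ Finset.Icc 2 M.s, (M.b i).mat 0
      (J (∑ j ∈ Finset.Ico 2 i, (M.a i j).mat Z ((M.c j : ℝ) • K (M.psi 2 j Z x)))) = 0
  cond13 : ∀ (d : ℕ) (Z K : Mat d) x,
    ∑ i ∈ Finset.Icc 2 M.s, (M.b i).mat 0 ((M.c i : ℝ) • K (M.psi 3 i Z x)) = 0
  cond14 : ∀ (d : ℕ) (Z J K : Mat d) x,
    ∑ i ∈ Finset.Icc 2 M.s, (M.b i).mat 0 ((M.c i : ℝ) •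
      K (∑ j ∈ Finset.Ico 2 i, (M.a i j).mat Z (J (M.psi 2 j Z x)))) = 0
  cond15 : ∀ (d : ℕ) (Z : Mat d)
      (B : EuclideanSpace ℝ (Fin d) →ₗ[ℝ] EuclideanSpace ℝ (Fin d) →ₗ[ℝ] EuclideanSpace ℝ (Fin d))
      x y,
    ∑ i ∈ Finset.Icc 2 M.s, (M.b i).mat 0 (B (M.psi 2 i Z x) (M.psi 2 i Z y)) = 0
  cond16 : ∀ (d : ℕ) (Z L : Mat d) x,
    ∑ i ∈ Finset.Icc 2 M.s, (M.b i).mat 0 ((M.c i : ℝ) ^ 2 • L (M.psi 2 i Z x)) = 0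

end Method

/-! ### The initial value problem -/

section Problem

variable {X : Type v} [NormedAddCommGroup X] [NormedSpace ℝ X]

/-- `u` solves `u'(t) = A u(t) + g(u(t))` on `[t₀, t₁]`; in particular `u(t)` lies in the domain
of `A` (one-sided derivatives at the end points). -/
def IsSolution (A : X →ₗ.[ℝ] X) (g : X → X) (t₀ t₁ : ℝ) (u : ℝ → X) : Prop :=
  ∀ t ∈ Icc t₀ t₁, ∃ hx : u t ∈ A.domain,
    HasDerivWithinAt u (A ⟨u t, hx⟩ + g (u t)) (Icc t₀ t₁) t

/-- Regularity: `u` is `C⁵` on `[t₀, t₁]` and `g` is `C⁵` in a strip of some width `r > 0` along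
`u`, with uniformly bounded derivatives there. (The derivatives of `u` are bounded by compactness
of `[t₀, t₁]`.) -/
structure IsRegular (g : X → X) (t₀ t₁ : ℝ) (u : ℝ → X) : Prop where
  smooth_u : ContDiffOn ℝ 5 u (Icc t₀ t₁)
  smooth_g : ∃ r > 0, ContDiffOn ℝ 5 g (Metric.thickening r (u '' Icc t₀ t₁)) ∧
    ∃ R : ℝ, ∀ k : ℕ, 1 ≤ k → k ≤ 5 → ∀ x ∈ Metric.thickening r (u '' Icc t₀ t₁),
      ‖iteratedFDeriv ℝ k g x‖ ≤ R

end Problem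

end

end ExpRK

/-! Along a smooth extension `v` of the solution, all quantities of one step are expanded in powers
of `h`, uniformly in `t`. Unboundedness of `A` does no harm, since only bounded operators such as
`φ_k(hA)`, derivatives of `v` and derivatives of `g` along `v` occur (`SmoothProblem.isOrd_stage`,
`SmoothProblem.isOrd_step`). `FullConditions` removes the terms up to `h^4` of the local error.
`WeakConditions` reduces the `h^5` term to `localErr`, a sum of terms `(f(hA) - f(0)) w` with
coefficient functions `f` and with `w` Lipschitz in time. For unbounded `A` such a term is in
general bounded but not `O(h)`, so estimating local errors one by one would give order four only.

The missing power comes from summation, and this is the one place where analyticity enters. The sums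
`∑_{j<n} e^{jhA} (f(hA) - f(0))` are bounded (`IsAnalyticSemigroup.exists_sum_opL_sub_bound`):
subtracting linear interpolants from the semigroup leaves summable errors of size `j^{-2}`, because
its second derivative is `O(t^{-2})`, and the interpolants telescope. Abel summation then admits the
slowly varying factor `w`, so the propagated terms `h^5 localErr` add up to `O(h^5)`. The remaining
`O(h^6)` errors are summed directly, and a discrete Gronwall argument concludes.

The order conditions speak of matrices but are needed for generators. Diagonal matrices linked by a
nilpotent shift turn them into scalar identities in independent real variables. A coefficient
function vanishing on the real line is annihilated by every continuous test function, by Weierstrass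
approximation in `e^t`, hence its operator vanishes (`opL_eq_zero`); identities in several variables
are transferred one variable at a time (`sum_map_eq_zero_of_scal`). -/

namespace ExpRK

noncomputable section

universe v

/-! ### Strongly continuous semigroups -/

section Semigroup

variable {X : Type v} [NormedAddCommGroup X] [NormedSpace ℝ X] {T : ℝ → X →L[ℝ] X}

/-- A strongly continuous semigroup is uniformly bounded on compact time intervals. -/
theorem IsC0Semigroup.exists_norm_le [CompleteSpace X] (hT : IsC0Semigroup T) (R : ℝ) :
    ∃ C : ℝ, 0 < C ∧ ∀ t, 0 ≤ t → t ≤ R → ‖T t‖ ≤ C := by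
  obtain ⟨C, hC⟩ := banach_steinhaus (g := fun t : Icc (0 : ℝ) R => T t) (by
    intro x
    obtain ⟨C, hC⟩ := isCompact_Icc.exists_bound_of_continuousOn
      ((hT.continuousOn x).mono (fun t ht => ht.1 : Icc 0 R ⊆ Ici 0))
    exact ⟨C, fun t => hC t t.2⟩)
  exact ⟨max C 1, by positivity, fun t h0 h1 => (hC ⟨t, h0, h1⟩).trans (le_max_left _ _)⟩

/-- Strong continuity treats a fixed vector; the uniform bound on compact time intervals absorbs a
change of the vector. Variation of constants needs this for curves `s ↦ T (h - s) (w s)`. -/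
theorem IsC0Semigroup.continuousOn_uncurry [CompleteSpace X] (hT : IsC0Semigroup T) :
    ContinuousOn (fun p : ℝ × X => T p.1 p.2) (Ici 0 ×ˢ univ) := by
  rintro ⟨t, x⟩ ⟨ht, -⟩
  obtain ⟨C, -, hC⟩ := hT.exists_norm_le (t + 1)
  have h1 : Tendsto (fun p : ℝ × X => T p.1 x) (𝓝[Ici 0 ×ˢ univ] (t, x)) (𝓝 (T t x)) := by
    refine (hT.continuousOn x t ht).tendsto.comp ?_
    exact tendsto_nhdsWithin_iff.2 ⟨(continuous_fst.tendsto (t, x)).mono_left nhdsWithin_le_nhds,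
      eventually_mem_nhdsWithin.mono fun p hp => hp.1⟩
  have h2 : Tendsto (fun p : ℝ × X => T p.1 (p.2 - x)) (𝓝[Ici 0 ×ˢ univ] (t, x)) (𝓝 0) := by
    have h3 : Tendsto (fun p : ℝ × X => C * ‖p.2 - x‖) (𝓝[Ici 0 ×ˢ univ] (t, x)) (𝓝 0) := by
      have : Continuous fun p : ℝ × X => C * ‖p.2 - x‖ := by fun_prop
      simpa using (this.tendsto (t, x)).mono_left nhdsWithin_le_nhds
    refine squeeze_zero_norm' ?_ h3
    have h4 : ∀ᶠ p : ℝ × X in 𝓝 (t, x), p.1 < t + 1 :=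
      continuous_fst.continuousAt.eventually (gt_mem_nhds (lt_add_one t))
    filter_upwards [nhdsWithin_le_nhds h4, eventually_mem_nhdsWithin] with p hp hp'
    exact (T p.1).le_of_opNorm_le (hC _ hp'.1 hp.le) _
  have := h2.add h1
  simpa [ContinuousWithinAt] using this

/-- Variation of constants: if `y' = A y + q` on `[0, h]`, then
`y(h) = e^{hA} y(0) + ∫_0^h e^{(h-s)A} q(s) ds`. -/
theorem IsC0Semigroup.variation_of_constants [CompleteSpace X] (hT : IsC0Semigroup T)
    {A : X →ₗ.[ℝ] X} (hA : IsGenerator A T) {y y' q : ℝ → X} {h : ℝ} (hh : 0 ≤ h)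
    (hyc : ContinuousOn y (Icc 0 h)) (hqc : ContinuousOn q (Icc 0 h))
    (hy : ∀ s ∈ Ioo 0 h, HasDerivWithinAt y (y' s) (Ioi s) s)
    (hyA : ∀ s ∈ Ioo 0 h, (y s, y' s - q s) ∈ A.graph) :
    y h = T h (y 0) + ∫ s in (0 : ℝ)..h, T (h - s) (q s) := by
  have hc : ∀ w : ℝ → X, ContinuousOn w (Icc 0 h) →
      ContinuousOn (fun s => T (h - s) (w s)) (Icc 0 h) := fun w hw =>
    hT.continuousOn_uncurry.comp ((continuousOn_const.sub continuousOn_id).prodMk hw)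
      fun s hs => ⟨sub_nonneg.2 hs.2, mem_univ _⟩
  have key := intervalIntegral.integral_eq_sub_of_hasDeriv_right_of_le hh (hc y hyc)
    (f' := fun s => T (h - s) (q s)) ?_ ?_
  · rw [key]; simp [hT.map_zero]
  · intro s hs
    have hgen := (hA _ _).1 (hyA s hs)
    have hshift : Tendsto (fun r : ℝ => r - s) (𝓝[>] s) (𝓝[>] 0) := by
      refine tendsto_nhdsWithin_iff.2 ⟨?_, ?_⟩
      · have : Tendsto (fun r : ℝ => r - s) (𝓝 s) (𝓝 (s - s)) :=
          (continuous_id.sub continuous_const).tendsto s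
        rw [sub_self] at this
        exact this.mono_left nhdsWithin_le_nhds
      · filter_upwards [self_mem_nhdsWithin] with r hr
        exact sub_pos.2 (mem_Ioi.1 hr)
    have h1 := (hasDerivWithinAt_iff_tendsto_slope' (by simp)).1 (hy s hs)
    have h2 := h1.sub (hgen.comp hshift)
    rw [sub_sub_cancel] at h2
    rw [hasDerivWithinAt_iff_tendsto_slope' (by simp)]
    -- As `T (h - s) (y s) = T (h - r) (T (r - s) (y s))`, the difference quotient of `s ↦ T (h - s)
    -- (y s)` is `T (h - r)` applied to the second component here, which tends to `y' - (y' - q) =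
    -- q`.
    have h3 : Tendsto (fun r : ℝ => (h - r, slope y s r - (r - s)⁻¹ • (T (r - s) (y s) - y s)))
        (𝓝[>] s) (𝓝[Ici 0 ×ˢ univ] (h - s, q s)) := by
      refine tendsto_nhdsWithin_iff.2 ⟨Tendsto.prodMk_nhds ?_ h2, ?_⟩
      · exact ((continuous_const.sub continuous_id).tendsto s).mono_left nhdsWithin_le_nhds
      · filter_upwards [Ioc_mem_nhdsGT hs.2] with r hr
        exact ⟨sub_nonneg.2 hr.2, mem_univ _⟩
    have h4 := (hT.continuousOn_uncurry (h - s, q s) ⟨sub_nonneg.2 hs.2.le, mem_univ _⟩).tendsto.comp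
      h3
    refine h4.congr' ?_
    filter_upwards [Ioc_mem_nhdsGT hs.2] with r hr
    have hadd : T (h - s) (y s) = T (h - r) (T (r - s) (y s)) := by
      have := hT.map_add _ _ (sub_nonneg.2 hr.2) (sub_nonneg.2 hr.1.le)
      rw [sub_add_sub_cancel] at this
      rw [this]; rfl
    simp only [Function.comp, slope, vsub_eq_sub, hadd, map_sub, map_smul]
    module
  · refine ContinuousOn.intervalIntegrable ?_
    rw [uIcc_of_le hh]
    exact hc q hqc

/-- The generator of a strongly continuous semigroup is a closed operator. -/
theorem IsGenerator.isClosed_graph [CompleteSpace X] (hT : IsC0Semigroup T) {A : X →ₗ.[ℝ] X}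
    (hA : IsGenerator A T) : IsClosed (A.graph : Set (X × X)) := by
  have hint : ∀ t, 0 ≤ t → ∀ y, IntervalIntegrable (fun s => T (t - s) y)
      MeasureTheory.volume 0 t := by
    intro t ht y
    refine ContinuousOn.intervalIntegrable ?_
    rw [uIcc_of_le ht]
    exact (hT.continuousOn y).comp (by fun_prop) fun s hs => sub_nonneg.2 hs.2
  -- The integrated form of `y = A x`: for each fixed `t` it is a closed condition on `(x, y)`.
  have hmem : ∀ x y, (x, y) ∈ A.graph ↔
      ∀ t, 0 ≤ t → x - T t x + ∫ s in (0 : ℝ)..t, T (t - s) y = 0 := by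
    intro x y
    constructor
    · intro hxy t ht
      -- The constant curve `x` solves `0 = A x + q` with `q = -y`.
      have := hT.variation_of_constants hA (y := fun _ => x) (y' := fun _ => 0) (q := fun _ => -y)
        ht continuousOn_const continuousOn_const (fun s _ => hasDerivWithinAt_const _ _ _)
        (fun s _ => by simpa using hxy)
      simp only [map_neg, intervalIntegral.integral_neg] at this
      rw [sub_add_eq_add_sub, sub_eq_zero]
      nth_rewrite 1 [this]
      abel
    · intro hx
      rw [hA]
      have h1 : ∀ t, 0 ≤ t → T t x - x = ∫ s in (0 : ℝ)..t, T s y := by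
        intro t ht
        have h2 := intervalIntegral.integral_comp_sub_left (a := 0) (b := t) (fun s => T s y) t
        simp only [sub_self, sub_zero] at h2
        rw [← h2, ← sub_eq_zero, ← neg_eq_zero, ← hx t ht]
        abel
      have hcont : ContinuousOn (fun s => T s y) (Icc 0 1) :=
        (hT.continuousOn y).mono fun s hs => hs.1
      have h3 : HasDerivWithinAt (fun t => ∫ s in (0 : ℝ)..t, T s y) (T 0 y) (Ici 0) 0 := by
        refine intervalIntegral.integral_hasDerivWithinAt_right (by simp) (t := Ioi 0) ?_ ?_
        · exact ⟨Ioc 0 1, Ioc_mem_nhdsGT zero_lt_one,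
            (hcont.mono Ioc_subset_Icc_self).aestronglyMeasurable measurableSet_Ioc⟩
        · exact ((hT.continuousOn y) 0 self_mem_Ici).mono Ioi_subset_Ici_self
      have h4 := (hasDerivWithinAt_iff_tendsto_slope' (by simp)).1 (h3.mono Ioi_subset_Ici_self)
      rw [hT.map_zero] at h4
      refine h4.congr' ?_
      filter_upwards [self_mem_nhdsWithin] with t ht
      rw [h1 t (le_of_lt ht)]
      simp [slope]
  have hset : (A.graph : Set (X × X)) = ⋂ t ∈ Ici (0 : ℝ),
      {p : X × X | p.1 - T t p.1 + ∫ s in (0 : ℝ)..t, T (t - s) p.2 = 0} := by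
    ext ⟨x, y⟩
    simp [hmem]
  rw [hset]
  refine isClosed_biInter fun t ht' => isClosed_eq ?_ continuous_const
  have ht : 0 ≤ t := ht'
  refine (continuous_fst.sub ((T t).continuous.comp continuous_fst)).add ?_
  have hlip : ∃ C : ℝ≥0, LipschitzWith C fun y => ∫ s in (0 : ℝ)..t, T (t - s) y := by
    obtain ⟨C, hC0, hC⟩ := hT.exists_norm_le t
    refine ⟨Real.toNNReal (C * t), LipschitzWith.of_dist_le_mul fun y z => ?_⟩
    rw [dist_eq_norm, dist_eq_norm, ← intervalIntegral.integral_sub (hint t ht y) (hint t ht z)]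
    have := intervalIntegral.norm_integral_le_of_norm_le_const (a := 0) (b := t)
      (f := fun s => T (t - s) y - T (t - s) z) (C := C * ‖y - z‖) (by
        intro s hs
        rw [uIoc_of_le ht] at hs
        rw [← map_sub]
        exact (T _).le_of_opNorm_le (hC _ (by linarith [hs.2]) (by linarith [hs.1])) _)
    rw [sub_zero, abs_of_nonneg ht] at this
    rw [Real.coe_toNNReal _ (mul_nonneg hC0.le ht)]
    linarith
  obtain ⟨C, hC⟩ := hlip
  exact hC.continuous.comp continuous_snd

end Semigroup

/-! ### The operators `φ_k(τA)` and `f(τA)` as continuous linear maps -/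

section Operators

variable {X : Type v} [NormedAddCommGroup X] [NormedSpace ℝ X] {T : ℝ → X →L[ℝ] X}

theorem IsC0Semigroup.intervalIntegrable_phi (hT : IsC0Semigroup T) (k : ℕ) {τ : ℝ} (hτ : 0 ≤ τ)
    (x : X) : IntervalIntegrable (fun θ : ℝ => (θ ^ k / (k ! : ℝ)) • T ((1 - θ) * τ) x)
      MeasureTheory.volume 0 1 := by
  refine ContinuousOn.intervalIntegrable (ContinuousOn.smul (by fun_prop) ?_)
  refine (hT.continuousOn x).comp (by fun_prop) ?_
  intro θ hθ
  rw [uIcc_of_le zero_le_one] at hθ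
  exact mul_nonneg (by linarith [hθ.2]) hτ

/-- The weights `θ ^ k / k!` are at most one on `[0, 1]`, so one bound for the semigroup serves
every `φ_k`. -/
theorem norm_phi_le {R C : ℝ} (hC : ∀ t, 0 ≤ t → t ≤ R → ‖T t‖ ≤ C)
    (k : ℕ) {τ : ℝ} (hτ : 0 ≤ τ) (hτR : τ ≤ R) (x : X) : ‖phi T k τ x‖ ≤ C * ‖x‖ := by
  cases k with
  | zero => exact (T τ).le_of_opNorm_le (hC _ hτ hτR) _
  | succ k =>
    have := intervalIntegral.norm_integral_le_of_norm_le_const (a := 0) (b := 1)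
      (f := fun θ : ℝ => (θ ^ k / (k ! : ℝ)) • T ((1 - θ) * τ) x) (C := C * ‖x‖) (by
        intro θ hθ
        rw [uIoc_of_le zero_le_one] at hθ
        rw [norm_smul]
        have h1 : ‖θ ^ k / (k ! : ℝ)‖ ≤ 1 := by
          rw [Real.norm_of_nonneg (div_nonneg (pow_nonneg hθ.1.le _) (by positivity))]
          refine div_le_one_of_le₀ ?_ (by positivity)
          exact (pow_le_one₀ hθ.1.le hθ.2).trans (by exact_mod_cast Nat.factorial_pos k)
        have h2 : ‖T ((1 - θ) * τ) x‖ ≤ C * ‖x‖ :=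
          (T _).le_of_opNorm_le (hC _ (mul_nonneg (by linarith [hθ.2]) hτ)
            (by nlinarith [hθ.1, hθ.2])) _
        nlinarith [norm_nonneg (T ((1 - θ) * τ) x), norm_nonneg (θ ^ k / (k ! : ℝ))])
    simpa [phi] using this

/-- `φ_k(τ A)` as a continuous linear map, for `τ ≥ 0` (see `phiL_apply`). -/
def phiL [CompleteSpace X] (hT : IsC0Semigroup T) (k : ℕ) (τ : ℝ) : X →L[ℝ] X :=
  LinearMap.mkContinuousOfExistsBound
    { toFun := phi T k (max τ 0)
      map_add' := by
        intro x y
        cases k with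
        | zero => simp [phi]
        | succ k =>
          simp only [phi, map_add, smul_add]
          exact intervalIntegral.integral_add (hT.intervalIntegrable_phi k (le_max_right _ _) x)
            (hT.intervalIntegrable_phi k (le_max_right _ _) y)
      map_smul' := by
        intro r x
        cases k with
        | zero => simp [phi]
        | succ k => simp only [phi, map_smul, smul_comm _ r, intervalIntegral.integral_smul,
            RingHom.id_apply] }
    (by
      obtain ⟨C, -, hC⟩ := hT.exists_norm_le (max τ 0)
      exact ⟨C, norm_phi_le hC k (le_max_right _ _) le_rfl⟩)

variable [CompleteSpace X] (hT : IsC0Semigroup T)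

theorem phiL_apply (k : ℕ) {τ : ℝ} (hτ : 0 ≤ τ) (x : X) : phiL hT k τ x = phi T k τ x := by
  change phi T k (max τ 0) x = _
  rw [max_eq_left hτ]

theorem exists_norm_phiL_le (R : ℝ) :
    ∃ C : ℝ, 0 < C ∧ ∀ k τ, τ ≤ R → ‖phiL hT k τ‖ ≤ C := by
  obtain ⟨C, hC0, hC⟩ := hT.exists_norm_le (max R 0)
  refine ⟨C, hC0, fun k τ hτ => ContinuousLinearMap.opNorm_le_bound _ hC0.le fun x => ?_⟩
  exact norm_phi_le hC k (le_max_right _ _) (max_le_max hτ le_rfl) x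

/-- `f(τ A)` as a continuous linear map, for `τ ≥ 0` (see `opL_apply`), depending linearly on the
coefficient function `f`. -/
def opL (τ : ℝ) : Coeff →ₗ[ℝ] X →L[ℝ] X :=
  Finsupp.lsum ℝ fun p => LinearMap.toSpanSingleton ℝ _ (phiL hT p.1 ((p.2 : ℝ) * τ))

theorem opL_eq_sum (f : Coeff) (τ : ℝ) :
    opL hT τ f = f.sum fun p r => r • phiL hT p.1 ((p.2 : ℝ) * τ) := rfl

theorem opL_apply (f : Coeff) {τ : ℝ} (hτ : 0 ≤ τ) (x : X) : opL hT τ f x = f.op T τ x := by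
  rw [opL_eq_sum, Coeff.op, Finsupp.sum, Finsupp.sum, sum_apply]
  refine Finset.sum_congr rfl fun p _ => ?_
  rw [smul_apply, phiL_apply hT _ (mul_nonneg (NNReal.coe_nonneg _) hτ)]

theorem exists_norm_opL_le (f : Coeff) (R : ℝ) :
    ∃ C : ℝ, 0 < C ∧ ∀ τ, τ ≤ R → ‖opL hT τ f‖ ≤ C := by
  have hb : ∀ p : ℕ × ℝ≥0, ∃ C : ℝ, 0 < C ∧ ∀ τ, τ ≤ R → ‖phiL hT p.1 (p.2 * τ)‖ ≤ C := by
    intro p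
    obtain ⟨C, hC0, hC⟩ := exists_norm_phiL_le hT (p.2 * R)
    exact ⟨C, hC0, fun τ hτ => hC _ _ (mul_le_mul_of_nonneg_left hτ p.2.2)⟩
  choose C hC0 hC using hb
  refine ⟨(∑ p ∈ f.support, ‖f p‖ * C p) + 1, ?_, fun τ hτ => ?_⟩
  · have : 0 ≤ ∑ p ∈ f.support, ‖f p‖ * C p :=
      Finset.sum_nonneg fun p _ => mul_nonneg (norm_nonneg _) (hC0 p).le
    linarith
  · rw [opL_eq_sum]
    refine (norm_sum_le _ _).trans ((Finset.sum_le_sum fun p _ => ?_).trans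
      (le_add_of_nonneg_right zero_le_one))
    rw [norm_smul]
    exact mul_le_mul_of_nonneg_left (hC p τ hτ) (norm_nonneg _)

/-- `∫_0^h e^{(h-s)A} s^k/k! x ds = h^{k+1} φ_{k+1}(hA) x`. -/
theorem integral_pow_smul_semigroup (k : ℕ) {h : ℝ} (hh : 0 ≤ h) (x : X) :
    ∫ s in (0 : ℝ)..h, T (h - s) ((s ^ k / (k ! : ℝ)) • x) =
      h ^ (k + 1) • phiL hT (k + 1) h x := by
  rw [phiL_apply hT _ hh, phi]
  have h1 := intervalIntegral.smul_integral_comp_mul_right (a := 0) (b := 1)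
    (fun s : ℝ => T (h - s) ((s ^ k / (k ! : ℝ)) • x)) h
  rw [zero_mul, one_mul] at h1
  rw [← h1, pow_succ', mul_smul, ← intervalIntegral.integral_smul (h ^ k)]
  congr 2
  funext θ
  rw [map_smul, smul_smul, show h - θ * h = (1 - θ) * h by ring]
  congr 1
  ring

end Operators

/-! ### Smoothing by analytic semigroups -/

section Sector

variable {Y : Type v} [NormedAddCommGroup Y] [NormedSpace ℂ Y] {δ : ℝ} {S : ℂ → Y →L[ℂ] Y}

/-- The bound `δ ≤ π` keeps the sector inside the slit plane, where `arg` is continuous. -/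
theorem isOpen_sector (hδ : δ ≤ Real.pi) : IsOpen (sector δ) := by
  rw [isOpen_iff_mem_nhds]
  rintro z ⟨hz, harg⟩
  have hs : z ∈ Complex.slitPlane := by
    rw [Complex.mem_slitPlane_iff_arg]
    exact ⟨fun h => by rw [h, abs_of_pos Real.pi_pos] at harg; linarith, hz⟩
  have h1 : ContinuousAt (fun z : ℂ => |z.arg|) z := (Complex.continuousAt_arg hs).abs
  filter_upwards [h1.eventually (gt_mem_nhds harg), isOpen_ne.mem_nhds hz] with w hw hw'
  exact ⟨hw', hw⟩

/-- The sector is a cone, so a disc around `1` inside it can be scaled by `t`. Radii proportional to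
`t` turn Cauchy's estimate into negative powers of `t`. -/
theorem exists_closedBall_subset_sector (hδ : 0 < δ) :
    ∃ κ : ℝ, 0 < κ ∧ κ ≤ 1 / 2 ∧ ∀ t : ℝ, 0 < t → Metric.closedBall (t : ℂ) (κ * t) ⊆ sector δ := by
  have h1 : ∀ᶠ z in 𝓝 (1 : ℂ), |z.arg| < δ := by
    have : ContinuousAt (fun z : ℂ => |z.arg|) 1 :=
      (Complex.continuousAt_arg Complex.one_mem_slitPlane).abs
    exact this.eventually (gt_mem_nhds (by simpa using hδ))
  obtain ⟨ε, hε, hball⟩ := Metric.eventually_nhds_iff.1 h1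
  refine ⟨min (ε / 2) (1 / 2), by positivity, min_le_right _ _, fun t ht z hz => ?_⟩
  rw [Metric.mem_closedBall, dist_eq_norm] at hz
  have ht' : (t : ℂ) ≠ 0 := by exact_mod_cast ht.ne'
  have hd : ‖z / t - 1‖ ≤ min (ε / 2) (1 / 2) := by
    rw [show z / t - 1 = (z - t) / t by field_simp, norm_div, Complex.norm_of_nonneg ht.le,
      div_le_iff₀ ht]
    exact hz
  have hz0 : z ≠ 0 := by
    rintro rfl
    have : ‖(0 : ℂ) / t - 1‖ = 1 := by simp
    linarith [min_le_right (ε / 2) (1 / 2 : ℝ)]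
  refine ⟨hz0, ?_⟩
  have := hball (y := z / t) (by rw [dist_eq_norm]; linarith [min_le_left (ε / 2) (1 / 2 : ℝ)])
  rwa [← Complex.arg_real_mul (z / t) ht, mul_div_cancel₀ _ ht'] at this

/-- Along points `z n → 0` of the sector with unbounded `‖S (z n)‖` every orbit would still
converge, contradicting uniform boundedness. -/
theorem IsSectorialSemigroup.exists_norm_le [CompleteSpace Y] (hS : IsSectorialSemigroup δ S) :
    ∃ ε C : ℝ, 0 < ε ∧ 0 < C ∧ ∀ z ∈ sector δ, ‖z‖ < ε → ‖S z‖ ≤ C := by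
  by_contra! hcon
  have : ∀ n : ℕ, ∃ z ∈ sector δ, ‖z‖ < 1 / ((n : ℝ) + 1) ∧ (n : ℝ) + 1 < ‖S z‖ := fun n =>
    hcon _ _ (by positivity) (by positivity)
  choose z hz hz1 hz2 using this
  have hlim : Tendsto z atTop (𝓝[sector δ] 0) := by
    refine tendsto_nhdsWithin_iff.2 ⟨?_, Eventually.of_forall hz⟩
    exact squeeze_zero_norm (fun n => (hz1 n).le) tendsto_one_div_add_atTop_nhds_zero_nat
  obtain ⟨C, hC⟩ := banach_steinhaus (g := fun n => S (z n)) (by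
    intro y
    obtain ⟨C, hC⟩ := ((hS.tendsto_zero y).comp hlim).norm.bddAbove_range
    exact ⟨C, fun n => hC ⟨n, rfl⟩⟩)
  obtain ⟨n, hn⟩ := exists_nat_gt C
  linarith [hC n, hz2 n]

/-- Cauchy's estimate on the disc of radius `κ t` around `t`. Its points have modulus at most `3 t /
2 < ε`, and the factor `2` in the constant is `2!`. -/
theorem IsSectorialSemigroup.exists_norm_deriv_deriv_le [CompleteSpace Y] (hδ : 0 < δ)
    (hδ' : δ ≤ Real.pi) (hS : IsSectorialSemigroup δ S) :
    ∃ ε C : ℝ, 0 < ε ∧ 0 < C ∧ ∀ t : ℝ, 0 < t → t < ε →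
      DifferentiableAt ℂ S t ∧ DifferentiableAt ℂ (deriv S) t ∧
      ‖deriv (deriv S) t‖ ≤ C / t ^ 2 := by
  obtain ⟨ε, C, hε, hC0, hC⟩ := hS.exists_norm_le
  obtain ⟨κ, hκ, hκ', hball⟩ := exists_closedBall_subset_sector hδ
  refine ⟨ε / 2, 2 * C / κ ^ 2, by positivity, by positivity, fun t ht htε => ?_⟩
  have hmem : sector δ ∈ 𝓝 (t : ℂ) := (isOpen_sector hδ').mem_nhds
    (hball t ht (Metric.mem_closedBall_self (by positivity)))
  refine ⟨hS.analytic.differentiableAt hmem,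
    (hS.analytic.deriv (isOpen_sector hδ')).differentiableAt hmem, ?_⟩
  have := Complex.norm_iteratedDeriv_le_of_forall_mem_sphere_norm_le (c := (t : ℂ)) (R := κ * t)
    (C := C) (f := S) 2 (by positivity)
    ((hS.analytic.mono (hball t ht)).diffContOnCl_ball subset_rfl) (by
      intro z hz
      refine hC z (hball t ht (Metric.sphere_subset_closedBall hz)) ?_
      rw [mem_sphere_iff_norm] at hz
      have h1 : ‖z‖ ≤ ‖z - t‖ + ‖(t : ℂ)‖ := by simpa using norm_add_le (z - t) (t : ℂ)
      rw [hz, Complex.norm_of_nonneg ht.le] at h1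
      nlinarith)
  rw [iteratedDeriv_succ, iteratedDeriv_one] at this
  refine this.trans (le_of_eq ?_)
  rw [Nat.factorial_two]
  push_cast
  field_simp

end Sector

theorem _root_.HasDerivAt.comp_ofReal_vec {E : Type*} [NormedAddCommGroup E] [NormedSpace ℝ E]
    [NormedSpace ℂ E] [IsScalarTower ℝ ℂ E] {f : ℂ → E} {f' : E} {t : ℝ}
    (hf : HasDerivAt f f' (t : ℂ)) : HasDerivAt (fun r : ℝ => f r) f' t := by
  have := HasDerivAt.scomp t hf Complex.ofRealCLM.hasDerivAt
  rwa [Complex.ofRealCLM_apply, Complex.ofReal_one, one_smul] at this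

/-- The error of linear interpolation. -/
theorem norm_sub_linear_interpolation_le {E : Type*} [NormedAddCommGroup E] [NormedSpace ℝ E]
    {f f' f'' : ℝ → E} {t H K : ℝ} (hH : 0 < H)
    (hf : ∀ x ∈ Icc t (t + H), HasDerivAt f (f' x) x)
    (hf' : ∀ x ∈ Icc t (t + H), HasDerivAt f' (f'' x) x)
    (hK : ∀ x ∈ Icc t (t + H), ‖f'' x‖ ≤ K) {s : ℝ} (hs : s ∈ Icc 0 H) :
    ‖f (t + s) - (1 - s / H) • f t - (s / H) • f (t + H)‖ ≤ 2 * K * H ^ 2 := by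
  have hK0 : 0 ≤ K := (norm_nonneg _).trans (hK t ⟨le_rfl, by linarith⟩)
  have h1 : ∀ x ∈ Icc t (t + H), ‖f' x - f' t‖ ≤ K * H := by
    intro x hx
    have := (convex_Icc t (t + H)).norm_image_sub_le_of_norm_hasDerivWithin_le
      (fun y hy => (hf' y hy).hasDerivWithinAt) hK (left_mem_Icc.2 (by linarith)) hx
    refine this.trans (mul_le_mul_of_nonneg_left ?_ hK0)
    rw [Real.norm_eq_abs, abs_of_nonneg (by linarith [hx.1])]
    linarith [hx.2]
  have h2 : ∀ s ∈ Icc 0 H, ‖f (t + s) - f t - s • f' t‖ ≤ K * H ^ 2 := by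
    intro s hs
    have := (convex_Icc t (t + H)).norm_image_sub_le_of_norm_hasDerivWithin_le
      (f := fun x => f x - (x - t) • f' t) (f' := fun x => f' x - f' t) (C := K * H)
      (fun y hy => by
        have h3 := (((hasDerivAt_id y).sub_const t).smul_const (f' t))
        simp only [one_smul, id] at h3
        exact ((hf y hy).sub h3).hasDerivWithinAt) h1
      (left_mem_Icc.2 (by linarith)) (y := t + s) ⟨by linarith [hs.1], by linarith [hs.2]⟩
    simp only [sub_self, zero_smul, sub_zero, add_sub_cancel_left, Real.norm_eq_abs,
      abs_of_nonneg hs.1] at this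
    rw [sub_right_comm]
    refine this.trans ?_
    nlinarith [hs.2, mul_nonneg hK0 hH.le]
  have h3 := h2 s hs
  have h4 := h2 H ⟨hH.le, le_rfl⟩
  -- The linear Taylor parts at `s` and at `H` cancel exactly, leaving two remainders of size at
  -- most `K H ^ 2` each.
  have h5 : f (t + s) - (1 - s / H) • f t - (s / H) • f (t + H) =
      (f (t + s) - f t - s • f' t) - (s / H) • (f (t + H) - f t - H • f' t) := by
    rw [smul_sub (s / H) _ (H • _), smul_smul, div_mul_cancel₀ _ hH.ne']
    module
  have h6 : ‖(s / H) • (f (t + H) - f t - H • f' t)‖ ≤ K * H ^ 2 := by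
    rw [norm_smul, Real.norm_of_nonneg (div_nonneg hs.1 hH.le)]
    have : s / H ≤ 1 := div_le_one_of_le₀ hs.2 hH.le
    nlinarith [norm_nonneg (f (t + H) - f t - H • f' t)]
  rw [h5]
  refine (norm_sub_le _ _).trans ?_
  linarith

/-! ### Interpolation of analytic semigroups and bounded sums along the time grid -/

section Smoothing

variable {X : Type v} [NormedAddCommGroup X] [NormedSpace ℝ X] [CompleteSpace X]
  {T : ℝ → X →L[ℝ] X}

/-- For small steps `H`, linear interpolation of an analytic semigroup on `[t, t + H]` has an error
bounded by a multiple of `(H / t) ^ 2`. -/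
theorem IsAnalyticSemigroup.exists_interpolation_bound (hT : IsAnalyticSemigroup T) :
    ∃ H₀ : ℝ, 0 < H₀ ∧ ∀ R : ℝ, ∃ C : ℝ, 0 < C ∧ ∀ t H s : ℝ, 0 < t → t ≤ R → 0 < H → H ≤ H₀ →
      s ∈ Icc 0 H → ∀ x,
      ‖T (t + s) x - (1 - s / H) • T t x - (s / H) • T (t + H) x‖ ≤ C * (H / t) ^ 2 * ‖x‖ := by
  obtain ⟨hT0, Y, _, _, _, ι, δ, S, hδ, hδ', hS, hSι⟩ := hT
  obtain ⟨ε, C, hε, hC0, hC⟩ := hS.exists_norm_deriv_deriv_le hδ (by linarith [Real.pi_pos])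
  have hsmall : ∀ t H s : ℝ, 0 < t → 0 < H → t + H < ε → s ∈ Icc 0 H → ∀ x,
      ‖T (t + s) x - (1 - s / H) • T t x - (s / H) • T (t + H) x‖ ≤
        2 * C * (H / t) ^ 2 * ‖x‖ := by
    intro t H s ht hH htH hs x
    have hder := norm_sub_linear_interpolation_le (f := fun r : ℝ => S (r : ℂ))
      (f' := fun r : ℝ => deriv S (r : ℂ)) (f'' := fun r : ℝ => deriv (deriv S) (r : ℂ)) (t := t)
      (H := H) (K := C / t ^ 2) hH
      (fun r hr => (hC r (by linarith [hr.1]) (by linarith [hr.2])).1.hasDerivAt.comp_ofReal_vec)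
      (fun r hr => (hC r (by linarith [hr.1]) (by linarith [hr.2])).2.1.hasDerivAt.comp_ofReal_vec)
      (fun r hr => by
        refine (hC r (by linarith [hr.1]) (by linarith [hr.2])).2.2.trans ?_
        have := hr.1
        gcongr) hs
    have h1 := ContinuousLinearMap.le_of_opNorm_le _ hder (ι x)
    have h2 : ι (T (t + s) x - (1 - s / H) • T t x - (s / H) • T (t + H) x) =
        (S (t + s : ℝ) - (1 - s / H) • S t - (s / H) • S (t + H : ℝ)) (ι x) := by
      simp only [map_sub, map_smul, ← hSι (t + s) (by linarith [hs.1]) x, ← hSι t ht.le x,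
        ← hSι (t + H) (by linarith) x]
      rfl
    rw [← h2, ι.norm_map, ι.norm_map] at h1
    refine h1.trans (le_of_eq ?_)
    field_simp
  -- With `H ≤ ε / 4` one has `t + H < ε` for all `t ≤ ε / 4`, including the base point `ε / 4` used
  -- for larger times.
  refine ⟨ε / 4, by positivity, fun R => ?_⟩
  obtain ⟨M, hM0, hM⟩ := hT0.exists_norm_le R
  refine ⟨2 * C + M * (2 * C * (R / (ε / 4)) ^ 2), by positivity,
    fun t H s ht htR hH hHε hs x => ?_⟩
  rw [add_mul, add_mul]
  have hR : 0 < R := ht.trans_le htR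
  rcases lt_or_ge t (ε / 4) with htε | htε
  · refine (hsmall t H s ht hH (by linarith) hs x).trans (le_add_of_nonneg_right (by positivity))
  -- For larger `t` the bounded factor `T (t - ε / 4)` is split off and the interpolation takes
  -- place at `ε / 4`; since `t ≤ R`, the quotient `H / (ε / 4)` is at most a multiple of `H / t`.
  · have hsplit : ∀ r, 0 ≤ r → T (t + r) x = T (t - ε / 4) (T (ε / 4 + r) x) := by
      intro r hr
      have := hT0.map_add (t - ε / 4) (ε / 4 + r) (by linarith) (by linarith)
      rw [show t - ε / 4 + (ε / 4 + r) = t + r by ring] at this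
      rw [this]; rfl
    have h0 := hsplit 0 le_rfl
    rw [add_zero, add_zero] at h0
    rw [hsplit s hs.1, hsplit H hH.le, h0, ← (T (t - ε / 4)).map_smul,
      ← (T (t - ε / 4)).map_smul, ← map_sub, ← map_sub]
    refine ((T _).le_of_opNorm_le (hM _ (by linarith) (by linarith)) _).trans ?_
    refine le_trans ?_ (le_add_of_nonneg_left (by positivity))
    have h3 := hsmall (ε / 4) H s (by positivity) hH (by linarith) hs x
    have h4 : (H / (ε / 4)) ^ 2 ≤ (R / (ε / 4)) ^ 2 * (H / t) ^ 2 := by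
      rw [← mul_pow]
      refine pow_le_pow_left₀ (by positivity) ?_ 2
      rw [div_mul_div_comm, div_le_div_iff₀ (by positivity) (by positivity)]
      have : 0 ≤ H * (ε / 4) := by positivity
      nlinarith
    calc M * _ ≤ M * (2 * C * (H / (ε / 4)) ^ 2 * ‖x‖) := by gcongr
      _ ≤ M * (2 * C * ((R / (ε / 4)) ^ 2 * (H / t) ^ 2) * ‖x‖) := by gcongr
      _ = _ := by ring

theorem exists_sum_inv_sq_le : ∃ C : ℝ, 0 < C ∧ ∀ n : ℕ,
    ∑ j ∈ Finset.range n, 1 / ((j : ℝ) + 1) ^ 2 ≤ C := by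
  have h : Summable fun j : ℕ => 1 / ((j : ℝ) + 1) ^ 2 := by
    have := (summable_nat_add_iff 1).2 (Real.summable_one_div_nat_pow.2 one_lt_two)
    simpa using this
  refine ⟨∑' j : ℕ, 1 / ((j : ℝ) + 1) ^ 2, h.tsum_pos (fun j => by positivity) 0 (by simp),
    fun n => h.sum_le_tsum _ fun j _ => by positivity⟩

/-- `∑_{j<n} e^{jhA} (e^{θhA} - 1)` is bounded, uniformly for `h → 0`, `nh ≤ R` and `θ ≤ N`. -/
theorem IsAnalyticSemigroup.exists_sum_sub_bound (hT : IsAnalyticSemigroup T) (R : ℝ) (N : ℕ)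
    (hN : 0 < N) : ∃ h₀ C : ℝ, 0 < h₀ ∧ 0 < C ∧ ∀ h : ℝ, 0 < h → h ≤ h₀ → ∀ n : ℕ, n * h ≤ R →
      ∀ θ ∈ Icc (0 : ℝ) N, ∀ x,
      ‖∑ j ∈ Finset.range n, T (j * h) (T (θ * h) x - x)‖ ≤ C * ‖x‖ := by
  obtain ⟨H₀, hH₀, hint⟩ := hT.exists_interpolation_bound
  obtain ⟨C, hC0, hC⟩ := hint R
  obtain ⟨hT0, -⟩ := hT
  obtain ⟨K, hK0, hK⟩ := exists_sum_inv_sq_le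
  have hN' : (0 : ℝ) < N := by exact_mod_cast hN
  obtain ⟨M, hM0, hM⟩ := hT0.exists_norm_le (max R 0 + H₀)
  -- The step bound ensures `N h ≤ H₀`. In the constant, `3 M` covers the interpolation error at `j
  -- = 0`, `4 C N ^ 2` those at `j ≥ 1` through `1 / j ^ 2 ≤ 4 / (j + 1) ^ 2`, and `N (2 M)` the
  -- boundary terms of the telescoping sum.
  refine ⟨H₀ / N, (3 * M + 4 * C * N ^ 2) * K + N * (2 * M), by positivity, by positivity,
    fun h hh hh₀ n hn θ hθ x => ?_⟩
  rw [le_div_iff₀ hN', mul_comm] at hh₀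
  have hMx : ∀ t, 0 ≤ t → t ≤ max R 0 + H₀ → ‖T t x‖ ≤ M * ‖x‖ := fun t h0 h1 =>
    (T t).le_of_opNorm_le (hM t h0 h1) x
  have hjR : ∀ j : ℕ, j ≤ n → (j : ℝ) * h ≤ max R 0 := fun j hj => by
    refine le_trans ?_ (hn.trans (le_max_left _ _))
    gcongr
  have hθN : 0 ≤ θ / N := div_nonneg hθ.1 hN'.le
  have hθN' : θ / N ≤ 1 := div_le_one_of_le₀ hθ.2 hN'.le
  -- A bound by the first derivative would give terms of size `1 / j` and hence a logarithm.
  -- Subtracting the interpolant over `N` whole steps leaves a summable error `D j`, and the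
  -- interpolant contributes differences that telescope.
  set D : ℕ → X := fun j => T (j * h + θ * h) x - (1 - θ / N) • T (j * h) x -
    (θ / N) • T (j * h + N * h) x with hD
  have hDbound : ∀ j ∈ Finset.range n,
      ‖D j‖ ≤ (3 * M + 4 * C * N ^ 2) * ‖x‖ * (1 / ((j : ℝ) + 1) ^ 2) := by
    intro j hj
    have hjn := (Finset.mem_range.1 hj).le
    have hθh : θ * h ≤ N * h := by gcongr; exact hθ.2
    rcases Nat.eq_zero_or_pos j with rfl | hj0
    · simp only [hD, Nat.cast_zero, zero_mul, zero_add, one_pow, div_one, mul_one]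
      have h0R := le_max_right R 0
      have h1 := hMx (θ * h) (mul_nonneg hθ.1 hh.le) (by linarith)
      have h2 : ‖(1 - θ / N) • T 0 x‖ ≤ M * ‖x‖ := by
        rw [norm_smul, Real.norm_of_nonneg (by linarith)]
        have := hMx 0 le_rfl (by linarith)
        nlinarith [norm_nonneg (T 0 x)]
      have h3 : ‖(θ / N) • T (N * h) x‖ ≤ M * ‖x‖ := by
        rw [norm_smul, Real.norm_of_nonneg hθN]
        have := hMx (N * h) (by positivity) (by linarith)
        nlinarith [norm_nonneg (T (N * h) x)]
      have h4 := norm_sub_le (T (θ * h) x - (1 - θ / N) • T 0 x) ((θ / N) • T (N * h) x)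
      have h5 := norm_sub_le (T (θ * h) x) ((1 - θ / N) • T 0 x)
      have h6 : 0 ≤ 4 * C * N ^ 2 * ‖x‖ := by positivity
      linarith
    · have hj1 : (1 : ℝ) ≤ j := by exact_mod_cast hj0
      have h1 := hC (j * h) (N * h) (θ * h) (by positivity) 
        ((by gcongr : (j : ℝ) * h ≤ n * h).trans hn)
        (by positivity) hh₀ ⟨mul_nonneg hθ.1 hh.le, hθh⟩ x
      rw [mul_div_mul_right _ _ hh.ne', mul_div_mul_right _ _ hh.ne'] at h1
      refine h1.trans ?_
      have h2 : ((N : ℝ) / j) ^ 2 ≤ 4 * N ^ 2 * (1 / ((j : ℝ) + 1) ^ 2) := by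
        rw [div_pow, mul_one_div, div_le_div_iff₀ (by positivity) (by positivity)]
        have : ((j : ℝ) + 1) ^ 2 ≤ 4 * (j : ℝ) ^ 2 := by nlinarith
        nlinarith [sq_nonneg (N : ℝ)]
      have h3 : 0 ≤ 3 * M * ‖x‖ * (1 / ((j : ℝ) + 1) ^ 2) := by positivity
      calc C * ((N : ℝ) / j) ^ 2 * ‖x‖
          ≤ C * (4 * N ^ 2 * (1 / ((j : ℝ) + 1) ^ 2)) * ‖x‖ := by gcongr
        _ ≤ _ := by linarith
  have hsplit : ∀ j ∈ Finset.range n, T (j * h) (T (θ * h) x - x) =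
      D j + (θ / N) • (T (((N + j : ℕ) : ℝ) * h) x - T ((j : ℝ) * h) x) := by
    intro j _
    have h1 := hT0.map_add (j * h) (θ * h) (by positivity) (mul_nonneg hθ.1 hh.le)
    have h2 : T (j * h + θ * h) x = T (j * h) (T (θ * h) x) := by rw [h1]; rfl
    have h3 : ((N + j : ℕ) : ℝ) * h = j * h + N * h := by push_cast; ring
    simp only [hD, map_sub, h2, h3]
    module
  have htel : ∑ j ∈ Finset.range n, (T (((N + j : ℕ) : ℝ) * h) x - T ((j : ℝ) * h) x) =
      ∑ j ∈ Finset.range N, (T (((n + j : ℕ) : ℝ) * h) x - T ((j : ℝ) * h) x) := by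
    have h1 := Finset.sum_range_add (fun j : ℕ => T ((j : ℝ) * h) x) n N
    have h2 := Finset.sum_range_add (fun j : ℕ => T ((j : ℝ) * h) x) N n
    rw [add_comm N n, h1] at h2
    rw [Finset.sum_sub_distrib, Finset.sum_sub_distrib, sub_eq_sub_iff_add_eq_add,
      add_comm _ (∑ j ∈ Finset.range N, T ((j : ℝ) * h) x),
      add_comm _ (∑ j ∈ Finset.range n, T ((j : ℝ) * h) x), h2]
  rw [Finset.sum_congr rfl hsplit, Finset.sum_add_distrib, ← Finset.smul_sum, htel]
  have h1 : ‖∑ j ∈ Finset.range n, D j‖ ≤ (3 * M + 4 * C * N ^ 2) * K * ‖x‖ := by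
    refine (norm_sum_le_of_le _ hDbound).trans ?_
    rw [← Finset.mul_sum]
    have := hK n
    calc _ ≤ (3 * M + 4 * C * N ^ 2) * ‖x‖ * K := by gcongr
      _ = _ := by ring
  have h2 : ‖(θ / N) • ∑ j ∈ Finset.range N,
      (T (((n + j : ℕ) : ℝ) * h) x - T ((j : ℝ) * h) x)‖ ≤ N * (2 * M) * ‖x‖ := by
    rw [norm_smul, Real.norm_of_nonneg hθN]
    have h3 : ‖∑ j ∈ Finset.range N, (T (((n + j : ℕ) : ℝ) * h) x - T ((j : ℝ) * h) x)‖ ≤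
        N * (2 * M) * ‖x‖ := by
      refine (norm_sum_le_of_le (f := fun j : ℕ => T (((n + j : ℕ) : ℝ) * h) x - T ((j : ℝ) * h) x)
        _ (n := fun _ => 2 * M * ‖x‖) fun j hj => ?_).trans ?_
      · have hjN : (j : ℝ) * h ≤ N * h := by
          gcongr; exact (Finset.mem_range.1 hj).le
        have h4 := hMx (((n + j : ℕ) : ℝ) * h) (by positivity) (by
          push_cast; linarith [hjR n le_rfl])
        have h5 := hMx (j * h) (by positivity) (by linarith [le_max_right R 0])
        linarith [norm_sub_le (T (((n + j : ℕ) : ℝ) * h) x) (T ((j : ℝ) * h) x)]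
      · simp only [Finset.sum_const, Finset.card_range, nsmul_eq_mul]
        exact le_of_eq (by ring)
    refine le_trans ?_ h3
    exact mul_le_of_le_one_left (norm_nonneg _) hθN'
  refine (norm_add_le _ _).trans ?_
  linarith

/-- For `k ≥ 1`, `φ_k(σhA) - φ_k(0)` is a weighted integral of `T ((1 - θ) σ h) - 1`, so the bound
for semigroup differences passes under the integral; any integer `N > σ` covers all these times. -/
theorem IsAnalyticSemigroup.exists_sum_phiL_sub_bound (hT : IsAnalyticSemigroup T) (R : ℝ) (k : ℕ)
    (σ : ℝ≥0) : ∃ h₀ C : ℝ, 0 < h₀ ∧ 0 < C ∧ ∀ h : ℝ, 0 < h → h ≤ h₀ → ∀ n : ℕ, n * h ≤ R →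
      ∀ x, ‖∑ j ∈ Finset.range n, T (j * h) (phiL hT.1 k (σ * h) x - phiL hT.1 k (σ * 0) x)‖ ≤
        C * ‖x‖ := by
  obtain ⟨N, hN⟩ := exists_nat_gt (σ : ℝ)
  have hN0 : 0 < N := by exact_mod_cast (NNReal.coe_nonneg σ).trans_lt hN
  obtain ⟨h₀, C, hh₀, hC0, hC⟩ := hT.exists_sum_sub_bound R N hN0
  refine ⟨h₀, C, hh₀, hC0, fun h hh hhh₀ n hn x => ?_⟩
  have hσ := NNReal.coe_nonneg σ
  rw [phiL_apply _ _ (by positivity), phiL_apply _ _ (by simp)]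
  cases k with
  | zero =>
    have := hC h hh hhh₀ n hn σ ⟨hσ, hN.le⟩ x
    simpa [phi, hT.1.map_zero] using this
  | succ k =>
    have h1 := hT.1.intervalIntegrable_phi k (τ := σ * h) (by positivity) x
    have h2 := hT.1.intervalIntegrable_phi k (τ := σ * 0) (by simp) x
    have h3 : ∑ j ∈ Finset.range n, T (j * h) (phi T (k + 1) (σ * h) x - phi T (k + 1) (σ * 0) x) =
        ∫ θ in (0 : ℝ)..1, (θ ^ k / (k ! : ℝ)) •
          ∑ j ∈ Finset.range n, T (j * h) (T ((1 - θ) * σ * h) x - x) := by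
      rw [phi, phi, ← intervalIntegral.integral_sub h1 h2]
      have h4 := ContinuousLinearMap.intervalIntegral_comp_comm
        (∑ j ∈ Finset.range n, T (j * h)) (h1.sub h2)
      simp only [sum_apply] at h4
      rw [← h4]
      congr 1
      funext θ
      rw [Finset.smul_sum]
      refine Finset.sum_congr rfl fun j _ => ?_
      simp [hT.1.map_zero, mul_assoc, smul_sub]
    rw [h3]
    have := intervalIntegral.norm_integral_le_of_norm_le_const (a := 0) (b := 1)
      (f := fun θ : ℝ => (θ ^ k / (k ! : ℝ)) •
          ∑ j ∈ Finset.range n, T (j * h) (T ((1 - θ) * σ * h) x - x)) (C := C * ‖x‖) (by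
        intro θ hθ
        rw [uIoc_of_le zero_le_one] at hθ
        rw [norm_smul]
        have h1 : ‖θ ^ k / (k ! : ℝ)‖ ≤ 1 := by
          rw [Real.norm_of_nonneg (div_nonneg (pow_nonneg hθ.1.le _) (by positivity))]
          refine div_le_one_of_le₀ ?_ (by positivity)
          exact (pow_le_one₀ hθ.1.le hθ.2).trans (by exact_mod_cast Nat.factorial_pos k)
        refine (mul_le_of_le_one_left (norm_nonneg _) h1).trans ?_
        exact hC h hh hhh₀ n hn _ ⟨mul_nonneg (by linarith [hθ.2]) hσ, by nlinarith [hθ.1]⟩ x)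
    simpa using this

/-- `∑_{j<n} e^{jhA} (f(hA) - f(0))` is bounded, uniformly for `h → 0` and `nh ≤ R`. -/
theorem IsAnalyticSemigroup.exists_sum_opL_sub_bound (hT : IsAnalyticSemigroup T) (R : ℝ)
    (f : Coeff) : ∃ h₀ C : ℝ, 0 < h₀ ∧ 0 < C ∧ ∀ h : ℝ, 0 < h → h ≤ h₀ → ∀ n : ℕ, n * h ≤ R →
      ∀ x, ‖∑ j ∈ Finset.range n, T (j * h) ((opL hT.1 h f - opL hT.1 0 f) x)‖ ≤ C * ‖x‖ := by
  induction f using Finsupp.induction_linear with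
  | zero => exact ⟨1, 1, one_pos, one_pos, fun h _ _ n _ x => by simp⟩
  | add f g hf hg =>
    obtain ⟨h₁, C₁, hh₁, hC₁, H₁⟩ := hf
    obtain ⟨h₂, C₂, hh₂, hC₂, H₂⟩ := hg
    refine ⟨min h₁ h₂, C₁ + C₂, lt_min hh₁ hh₂, by positivity, fun h hh hle n hn x => ?_⟩
    have e1 := H₁ h hh (hle.trans (min_le_left _ _)) n hn x
    have e2 := H₂ h hh (hle.trans (min_le_right _ _)) n hn x
    rw [add_mul]
    refine le_trans (le_of_eq ?_) ((norm_add_le _ _).trans (add_le_add e1 e2))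
    rw [← Finset.sum_add_distrib]
    congr 1
    refine Finset.sum_congr rfl fun j _ => ?_
    simp only [map_add, sub_apply, add_apply, map_sub]
    abel
  | single p r =>
    obtain ⟨h₁, C₁, hh₁, hC₁, H₁⟩ := hT.exists_sum_phiL_sub_bound R p.1 p.2
    refine ⟨h₁, (|r| + 1) * C₁, hh₁, by positivity, fun h hh hle n hn x => ?_⟩
    have e1 := H₁ h hh hle n hn x
    have e2 : ∑ j ∈ Finset.range n, T (j * h)
        ((opL hT.1 h (Finsupp.single p r) - opL hT.1 0 (Finsupp.single p r)) x) =
        r • ∑ j ∈ Finset.range n,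
          T (j * h) (phiL hT.1 p.1 (p.2 * h) x - phiL hT.1 p.1 (p.2 * 0) x) := by
      rw [Finset.smul_sum]
      refine Finset.sum_congr rfl fun j _ => ?_
      rw [← map_smul, smul_sub]
      simp [opL_eq_sum]
    rw [e2, norm_smul, Real.norm_eq_abs, mul_assoc]
    nlinarith [abs_nonneg r, norm_nonneg (∑ j ∈ Finset.range n,
          T (j * h) (phiL hT.1 p.1 (p.2 * h) x - phiL hT.1 p.1 (p.2 * 0) x))]

/-- Abel summation: bounds for the partial sums `∑_{j<m} P_j` carry over to
`∑_{j<n} P_{n-1-j} w_j` if `w` varies slowly. -/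
theorem norm_sum_convolution_sub_le {E : Type*} [NormedAddCommGroup E] [NormedSpace ℝ E]
    (P : ℕ → E →L[ℝ] E) {C : ℝ} (n : ℕ)
    (hC : ∀ m ≤ n, ∀ x, ‖∑ j ∈ Finset.range m, P j x‖ ≤ C * ‖x‖) (w : ℕ → E) :
    ‖∑ j ∈ Finset.range n, P (n - 1 - j) (w j) - ∑ j ∈ Finset.range n, P j (w 0)‖ ≤
      C * ∑ j ∈ Finset.range n, ‖w (j + 1) - w j‖ := by
  induction n generalizing w with
  | zero => simp
  | succ n ih =>
    have h1 := ih (fun m hm => hC m (hm.trans n.le_succ)) fun j => w (j + 1)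
    -- The term `P n (w 0)` occurs in both sums and cancels. What remains is the claim for the
    -- shifted sequence and a partial sum applied to the first increment of `w`.
    have h2 : ∑ j ∈ Finset.range (n + 1), P (n + 1 - 1 - j) (w j) -
        ∑ j ∈ Finset.range (n + 1), P j (w 0) =
        (∑ j ∈ Finset.range n, P (n - 1 - j) (w (j + 1)) - ∑ j ∈ Finset.range n, P j (w (0 + 1))) +
          ∑ j ∈ Finset.range n, P j (w 1 - w 0) := by
      rw [Finset.sum_range_succ', Finset.sum_range_succ]
      have h3 : ∑ j ∈ Finset.range n, P (n + 1 - 1 - (j + 1)) (w (j + 1)) =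
          ∑ j ∈ Finset.range n, P (n - 1 - j) (w (j + 1)) :=
        Finset.sum_congr rfl fun j _ => by rw [show n + 1 - 1 - (j + 1) = n - 1 - j by omega]
      rw [h3]
      simp only [Nat.add_sub_cancel, map_sub, Finset.sum_sub_distrib, Nat.sub_zero, zero_add]
      abel
    rw [h2, Finset.sum_range_succ', mul_add]
    exact (norm_add_le _ _).trans (add_le_add h1 (hC n n.le_succ _))

end Smoothing

/-! ### Coefficient functions as scalar functions -/

/-- The functional `F ↦ ∫_0^1 F((1-θ)σ) θ^{k-1}/(k-1)! dθ` for `k ≥ 1`, and `F ↦ F(σ)` for `k = 0`.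
It sends `t ↦ e^{tz}` to `φ_k(σz)`. -/
def phiTest (F : ℝ → ℝ) : ℕ → ℝ → ℝ
  | 0, σ => F σ
  | k + 1, σ => ∫ θ in (0 : ℝ)..1, (θ ^ k / (k ! : ℝ)) * F ((1 - θ) * σ)

/-- The extension of `phiTest` to coefficient functions. -/
def Coeff.test (F : ℝ → ℝ) : Coeff →ₗ[ℝ] ℝ :=
  Finsupp.lsum ℝ fun p => LinearMap.toSpanSingleton ℝ ℝ (phiTest F p.1 p.2)

/-- The value `f(z)` of a coefficient function at a real number `z`. -/
def Coeff.scal (z : ℝ) : Coeff →ₗ[ℝ] ℝ := Coeff.test fun t => Real.exp (t * z)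

theorem Coeff.test_eq_sum (F : ℝ → ℝ) (f : Coeff) :
    Coeff.test F f = f.sum fun p r => r * phiTest F p.1 p.2 := rfl

section Test

variable {F G : ℝ → ℝ}

theorem continuousOn_phiTest (hF : ContinuousOn F (Ici 0)) (k : ℕ) {σ : ℝ} (hσ : 0 ≤ σ) :
    ContinuousOn (fun θ : ℝ => (θ ^ k / (k ! : ℝ)) * F ((1 - θ) * σ)) (uIcc 0 1) := by
  refine ContinuousOn.mul (by fun_prop) (hF.comp (by fun_prop) ?_)
  intro θ hθ
  rw [uIcc_of_le zero_le_one] at hθ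
  exact mul_nonneg (by linarith [hθ.2]) hσ

theorem phiTest_add (hF : ContinuousOn F (Ici 0)) (hG : ContinuousOn G (Ici 0)) (k : ℕ) {σ : ℝ}
    (hσ : 0 ≤ σ) : phiTest (fun t => F t + G t) k σ = phiTest F k σ + phiTest G k σ := by
  cases k with
  | zero => rfl
  | succ k =>
    simp only [phiTest, mul_add]
    exact intervalIntegral.integral_add (continuousOn_phiTest hF k hσ).intervalIntegrable
      (continuousOn_phiTest hG k hσ).intervalIntegrable

theorem phiTest_const_mul (c : ℝ) (k : ℕ) (σ : ℝ) :
    phiTest (fun t => c * F t) k σ = c * phiTest F k σ := by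
  cases k with
  | zero => rfl
  | succ k =>
    simp only [phiTest, ← intervalIntegral.integral_const_mul]
    congr 1
    funext θ
    ring

theorem Coeff.test_add (hF : ContinuousOn F (Ici 0)) (hG : ContinuousOn G (Ici 0)) (f : Coeff) :
    Coeff.test (fun t => F t + G t) f = Coeff.test F f + Coeff.test G f := by
  simp only [Coeff.test_eq_sum, Finsupp.sum, ← Finset.sum_add_distrib, ← mul_add]
  exact Finset.sum_congr rfl fun p _ => by rw [phiTest_add hF hG _ (NNReal.coe_nonneg _)]

theorem Coeff.test_const_mul (c : ℝ) (f : Coeff) :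
    Coeff.test (fun t => c * F t) f = c * Coeff.test F f := by
  simp only [Coeff.test_eq_sum, Finsupp.sum, Finset.mul_sum]
  exact Finset.sum_congr rfl fun p _ => by rw [phiTest_const_mul]; ring

theorem abs_phiTest_le {ε R : ℝ} (hF : ∀ t ∈ Icc 0 R, |F t| ≤ ε) (k : ℕ) {σ : ℝ} (hσ : 0 ≤ σ)
    (hσR : σ ≤ R) : |phiTest F k σ| ≤ ε := by
  cases k with
  | zero => exact hF _ ⟨hσ, hσR⟩
  | succ k =>
    have := intervalIntegral.norm_integral_le_of_norm_le_const (a := 0) (b := 1)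
      (f := fun θ : ℝ => (θ ^ k / (k ! : ℝ)) * F ((1 - θ) * σ)) (C := ε) (by
        intro θ hθ
        rw [uIoc_of_le zero_le_one] at hθ
        rw [norm_mul]
        have h1 : ‖θ ^ k / (k ! : ℝ)‖ ≤ 1 := by
          rw [Real.norm_of_nonneg (div_nonneg (pow_nonneg hθ.1.le _) (by positivity))]
          refine div_le_one_of_le₀ ?_ (by positivity)
          exact (pow_le_one₀ hθ.1.le hθ.2).trans (by exact_mod_cast Nat.factorial_pos k)
        refine (mul_le_of_le_one_left (norm_nonneg _) h1).trans ?_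
        exact hF _ ⟨mul_nonneg (by linarith [hθ.2]) hσ, by nlinarith [hθ.1, hθ.2]⟩)
    simpa [phiTest] using this

/-- A polynomial in `e^t` is a combination of exponentials `e^{nt}`, and testing against these gives
the values `f(n) = 0`. -/
theorem Coeff.test_polynomial_exp {f : Coeff} (hf : ∀ z, Coeff.scal z f = 0)
    (P : Polynomial ℝ) : Coeff.test (fun t => P.eval (Real.exp t)) f = 0 := by
  induction P using Polynomial.induction_on' with
  | add P Q hP hQ =>
    simp only [Polynomial.eval_add]
    rw [Coeff.test_add (by fun_prop) (by fun_prop), hP, hQ, add_zero]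
  | monomial n a =>
    simp only [Polynomial.eval_monomial, ← Real.exp_nat_mul]
    rw [Coeff.test_const_mul]
    have := hf n
    simp only [Coeff.scal] at this
    simp only [mul_comm (n : ℝ), this, mul_zero]

/-- A coefficient function that vanishes on the real line is annihilated by every continuous test
function: exponential sums are dense in the continuous functions on a compact interval. -/
theorem Coeff.test_eq_zero {f : Coeff} (hf : ∀ z, Coeff.scal z f = 0)
    (hF : ContinuousOn F (Ici 0)) : Coeff.test F f = 0 := by
  -- Any common upper bound for the scales `σ` in the support would do; the test only sees `F` on
  -- `[0, R]`.
  set R : ℝ := ∑ p ∈ f.support, (p.2 : ℝ) with hR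
  have hσR : ∀ p ∈ f.support, (p.2 : ℝ) ≤ R := fun p hp =>
    Finset.single_le_sum (f := fun p : ℕ × ℝ≥0 => (p.2 : ℝ)) (fun p _ => NNReal.coe_nonneg _) hp
  have key : ∀ ε : ℝ, 0 < ε → |Coeff.test F f| ≤ (∑ p ∈ f.support, |f p|) * ε := by
    intro ε hε
    -- The substitution `s = e^t` makes monomials out of exponentials, so that Weierstrass
    -- approximation applies.
    have hlog : ContinuousOn (fun s => F (Real.log s)) (Icc 1 (Real.exp R)) := by
      refine hF.comp (Real.continuousOn_log.mono fun s hs => ?_) fun s hs => Real.log_nonneg hs.1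
      exact (zero_lt_one.trans_le hs.1).ne'
    obtain ⟨P, hP⟩ := exists_polynomial_near_of_continuousOn 1 (Real.exp R) _ hlog ε hε
    have hPc : ContinuousOn (fun t => (-1) * P.eval (Real.exp t)) (Ici 0) := by fun_prop
    have h1 : Coeff.test F f = Coeff.test (fun t => F t + (-1) * P.eval (Real.exp t)) f := by
      rw [Coeff.test_add hF hPc, Coeff.test_const_mul, Coeff.test_polynomial_exp hf]
      simp
    have h2 : ∀ t ∈ Icc 0 R, |F t + (-1) * P.eval (Real.exp t)| ≤ ε := by
      intro t ht
      have := hP (Real.exp t) ⟨Real.one_le_exp ht.1, Real.exp_le_exp.2 ht.2⟩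
      rw [Real.log_exp, abs_sub_comm] at this
      rw [neg_one_mul, ← sub_eq_add_neg]
      exact this.le
    rw [h1, Coeff.test_eq_sum, Finset.sum_mul]
    refine (Finset.abs_sum_le_sum_abs _ _).trans (Finset.sum_le_sum fun p hp => ?_)
    rw [abs_mul]
    exact mul_le_mul_of_nonneg_left
      (abs_phiTest_le h2 _ (NNReal.coe_nonneg _) (hσR p hp)) (abs_nonneg _)
  have h3 : Tendsto (fun ε : ℝ => (∑ p ∈ f.support, |f p|) * ε) (𝓝[>] 0) (𝓝 0) := by
    have : Continuous fun ε : ℝ => (∑ p ∈ f.support, |f p|) * ε := by fun_prop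
    simpa using (this.tendsto 0).mono_left nhdsWithin_le_nhds
  have h4 : |Coeff.test F f| ≤ 0 := ge_of_tendsto h3 (by
    filter_upwards [self_mem_nhdsWithin] with ε hε using key ε hε)
  exact abs_nonpos_iff.1 h4

end Test

/-! ### From scalar identities to identities between operators -/

section Transfer

variable {X : Type v} [NormedAddCommGroup X] [NormedSpace ℝ X] [CompleteSpace X]
  {T : ℝ → X →L[ℝ] X} (hT : IsC0Semigroup T)

/-- A coefficient function that vanishes on the real line vanishes on generators. -/
theorem opL_eq_zero {f : Coeff} (hf : ∀ z, Coeff.scal z f = 0) {h : ℝ} (hh : 0 ≤ h) :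
    opL hT h f = 0 := by
  ext x
  -- Functionals separate points, and `ℓ (f(hA) x)` is the test value of the continuous function `t
  -- ↦ ℓ (T (t h) x)`; no spectral information on the generator is needed.
  refine SeparatingDual.eq_zero_of_forall_dual_eq_zero (R := ℝ) fun ℓ => ?_
  have hF : ContinuousOn (fun t => ℓ (T (t * h) x)) (Ici 0) :=
    ℓ.continuous.comp_continuousOn ((hT.continuousOn x).comp (by fun_prop) fun t ht =>
      mul_nonneg ht hh)
  have h1 := Coeff.test_eq_zero hf hF
  rw [← h1, opL_apply hT f hh, Coeff.op, Coeff.test_eq_sum, Finsupp.sum, Finsupp.sum, map_sum]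
  refine Finset.sum_congr rfl fun p _ => ?_
  rw [map_smul, smul_eq_mul]
  congr 1
  obtain ⟨k, σ⟩ := p
  cases k with
  | zero => rfl
  | succ k =>
    simp only [phi, phiTest]
    rw [← ContinuousLinearMap.intervalIntegral_comp_comm ℓ
      (hT.intervalIntegrable_phi k (mul_nonneg (NNReal.coe_nonneg σ) hh) x)]
    congr 1
    funext θ
    rw [map_smul, smul_eq_mul, mul_assoc]

/-- Separation of variables: a relation `∑ f_i(z) w_i = 0` for real `z` remains valid if the
functionals `f ↦ f(z)` are replaced by any linear map that only depends on the values of `f`. -/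
theorem sum_map_eq_zero_of_scal {ι W W' : Type*} [AddCommGroup W] [Module ℝ W] [AddCommGroup W']
    [Module ℝ W'] (N : Coeff →ₗ[ℝ] W →ₗ[ℝ] W') (hN : ∀ f, (∀ z, Coeff.scal z f = 0) → N f = 0)
    (s : Finset ι) (f : ι → Coeff) (w : ι → W)
    (h : ∀ z, ∑ i ∈ s, Coeff.scal z (f i) • w i = 0) : ∑ i ∈ s, N (f i) (w i) = 0 := by
  classical
  -- In an algebraic basis the vector relation splits into one scalar relation per basis vector, and
  -- `hN` applies to each.
  set b := Module.Basis.ofVectorSpace ℝ W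
  have h1 : ∀ m, N (∑ i ∈ s, b.repr (w i) m • f i) = 0 := by
    refine fun m => hN _ fun z => ?_
    have := congrArg (fun x => b.repr x m) (h z)
    simp only [map_sum, map_smul, Finsupp.finsetSum_apply, Finsupp.smul_apply, map_zero,
      Finsupp.zero_apply, smul_eq_mul] at this ⊢
    rw [← this]
    exact Finset.sum_congr rfl fun i _ => mul_comm _ _
  set S := s.biUnion fun i => (b.repr (w i)).support
  have h2 : ∀ i ∈ s, N (f i) (w i) = ∑ m ∈ S, N (b.repr (w i) m • f i) (b m) := by
    intro i hi
    conv_lhs => rw [← b.linearCombination_repr (w i), Finsupp.linearCombination_apply,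
      Finsupp.sum_of_support_subset _ (Finset.subset_biUnion_of_mem
        (fun i => (b.repr (w i)).support) hi) _ (by simp), map_sum]
    refine Finset.sum_congr rfl fun m _ => ?_
    simp
  rw [Finset.sum_congr rfl h2, Finset.sum_comm]
  refine Finset.sum_eq_zero fun m _ => ?_
  have := LinearMap.congr_fun (h1 m) (b m)
  simpa using this

theorem sum_opL_apply_eq_zero {ι : Type*} {h : ℝ} (hh : 0 ≤ h) (s : Finset ι) (f : ι → Coeff)
    (w : ι → X) (hw : ∀ z, ∑ i ∈ s, Coeff.scal z (f i) • w i = 0) :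
    ∑ i ∈ s, opL hT h (f i) (w i) = 0 :=
  sum_map_eq_zero_of_scal ((ContinuousLinearMap.coeLM ℝ).comp (opL hT h))
    (fun f hf => by rw [LinearMap.comp_apply, opL_eq_zero hT hf hh, map_zero]) s f w hw

theorem sum_smul_opL_eq_zero {ι : Type*} {h : ℝ} (hh : 0 ≤ h) (s : Finset ι) (r : ι → ℝ)
    (f : ι → Coeff) (hf : ∀ z, ∑ i ∈ s, r i * Coeff.scal z (f i) = 0) :
    ∑ i ∈ s, r i • opL hT h (f i) = 0 := by
  have := opL_eq_zero hT (f := ∑ i ∈ s, r i • f i) (fun z => by simpa using hf z) hh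
  simpa using this

/-- One variable at a time: for fixed `z₁` the relation in `z₂` becomes one between operators;
composed with `J` and applied to `x` it is a vector relation in `z₁`. -/
theorem sum_opL_comp_opL_eq_zero {ι : Type*} {h : ℝ} (hh : 0 ≤ h) (s : Finset ι) (f g : ι → Coeff)
    (hfg : ∀ z₁ z₂, ∑ i ∈ s, Coeff.scal z₁ (f i) * Coeff.scal z₂ (g i) = 0) (J : X →L[ℝ] X)
    (x : X) : ∑ i ∈ s, opL hT h (f i) (J (opL hT h (g i) x)) = 0 := by
  refine sum_opL_apply_eq_zero hT hh s f _ fun z₁ => ?_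
  have := congrArg (fun P : X →L[ℝ] X => J (P x)) (sum_smul_opL_eq_zero hT hh s _ g (hfg z₁))
  simpa [sum_apply] using this

theorem sum_opL_comp_sum_opL_comp_opL_eq_zero {ι κ : Type*} {h : ℝ} (hh : 0 ≤ h) (s : Finset ι)
    (t : ι → Finset κ) (f : ι → Coeff) (g k : ι → κ → Coeff)
    (hfg : ∀ z₁ z₂ z₃, ∑ i ∈ s, ∑ j ∈ t i,
      Coeff.scal z₁ (f i) * Coeff.scal z₂ (g i j) * Coeff.scal z₃ (k i j) = 0)
    (J K : X →L[ℝ] X) (x : X) :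
    ∑ i ∈ s, opL hT h (f i) (J (∑ j ∈ t i, opL hT h (g i j) (K (opL hT h (k i j) x)))) = 0 := by
  refine sum_opL_apply_eq_zero hT hh s f _ fun z₁ => ?_
  have h1 := sum_opL_comp_opL_eq_zero hT hh (s.sigma t)
    (fun p => Coeff.scal z₁ (f p.1) • g p.1 p.2) (fun p => k p.1 p.2) (fun z₂ z₃ => by
      rw [Finset.sum_sigma]
      simpa using hfg z₁ z₂ z₃) K x
  rw [Finset.sum_sigma] at h1
  have h2 := congrArg J h1
  simpa [Finset.smul_sum] using h2

/-- For fixed `z₁` the second slot is replaced by operators; the linear map `N` then fills the first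
slot. -/
theorem sum_smul_bilin_opL_eq_zero {ι : Type*} {h : ℝ} (hh : 0 ≤ h) (s : Finset ι) (r : ι → ℝ)
    (f : ι → Coeff)
    (hf : ∀ z₁ z₂, ∑ i ∈ s, r i * (Coeff.scal z₁ (f i) * Coeff.scal z₂ (f i)) = 0)
    (B : X →L[ℝ] X →L[ℝ] X) (x y : X) :
    ∑ i ∈ s, r i • B (opL hT h (f i) x) (opL hT h (f i) y) = 0 := by
  let N : Coeff →ₗ[ℝ] X →ₗ[ℝ] X := (ContinuousLinearMap.coeLM ℝ).comp
    (B.toLinearMap.comp (((ContinuousLinearMap.apply ℝ X x).toLinearMap).comp (opL hT h)))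
  have := sum_map_eq_zero_of_scal N
    (fun f hf => by simp [N, opL_eq_zero hT hf hh]) s f (fun i => r i • opL hT h (f i) y)
    (fun z₁ => by
      have := congrArg (fun P : X →L[ℝ] X => P y) (sum_smul_opL_eq_zero hT hh s
        (fun i => r i * Coeff.scal z₁ (f i)) f (fun z₂ => by simpa [mul_assoc] using hf z₁ z₂))
      simpa [sum_apply, smul_smul, mul_comm] using this)
  simpa [N] using this

end Transfer

/-! ### The order conditions for coefficient functions -/

section Matrices

variable {d : ℕ}

theorem expSG_apply_eigenvector {Z : Mat d} {z : ℝ} {x : EuclideanSpace ℝ (Fin d)}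
    (hx : Z x = z • x) (t : ℝ) : expSG Z t x = Real.exp (t * z) • x := by
  have hpow : ∀ n : ℕ, ((t • Z) ^ n) x = ((t * z) ^ n) • x := by
    intro n
    induction n with
    | zero => simp
    | succ n ih =>
      rw [pow_succ']
      change (t • Z) (((t • Z) ^ n) x) = _
      rw [ih, map_smul, smul_apply, hx, smul_smul, smul_smul, pow_succ]
      congr 1
      ring
  have h1 := (ContinuousLinearMap.apply ℝ _ x).hasSum
    (NormedSpace.exp_series_hasSum_exp' (𝕂 := ℝ) (t • Z))
  have h2 := (NormedSpace.exp_series_hasSum_exp' (𝕂 := ℝ) (t * z)).smul_const x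
  rw [← congrFun Real.exp_eq_exp_ℝ (t * z)] at h2
  refine h1.unique (h2.congr_fun fun n => ?_)
  simp [hpow, smul_smul]

theorem phi_expSG_apply_eigenvector {Z : Mat d} {z : ℝ} {x : EuclideanSpace ℝ (Fin d)}
    (hx : Z x = z • x) (k : ℕ) (σ : ℝ) :
    phi (expSG Z) k σ x = phiTest (fun t => Real.exp (t * z)) k σ • x := by
  cases k with
  | zero => exact expSG_apply_eigenvector hx σ
  | succ k =>
    simp only [phi, phiTest, expSG_apply_eigenvector hx, smul_smul]
    exact intervalIntegral.integral_smul_const _ _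

/-- On eigenvectors matrix functions become real values, so the matrix conditions can be read as
identities between real functions. -/
theorem Coeff.mat_apply_eigenvector (f : Coeff) {Z : Mat d} {z : ℝ}
    {x : EuclideanSpace ℝ (Fin d)} (hx : Z x = z • x) : f.mat Z x = Coeff.scal z f • x := by
  rw [Coeff.mat, Coeff.op, Coeff.scal, Coeff.test_eq_sum, Finsupp.sum, Finsupp.sum,
    Finset.sum_smul]
  exact Finset.sum_congr rfl fun p _ => by
    rw [mul_one, phi_expSG_apply_eigenvector hx, smul_smul]

/-- `ψ_{j,i}` as a coefficient function. -/
def Method.psiCoeff (M : Method) (j i : ℕ) : Coeff :=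
  ∑ k ∈ Finset.Ico 2 i, ((M.c k : ℝ) ^ (j - 1) / ((j - 1)! : ℝ)) • M.a i k
    - Finsupp.single (j, M.c i) ((M.c i : ℝ) ^ j)

theorem Method.psi_apply_eigenvector (M : Method) (j i : ℕ) {Z : Mat d} {z : ℝ}
    {x : EuclideanSpace ℝ (Fin d)} (hx : Z x = z • x) :
    M.psi j i Z x = Coeff.scal z (M.psiCoeff j i) • x := by
  have h1 : phiMat j ((M.c i : ℝ) • Z) x =
      phiTest (fun t => Real.exp (t * z)) j (M.c i) • x := by
    have : ((M.c i : ℝ) • Z) x = ((M.c i : ℝ) * z) • x := by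
      rw [smul_apply, hx, smul_smul]
    rw [phiMat, phi_expSG_apply_eigenvector this]
    congr 1
    cases j <;> simp [phiTest, mul_assoc]
  have h2 : Coeff.scal z (Finsupp.single (j, M.c i) ((M.c i : ℝ) ^ j)) =
      (M.c i : ℝ) ^ j * phiTest (fun t => Real.exp (t * z)) j (M.c i) := by
    simp [Coeff.scal, Coeff.test_eq_sum]
  rw [Method.psi, Method.psiCoeff, map_sub, sub_smul, map_sum, Finset.sum_smul, h1, h2, smul_smul]
  congr 1
  refine Finset.sum_congr rfl fun k _ => ?_
  rw [Coeff.mat_apply_eigenvector _ hx, map_smul, smul_smul, smul_eq_mul]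

/-- A diagonal matrix with prescribed eigenvalues, with a nilpotent matrix that connects its
eigenvectors. -/
theorem exists_diagonal_shift (z : Fin 4 → ℝ) : ∃ (Z J : Mat 4)
    (B : EuclideanSpace ℝ (Fin 4) →ₗ[ℝ] EuclideanSpace ℝ (Fin 4) →ₗ[ℝ] EuclideanSpace ℝ (Fin 4))
    (e : Fin 4 → EuclideanSpace ℝ (Fin 4)), (∀ i, Z (e i) = z i • e i) ∧ e 0 ≠ 0 ∧
      J (e 1) = e 0 ∧ J (e 2) = e 1 ∧ J (e 3) = e 2 ∧ B (e 1) (e 2) = e 0 := by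
  let b := (EuclideanSpace.basisFun (Fin 4) ℝ).toBasis
  -- Format four suffices, since the longest product in the conditions has four factors. The two
  -- arguments of `B` are different eigenvectors, so their eigenvalues stay independent.
  refine ⟨LinearMap.toContinuousLinearMap (b.constr ℝ fun i => z i • b i),
    LinearMap.toContinuousLinearMap (b.constr ℝ ![0, b 0, b 1, b 2]),
    b.constr ℝ ![0, b.constr ℝ ![0, 0, b 0, 0], 0, 0], b, fun i => ?_, b.ne_zero 0, ?_, ?_, ?_, ?_⟩
  all_goals simp

theorem Coeff.mat_apply_smul (f : Coeff) {Z : Mat d} {z : ℝ} {x : EuclideanSpace ℝ (Fin d)}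
    (hx : Z x = z • x) (r : ℝ) : f.mat Z (r • x) = (r * Coeff.scal z f) • x := by
  rw [f.mat_apply_eigenvector (x := r • x) (z := z) (by rw [map_smul, hx, smul_comm]), smul_smul,
    mul_comm]

theorem Coeff.mat_zero_apply (f : Coeff) (x : EuclideanSpace ℝ (Fin d)) :
    f.mat 0 x = Coeff.scal 0 f • x := f.mat_apply_eigenvector (by simp)

end Matrices

/-! ### The order conditions as scalar identities in independent variables -/

section ScalarConditions

variable {M : Method}

theorem Method.QuadCond.scal {d m : ℕ} {Z : Mat d} {z : ℝ} {x : EuclideanSpace ℝ (Fin d)}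
    (hM : M.QuadCond m Z) (hx : x ≠ 0) (hZ : Z x = z • x) :
    ∑ i ∈ Finset.Icc 2 M.s, ((M.c i : ℝ) ^ m / (m ! : ℝ)) * Coeff.scal z (M.b i) =
      Coeff.scal z (Finsupp.single (m + 1, 1) 1) := by
  have h1 := hM x
  have h2 : phiMat (m + 1) Z x = Coeff.scal z (Finsupp.single (m + 1, 1) 1) • x := by
    rw [phiMat, phi_expSG_apply_eigenvector hZ]
    simp [Coeff.scal, Coeff.test_eq_sum]
  simp only [Coeff.mat_apply_eigenvector _ hZ, smul_smul, ← Finset.sum_smul] at h1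
  rw [h2] at h1
  exact smul_left_injective ℝ hx h1

/-- On `e 1` the factor `ψ` takes its value at `z₂`; the shift leads to `e 0`, where `b_i` takes its
value at `z₁`. Longer chains below start at a later basis vector. -/
theorem Method.FullConditions.scal_cond3 (hM : M.FullConditions) (z₁ z₂ : ℝ) :
    ∑ i ∈ Finset.Icc 2 M.s, Coeff.scal z₁ (M.b i) * Coeff.scal z₂ (M.psiCoeff 2 i) = 0 := by
  obtain ⟨Z, J, B, e, hZ, he, h1, -⟩ := exists_diagonal_shift ![z₁, z₂, 0, 0]
  simpa [M.psi_apply_eigenvector _ _ (hZ _), h1, Coeff.mat_apply_smul _ (hZ _),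
    ← Finset.sum_smul, he, mul_comm] using hM.cond3 4 Z J (e 1)

theorem Method.FullConditions.scal_cond5 (hM : M.FullConditions) (z₁ z₂ : ℝ) :
    ∑ i ∈ Finset.Icc 2 M.s, Coeff.scal z₁ (M.b i) * Coeff.scal z₂ (M.psiCoeff 3 i) = 0 := by
  obtain ⟨Z, J, B, e, hZ, he, h1, -⟩ := exists_diagonal_shift ![z₁, z₂, 0, 0]
  simpa [M.psi_apply_eigenvector _ _ (hZ _), h1, Coeff.mat_apply_smul _ (hZ _),
    ← Finset.sum_smul, he, mul_comm] using hM.cond5 4 Z J (e 1)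

theorem Method.FullConditions.scal_cond6 (hM : M.FullConditions) (z₁ z₂ z₃ : ℝ) :
    ∑ i ∈ Finset.Icc 2 M.s, ∑ j ∈ Finset.Ico 2 i, Coeff.scal z₁ (M.b i) *
      Coeff.scal z₂ (M.a i j) * Coeff.scal z₃ (M.psiCoeff 2 j) = 0 := by
  obtain ⟨Z, J, B, e, hZ, he, h1, h2, -⟩ := exists_diagonal_shift ![z₁, z₂, z₃, 0]
  simpa [M.psi_apply_eigenvector _ _ (hZ _), h1, h2, Coeff.mat_apply_smul _ (hZ _),
    ← Finset.sum_smul, he, Finset.mul_sum, mul_comm, mul_left_comm] using hM.cond6 4 Z J (e 2)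

theorem Method.FullConditions.scal_cond7 (hM : M.FullConditions) (z₁ z₂ : ℝ) :
    ∑ i ∈ Finset.Icc 2 M.s,
      Coeff.scal z₁ (M.b i) * Coeff.scal z₂ ((M.c i : ℝ) • M.psiCoeff 2 i) = 0 := by
  obtain ⟨Z, J, B, e, hZ, he, h1, -⟩ := exists_diagonal_shift ![z₁, z₂, 0, 0]
  simpa [M.psi_apply_eigenvector _ _ (hZ _), h1, Coeff.mat_apply_smul _ (hZ _), smul_smul,
    ← Finset.sum_smul, he, mul_comm, mul_left_comm] using hM.cond7 4 Z J (e 1)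

/-- The outer factor `f.mat 0` is multiplication by the number `f(0)`, so the weak conditions have
one variable fewer. -/
theorem Method.WeakConditions.scal_cond9 (hM : M.WeakConditions) (z : ℝ) :
    ∑ i ∈ Finset.Icc 2 M.s, Coeff.scal 0 (M.b i) * Coeff.scal z (M.psiCoeff 4 i) = 0 := by
  obtain ⟨Z, J, B, e, hZ, he, h1, -⟩ := exists_diagonal_shift ![0, z, 0, 0]
  simpa [M.psi_apply_eigenvector _ _ (hZ _), h1, Coeff.mat_zero_apply, smul_smul,
    ← Finset.sum_smul, he, mul_comm] using hM.cond9 4 Z J (e 1)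

theorem Method.WeakConditions.scal_cond10 (hM : M.WeakConditions) (z₁ z₂ : ℝ) :
    ∑ i ∈ Finset.Icc 2 M.s, ∑ j ∈ Finset.Ico 2 i, Coeff.scal z₁ (Coeff.scal 0 (M.b i) • M.a i j) *
      Coeff.scal z₂ (M.psiCoeff 3 j) = 0 := by
  obtain ⟨Z, J, B, e, hZ, he, h1, h2, -⟩ := exists_diagonal_shift ![0, z₁, z₂, 0]
  simpa [M.psi_apply_eigenvector _ _ (hZ _), h1, h2, Coeff.mat_apply_smul _ (hZ _),
    Coeff.mat_zero_apply, smul_smul, ← Finset.sum_smul, he, Finset.mul_sum, mul_comm,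
    mul_left_comm] using hM.cond10 4 Z J (e 2)

theorem Method.WeakConditions.scal_cond11 (hM : M.WeakConditions) (z₁ z₂ z₃ : ℝ) :
    ∑ i ∈ Finset.Icc 2 M.s, ∑ j ∈ Finset.Ico 2 i, ∑ k ∈ Finset.Ico 2 j,
      Coeff.scal z₁ (Coeff.scal 0 (M.b i) • M.a i j) *
      Coeff.scal z₂ (M.a j k) * Coeff.scal z₃ (M.psiCoeff 2 k) = 0 := by
  obtain ⟨Z, J, B, e, hZ, he, h1, h2, h3, -⟩ := exists_diagonal_shift ![0, z₁, z₂, z₃]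
  simpa [M.psi_apply_eigenvector _ _ (hZ _), h1, h2, h3, Coeff.mat_apply_smul _ (hZ _),
    Coeff.mat_zero_apply, smul_smul, ← Finset.sum_smul, he, Finset.mul_sum, Finset.sum_mul,
    mul_comm, mul_left_comm] using hM.cond11 4 Z J (e 3)

/-- Choosing `K = J` loses nothing: the shift acts on different basis vectors in its two roles. -/
theorem Method.WeakConditions.scal_cond12 (hM : M.WeakConditions) (z₁ z₂ : ℝ) :
    ∑ i ∈ Finset.Icc 2 M.s, ∑ j ∈ Finset.Ico 2 i, Coeff.scal z₁ (Coeff.scal 0 (M.b i) • M.a i j) *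
      Coeff.scal z₂ ((M.c j : ℝ) • M.psiCoeff 2 j) = 0 := by
  obtain ⟨Z, J, B, e, hZ, he, h1, h2, -⟩ := exists_diagonal_shift ![0, z₁, z₂, 0]
  simpa [M.psi_apply_eigenvector _ _ (hZ _), h1, h2, Coeff.mat_apply_smul _ (hZ _),
    Coeff.mat_zero_apply, smul_smul, ← Finset.sum_smul, he, Finset.mul_sum, mul_comm,
    mul_left_comm] using hM.cond12 4 Z J J (e 2)

theorem Method.WeakConditions.scal_cond13 (hM : M.WeakConditions) (z : ℝ) :
    ∑ i ∈ Finset.Icc 2 M.s,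
      (Coeff.scal 0 (M.b i) * M.c i) * Coeff.scal z (M.psiCoeff 3 i) = 0 := by
  obtain ⟨Z, J, B, e, hZ, he, h1, -⟩ := exists_diagonal_shift ![0, z, 0, 0]
  simpa [M.psi_apply_eigenvector _ _ (hZ _), h1, Coeff.mat_zero_apply, smul_smul,
    ← Finset.sum_smul, he, mul_assoc] using hM.cond13 4 Z J (e 1)

theorem Method.WeakConditions.scal_cond14 (hM : M.WeakConditions) (z₁ z₂ : ℝ) :
    ∑ i ∈ Finset.Icc 2 M.s, ∑ j ∈ Finset.Ico 2 i,
      Coeff.scal z₁ ((Coeff.scal 0 (M.b i) * M.c i) • M.a i j) *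
      Coeff.scal z₂ (M.psiCoeff 2 j) = 0 := by
  obtain ⟨Z, J, B, e, hZ, he, h1, h2, -⟩ := exists_diagonal_shift ![0, z₁, z₂, 0]
  simpa [M.psi_apply_eigenvector _ _ (hZ _), h1, h2, Coeff.mat_apply_smul _ (hZ _),
    Coeff.mat_zero_apply, smul_smul, ← Finset.sum_smul, he, Finset.mul_sum, mul_comm,
    mul_left_comm] using hM.cond14 4 Z J J (e 2)

theorem Method.WeakConditions.scal_cond15 (hM : M.WeakConditions) (z₁ z₂ : ℝ) :
    ∑ i ∈ Finset.Icc 2 M.s, Coeff.scal 0 (M.b i) *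
      (Coeff.scal z₁ (M.psiCoeff 2 i) * Coeff.scal z₂ (M.psiCoeff 2 i)) = 0 := by
  obtain ⟨Z, J, B, e, hZ, he, -, -, -, h1⟩ := exists_diagonal_shift ![0, z₁, z₂, 0]
  simpa [M.psi_apply_eigenvector _ _ (hZ _), h1, Coeff.mat_zero_apply, smul_smul,
    ← Finset.sum_smul, he, mul_comm, mul_left_comm] using hM.cond15 4 Z B (e 1) (e 2)

theorem Method.WeakConditions.scal_cond16 (hM : M.WeakConditions) (z : ℝ) :
    ∑ i ∈ Finset.Icc 2 M.s,
      (Coeff.scal 0 (M.b i) * (M.c i : ℝ) ^ 2) * Coeff.scal z (M.psiCoeff 2 i) = 0 := by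
  obtain ⟨Z, J, B, e, hZ, he, h1, -⟩ := exists_diagonal_shift ![0, z, 0, 0]
  simpa [M.psi_apply_eigenvector _ _ (hZ _), h1, Coeff.mat_zero_apply, smul_smul,
    ← Finset.sum_smul, he, mul_assoc] using hM.cond16 4 Z J (e 1)

end ScalarConditions

/-! ### Calculus -/

section Calculus

variable {E : Type*} [NormedAddCommGroup E] [NormedSpace ℝ E]

/-- A `C^n` function on a compact interval extends to a `C^n` function on the real line. -/
theorem exists_contDiff_extension [CompleteSpace E] {a b : ℝ} (hab : a < b) (n : ℕ) {u : ℝ → E}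
    (hu : ContDiffOn ℝ n u (Icc a b)) : ∃ w : ℝ → E, ContDiff ℝ n w ∧ EqOn w u (Icc a b) := by
  induction n generalizing u with
  | zero =>
    refine ⟨IccExtend hab.le ((Icc a b).domRestrict u), ?_, fun t ht => ?_⟩
    · rw [Nat.cast_zero, contDiff_zero]
      exact (continuousOn_iff_continuous_domRestrict.1 hu.continuousOn).Icc_extend'
    · rw [IccExtend_of_mem hab.le _ ht]; rfl
  | succ n ih =>
    have hun := (contDiffOn_succ_iff_derivWithin (uniqueDiffOn_Icc hab)).1
      (by exact_mod_cast hu : ContDiffOn ℝ ((n : WithTop ℕ∞) + 1) u (Icc a b))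
    obtain ⟨w, hw, hwu⟩ := ih hun.2.2
    -- The extension is the integral of an extension of the derivative, starting from constant
    -- extension in the continuous case.
    have hd : ∀ t, HasDerivAt (fun t => u a + ∫ s in a..t, w s) (w t) t := fun t =>
      (hw.continuous.integral_hasStrictDerivAt a t).hasDerivAt.const_add (u a)
    refine ⟨fun t => u a + ∫ s in a..t, w s, ?_, ?_⟩
    · have : ContDiff ℝ ((n : WithTop ℕ∞) + 1) fun t => u a + ∫ s in a..t, w s := by
        rw [contDiff_succ_iff_deriv]
        refine ⟨fun t => (hd t).differentiableAt, by simp, ?_⟩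
        rwa [show deriv (fun t => u a + ∫ s in a..t, w s) = w from funext fun t => (hd t).deriv]
      exact_mod_cast this
    · intro t ht
      have h1 := intervalIntegral.integral_eq_sub_of_hasDeriv_right_of_le ht.1
        (hu.continuousOn.mono (Icc_subset_Icc_right ht.2)) (f' := w) (fun s hs => by
          have h2 : s ∈ Ioo a b := ⟨hs.1, hs.2.trans_le ht.2⟩
          have h3 := (hun.1 s (Ioo_subset_Icc_self h2)).hasDerivWithinAt
          rw [← hwu (Ioo_subset_Icc_self h2)] at h3
          exact (h3.hasDerivAt (Icc_mem_nhds h2.1 h2.2)).hasDerivWithinAt)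
        (hw.continuous.intervalIntegrable _ _)
      simp [h1]

/-- Taylor's formula with a remainder that is uniform on compact intervals. -/
theorem exists_taylor_bound (n : ℕ) {w : ℝ → E} (hw : ContDiff ℝ n w) (a b R : ℝ) :
    ∃ C : ℝ, 0 ≤ C ∧ ∀ t ∈ Icc a b, ∀ τ ∈ Icc 0 R,
      ‖w (t + τ) - ∑ k ∈ Finset.range n, (τ ^ k / (k ! : ℝ)) • iteratedDeriv k w t‖ ≤ C * τ ^ n := by
  induction n generalizing w with
  | zero =>
    obtain ⟨C, hC⟩ := isCompact_Icc.exists_bound_of_continuousOn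
      (hw.continuous.continuousOn (s := Icc a (b + R)))
    refine ⟨max C 0, le_max_right _ _, fun t ht τ hτ => ?_⟩
    simpa using (Or.inl (hC (t + τ) ⟨by linarith [ht.1, hτ.1], by linarith [ht.2, hτ.2]⟩))
  | succ n ih =>
    have hwn := contDiff_succ_iff_deriv.1
      (by exact_mod_cast hw : ContDiff ℝ ((n : WithTop ℕ∞) + 1) w)
    obtain ⟨C, hC0, hC⟩ := ih hwn.2.2
    refine ⟨C, hC0, fun t ht τ hτ => ?_⟩
    -- The derivative of the remainder of `w` is the remainder of `deriv w` of one order less, so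
    -- the mean value inequality gains one power of `τ`.
    have hderiv : ∀ s : ℝ, HasDerivAt (fun s => w (t + s) -
        ∑ k ∈ Finset.range (n + 1), (s ^ k / (k ! : ℝ)) • iteratedDeriv k w t)
        (deriv w (t + s) - ∑ k ∈ Finset.range n, (s ^ k / (k ! : ℝ)) • iteratedDeriv k (deriv w) t)
        s := by
      intro s
      refine HasDerivAt.sub ((hwn.1 (t + s)).hasDerivAt.comp_const_add t s) ?_
      have h1 : ∀ k ∈ Finset.range (n + 1), HasDerivAt (fun s : ℝ =>
          (s ^ k / (k ! : ℝ)) • iteratedDeriv k w t)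
          (((k : ℝ) * s ^ (k - 1) / (k ! : ℝ)) • iteratedDeriv k w t) s := fun k _ =>
        ((hasDerivAt_pow k s).div_const _).smul_const _
      have h2 := HasDerivAt.fun_sum h1
      rw [Finset.sum_range_succ'] at h2
      convert h2 using 1
      simp only [CharP.cast_eq_zero, zero_mul, zero_div, zero_smul, add_zero]
      refine Finset.sum_congr rfl fun k _ => ?_
      rw [iteratedDeriv_succ', Nat.factorial_succ]
      congr 1
      push_cast
      rw [mul_div_mul_left _ _ (by positivity)]
    have h3 := (convex_Icc 0 τ).norm_image_sub_le_of_norm_hasDerivWithin_le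
      (fun s _ => (hderiv s).hasDerivWithinAt) (C := C * τ ^ n) (fun s hs => by
        refine (hC t ht s ⟨hs.1, hs.2.trans hτ.2⟩).trans ?_
        have := pow_le_pow_left₀ hs.1 hs.2 n
        gcongr) (left_mem_Icc.2 hτ.1) (right_mem_Icc.2 hτ.1)
    rw [Finset.sum_range_succ' (fun k => ((0 : ℝ) ^ k / (k ! : ℝ)) • iteratedDeriv k w t)] at h3
    simp only [add_zero, ne_eq, Nat.add_eq_zero_iff, one_ne_zero, and_false, not_false_eq_true,
      zero_pow, zero_div, zero_smul, Finset.sum_const_zero, pow_zero, Nat.factorial_zero,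
      Nat.cast_one, div_one, one_smul, iteratedDeriv_zero, zero_add, sub_self, sub_zero,
      Real.norm_eq_abs, abs_of_nonneg hτ.1] at h3
    rwa [pow_succ, ← mul_assoc]

set_option maxSynthPendingDepth 3 in
/-- Second order Taylor expansion of a map with three bounded derivatives on a convex set. -/
theorem norm_sub_taylor_two_le {F : Type*} [NormedAddCommGroup F] [NormedSpace ℝ F] {g : E → F}
    {s : Set E} (hs : Convex ℝ s) {K : ℝ} (hg : ∀ x ∈ s, DifferentiableAt ℝ g x)
    (hg' : ∀ x ∈ s, DifferentiableAt ℝ (fderiv ℝ g) x)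
    (hg'' : ∀ x ∈ s, DifferentiableAt ℝ (fderiv ℝ (fderiv ℝ g)) x)
    (hK : ∀ x ∈ s, ‖fderiv ℝ (fderiv ℝ (fderiv ℝ g)) x‖ ≤ K) {y e : E} (hy : y ∈ s)
    (hye : y + e ∈ s) :
    ‖g (y + e) - g y - fderiv ℝ g y e - (1 / 2 : ℝ) • fderiv ℝ (fderiv ℝ g) y e e‖ ≤
      K * ‖e‖ ^ 3 := by
  have hK0 : 0 ≤ K := (norm_nonneg _).trans (hK y hy)
  have hseg : ∀ r ∈ Icc (0 : ℝ) 1, y + r • e ∈ s := by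
    intro r hr
    have := hs hy hye (sub_nonneg.2 hr.2) hr.1 (by ring)
    convert this using 1
    module
  have h1 : ∀ x ∈ s, ‖fderiv ℝ (fderiv ℝ g) x - fderiv ℝ (fderiv ℝ g) y‖ ≤ K * ‖x - y‖ :=
    fun x hx => hs.norm_image_sub_le_of_norm_fderiv_le hg'' hK hy hx
  have h2 : ∀ r ∈ Icc (0 : ℝ) 1, ‖fderiv ℝ g (y + r • e) - fderiv ℝ g y -
      r • fderiv ℝ (fderiv ℝ g) y e‖ ≤ K * ‖e‖ ^ 2 := by
    intro r hr
    have h3 := (convex_segment y (y + r • e)).norm_image_sub_le_of_norm_hasFDerivWithin_le'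
      (f := fderiv ℝ g) (f' := fderiv ℝ (fderiv ℝ g)) (C := K * ‖e‖)
      (fun x hx => (hg' x (hs.segment_subset hy (hseg r hr) hx)).hasFDerivAt.hasFDerivWithinAt)
      (fun x hx => by
        refine (h1 x (hs.segment_subset hy (hseg r hr) hx)).trans ?_
        have h4 := norm_sub_le_of_mem_segment hx
        rw [add_sub_cancel_left, norm_smul, Real.norm_of_nonneg hr.1] at h4
        have h5 : ‖x - y‖ ≤ ‖e‖ := h4.trans (mul_le_of_le_one_left (norm_nonneg _) hr.2)
        gcongr) (left_mem_segment ℝ _ _) (right_mem_segment ℝ _ _)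
    rw [add_sub_cancel_left, map_smul, norm_smul, Real.norm_of_nonneg hr.1] at h3
    refine h3.trans ?_
    have : r * ‖e‖ ≤ ‖e‖ := mul_le_of_le_one_left (norm_nonneg _) hr.2
    calc K * ‖e‖ * (r * ‖e‖) ≤ K * ‖e‖ * ‖e‖ := by gcongr
      _ = _ := by ring
  have h6 := (convex_Icc (0 : ℝ) 1).norm_image_sub_le_of_norm_hasDerivWithin_le
    (f := fun r : ℝ => g (y + r • e) - r • fderiv ℝ g y e -
      (r ^ 2 / 2) • fderiv ℝ (fderiv ℝ g) y e e)
    (f' := fun r : ℝ => (fderiv ℝ g (y + r • e) - fderiv ℝ g y -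
      r • fderiv ℝ (fderiv ℝ g) y e) e) (C := K * ‖e‖ ^ 3) (x := 0) (y := 1) (fun r hr => by
        refine HasDerivAt.hasDerivWithinAt ?_
        have h7 : HasDerivAt (fun r : ℝ => y + r • e) e r := by
          simpa using ((hasDerivAt_id r).smul_const e).const_add y
        have h8 := (hg _ (hseg r hr)).hasFDerivAt.comp_hasDerivAt r h7
        have h9 : HasDerivAt (fun r : ℝ => r • fderiv ℝ g y e) (fderiv ℝ g y e) r := by
          simpa using (hasDerivAt_id r).smul_const (fderiv ℝ g y e)
        have h10 : HasDerivAt (fun r : ℝ => (r ^ 2 / 2) • fderiv ℝ (fderiv ℝ g) y e e)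
            (r • fderiv ℝ (fderiv ℝ g) y e e) r := by
          have := ((hasDerivAt_pow 2 r).div_const 2).smul_const (fderiv ℝ (fderiv ℝ g) y e e)
          convert this using 2
          simp
        exact (h8.sub h9).sub h10) (fun r hr => by
          refine (ContinuousLinearMap.le_of_opNorm_le _ (h2 r hr) e).trans (le_of_eq (by ring)))
      (left_mem_Icc.2 zero_le_one) (right_mem_Icc.2 zero_le_one)
  simp only [one_smul, zero_smul, add_zero, one_pow, ne_eq, OfNat.ofNat_ne_zero, not_false_eq_true,
    zero_pow, zero_div, sub_zero, norm_one, mul_one] at h6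
  convert h6 using 2
  abel

end Calculus

/-! ### The problem along a smooth extension of the solution -/

section SmoothProblem

variable {X : Type v} [NormedAddCommGroup X] [NormedSpace ℝ X]

theorem _root_.ContDiff.hasDerivAt_iteratedDeriv {E : Type*} [NormedAddCommGroup E]
    [NormedSpace ℝ E] {w : ℝ → E} {n k : ℕ} (hw : ContDiff ℝ n w) (hk : k < n) (t : ℝ) :
    HasDerivAt (iteratedDeriv k w) (iteratedDeriv (k + 1) w t) t := by
  rw [iteratedDeriv_succ]
  exact (hw.differentiable_iteratedDeriv k (by exact_mod_cast hk) t).hasDerivAt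

/-- A smooth extension `v` of the solution to the real line, with smooth extensions `f`, `G`, `H`
of `g`, `g'`, `g''` along the solution. The solution times are `[t₀, t₁)`. -/
structure SmoothProblem (A : X →ₗ.[ℝ] X) (g : X → X) (t₀ t₁ : ℝ) (v f : ℝ → X)
    (G : ℝ → X →L[ℝ] X) (H : ℝ → X →L[ℝ] X →L[ℝ] X) (r K : ℝ) : Prop where
  v_smooth : ContDiff ℝ (5 : ℕ) v
  f_smooth : ContDiff ℝ (5 : ℕ) f
  G_smooth : ContDiff ℝ (4 : ℕ) G
  H_smooth : ContDiff ℝ (3 : ℕ) H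
  r_pos : 0 < r
  K_nonneg : 0 ≤ K
  graph : ∀ k ≤ 4, ∀ t ∈ Ico t₀ t₁,
    (iteratedDeriv k v t, iteratedDeriv (k + 1) v t - iteratedDeriv k f t) ∈ A.graph
  f_eq : ∀ t ∈ Icc t₀ (t₁ + r), f t = g (v t)
  expand : ∀ t ∈ Icc t₀ (t₁ + r), ∀ e, ‖e‖ < r →
    ‖g (v t + e) - f t - G t e - (1 / 2 : ℝ) • H t e e‖ ≤ K * ‖e‖ ^ 3
  lip : ∀ t ∈ Icc t₀ t₁, ∀ x ∈ Metric.ball (v t) r, ∀ y ∈ Metric.ball (v t) r,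
    ‖g x - g y‖ ≤ K * ‖x - y‖

/-- Differentiating `v' = A v + f` repeatedly, using that `A` is closed. -/
theorem iteratedDeriv_mem_graph {A : X →ₗ.[ℝ] X} (hA : IsClosed (A.graph : Set (X × X)))
    {t₀ t₁ : ℝ} {v f : ℝ → X} {n : ℕ} (hv : ContDiff ℝ (n + 1 : ℕ) v) (hf : ContDiff ℝ n f)
    (h0 : ∀ t ∈ Ico t₀ t₁, (v t, deriv v t - f t) ∈ A.graph) (k : ℕ) (hk : k ≤ n) :
    ∀ t ∈ Ico t₀ t₁,
      (iteratedDeriv k v t, iteratedDeriv (k + 1) v t - iteratedDeriv k f t) ∈ A.graph := by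
  induction k with
  | zero => simpa [iteratedDeriv_one] using h0
  | succ k ih =>
    intro t ht
    have h1 : HasDerivAt (fun s => (iteratedDeriv k v s,
        iteratedDeriv (k + 1) v s - iteratedDeriv k f s))
        (iteratedDeriv (k + 1) v t, iteratedDeriv (k + 1 + 1) v t - iteratedDeriv (k + 1) f t) t :=
      (hv.hasDerivAt_iteratedDeriv (by omega) t).prodMk
        ((hv.hasDerivAt_iteratedDeriv (by omega) t).sub (hf.hasDerivAt_iteratedDeriv (by omega) t))
    -- Difference quotients of points of the graph stay in it. Quotients from the right are used so
    -- that `t = t₀` is included.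
    have h2 := (hasDerivWithinAt_iff_tendsto_slope' (s := Ioi t) (by simp)).1 h1.hasDerivWithinAt
    refine hA.mem_of_tendsto h2 ?_
    filter_upwards [Ioo_mem_nhdsGT ht.2] with s hs
    exact A.graph.smul_mem _ (A.graph.sub_mem
      (ih (by omega) s ⟨ht.1.trans hs.1.le, hs.2⟩) (ih (by omega) t ht))

set_option maxSynthPendingDepth 3 in
-- Nodes `t + c h` may lie beyond `t₁`, where no solution is given. Only smoothness is needed there:
-- an extended curve stays in the strip for a short time, so `g` and its derivatives can still be
-- evaluated along it.
theorem exists_smoothProblem [CompleteSpace X] {A : X →ₗ.[ℝ] X}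
    (hA : IsClosed (A.graph : Set (X × X))) {g : X → X} {t₀ t₁ : ℝ} (ht : t₀ < t₁) {u : ℝ → X}
    (hu : IsSolution A g t₀ t₁ u) (hreg : IsRegular g t₀ t₁ u) :
    ∃ v f G H r K, SmoothProblem A g t₀ t₁ v f G H r K ∧ EqOn v u (Icc t₀ t₁) := by
  obtain ⟨ρ, hρ, hg, R, hR⟩ := hreg.smooth_g
  obtain ⟨v, hv, hvu⟩ := exists_contDiff_extension ht 5 hreg.smooth_u
  set Ω := Metric.thickening ρ (u '' Icc t₀ t₁) with hΩ
  have hΩo : IsOpen Ω := Metric.isOpen_thickening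
  obtain ⟨ε, hε, hεv⟩ := Metric.continuousAt_iff.1 (hv.continuous.continuousAt (x := t₁)) (ρ / 2)
    (by positivity)
  -- Up to time `r` beyond `t₁` the curve stays within `ρ / 2` of `v t₁`, so balls of radius `r ≤ ρ
  -- / 2` around it remain in the strip.
  set r := min (ε / 2) (ρ / 2) with hr
  have hr0 : 0 < r := by positivity
  have hball : ∀ t ∈ Icc t₀ (t₁ + r), Metric.ball (v t) r ⊆ Ω := by
    intro t htr x hx
    rw [Metric.mem_ball] at hx
    rw [hΩ, Metric.mem_thickening_iff]
    have hrρ : r ≤ ρ / 2 := min_le_right _ _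
    rcases le_total t t₁ with htt | htt
    · exact ⟨u t, mem_image_of_mem u ⟨htr.1, htt⟩, by rw [← hvu ⟨htr.1, htt⟩]; linarith⟩
    · refine ⟨u t₁, mem_image_of_mem u ⟨ht.le, le_rfl⟩, ?_⟩
      rw [← hvu ⟨ht.le, le_rfl⟩]
      have h1 := hεv (x := t) (by
        rw [Real.dist_eq, abs_of_nonneg (by linarith)]
        linarith [htr.2, min_le_left (ε / 2) (ρ / 2)])
      linarith [dist_triangle x (v t) (v t₁)]
  have hmaps : MapsTo v (Icc t₀ (t₁ + r)) Ω := fun t htr =>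
    hball t htr (Metric.mem_ball_self hr0)
  have hg1 : ContDiffOn ℝ 4 (fderiv ℝ g) Ω := hg.fderiv_of_isOpen hΩo (by norm_num)
  have hg2 : ContDiffOn ℝ 3 (fderiv ℝ (fderiv ℝ g)) Ω := hg1.fderiv_of_isOpen hΩo (by norm_num)
  have hlt : t₀ < t₁ + r := by linarith
  obtain ⟨f, hf, hfv⟩ := exists_contDiff_extension hlt 5 (u := g ∘ v)
    (hg.comp hv.contDiffOn hmaps)
  obtain ⟨G, hG, hGv⟩ := exists_contDiff_extension hlt 4 (u := fderiv ℝ g ∘ v)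
    (hg1.comp (hv.of_le (by norm_num)).contDiffOn hmaps)
  obtain ⟨H, hH, hHv⟩ := exists_contDiff_extension hlt 3 (u := fderiv ℝ (fderiv ℝ g) ∘ v)
    (hg2.comp (hv.of_le (by norm_num)).contDiffOn hmaps)
  have hd0 : ∀ x ∈ Ω, DifferentiableAt ℝ g x := fun x hx =>
    (hg.differentiableOn (by norm_num)).differentiableAt (hΩo.mem_nhds hx)
  have hd1 : ∀ x ∈ Ω, DifferentiableAt ℝ (fderiv ℝ g) x := fun x hx =>
    (hg1.differentiableOn (by norm_num)).differentiableAt (hΩo.mem_nhds hx)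
  have hd2 : ∀ x ∈ Ω, DifferentiableAt ℝ (fderiv ℝ (fderiv ℝ g)) x := fun x hx =>
    (hg2.differentiableOn (by norm_num)).differentiableAt (hΩo.mem_nhds hx)
  have hsub : ∀ t ∈ Icc t₀ t₁, t ∈ Icc t₀ (t₁ + r) := fun t htt => ⟨htt.1, by linarith [htt.2]⟩
  have hR0 : 0 ≤ R := (norm_nonneg _).trans
    (hR 1 le_rfl (by norm_num) (v t₀) (hmaps ⟨le_rfl, hlt.le⟩))
  refine ⟨v, f, G, H, r, R, ⟨hv, hf, hG, hH, hr0, hR0, ?_, hfv, ?_, ?_⟩, hvu⟩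
  · intro k hk
    refine iteratedDeriv_mem_graph hA (n := 4) hv (hf.of_le (by norm_num)) ?_ k hk
    intro t htt
    have htt' : t ∈ Icc t₀ t₁ := Ico_subset_Icc_self htt
    obtain ⟨hx, hder⟩ := hu t htt'
    have h1 : HasDerivWithinAt v (A ⟨u t, hx⟩ + g (u t)) (Icc t₀ t₁) t :=
      hder.congr hvu (hvu htt')
    have h2 : HasDerivWithinAt v (deriv v t) (Icc t₀ t₁) t :=
      (hv.differentiable (by norm_num) t).hasDerivAt.hasDerivWithinAt
    have h3 := (uniqueDiffOn_Icc ht t htt').eq_deriv _ h2 h1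
    have h4 := A.mem_graph ⟨u t, hx⟩
    rw [h3, hfv (hsub t htt'), Function.comp, hvu htt', add_sub_cancel_right]
    exact h4
  · intro t htt e he
    have h1 := norm_sub_taylor_two_le (convex_ball (v t) r) (K := R)
      (fun x hx => hd0 x (hball t htt hx)) (fun x hx => hd1 x (hball t htt hx))
      (fun x hx => hd2 x (hball t htt hx)) (fun x hx => by
        have := hR 3 (by norm_num) (by norm_num) x (hball t htt hx)
        rwa [← norm_iteratedFDeriv_fderiv, ← norm_iteratedFDeriv_fderiv,
          ← norm_iteratedFDeriv_fderiv, norm_iteratedFDeriv_zero] at this)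
      (Metric.mem_ball_self hr0) (e := e) (by simpa using he)
    rw [hfv htt, hGv htt, hHv htt]
    exact h1
  · intro t htt x hx y hy
    refine (convex_ball (v t) r).norm_image_sub_le_of_norm_fderiv_le
      (fun z hz => hd0 z (hball t (hsub t htt) hz)) (fun z hz => ?_) hy hx
    have := hR 1 le_rfl (by norm_num) z (hball t (hsub t htt) hz)
    rwa [← norm_iteratedFDeriv_fderiv, norm_iteratedFDeriv_zero] at this

end SmoothProblem

/-! ### Terms of order `h^k`, uniformly in time -/

section Order

/-- Pairs `(h, t)` of a step size `h → 0+` and a time `t ∈ [t₀, t₁)`. -/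
def stepFilter (t₀ t₁ : ℝ) : Filter (ℝ × ℝ) := 𝓝[>] 0 ×ˢ 𝓟 (Ico t₀ t₁)

variable {E E' : Type*} [NormedAddCommGroup E] [NormedAddCommGroup E'] {t₀ t₁ : ℝ}

theorem eventually_stepFilter {P : ℝ × ℝ → Prop} : (∀ᶠ p in stepFilter t₀ t₁, P p) ↔
    ∃ h₀ > 0, ∀ h t, 0 < h → h ≤ h₀ → t ∈ Ico t₀ t₁ → P (h, t) := by
  rw [stepFilter, eventually_prod_principal_iff, eventually_nhdsWithin_iff,
    Metric.eventually_nhds_iff]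
  constructor
  · rintro ⟨ε, hε, h⟩
    refine ⟨ε / 2, by positivity, fun h' t h0 h1 ht => h ?_ h0 t ht⟩
    rw [Real.dist_eq, sub_zero, abs_of_pos h0]
    linarith
  · rintro ⟨h₀, hh₀, h⟩
    refine ⟨h₀, hh₀, fun y hy hy0 t ht => h y t hy0 ?_ ht⟩
    rw [Real.dist_eq, sub_zero, abs_of_pos hy0] at hy
    exact hy.le

/-- `F(h, t) = O(h^k)`, uniformly for `t ∈ [t₀, t₁)`. -/
def IsOrd (t₀ t₁ : ℝ) (k : ℕ) (F : ℝ × ℝ → E) : Prop :=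
  F =O[stepFilter t₀ t₁] fun p => p.1 ^ k

theorem isOrd_iff {k : ℕ} {F : ℝ × ℝ → E} : IsOrd t₀ t₁ k F ↔ ∃ C h₀ : ℝ, 0 < h₀ ∧ 0 ≤ C ∧
    ∀ h t, 0 < h → h ≤ h₀ → t ∈ Ico t₀ t₁ → ‖F (h, t)‖ ≤ C * h ^ k := by
  rw [IsOrd, Asymptotics.isBigO_iff']
  constructor
  · rintro ⟨C, hC, h⟩
    obtain ⟨h₀, hh₀, h⟩ := eventually_stepFilter.1 h
    refine ⟨C, h₀, hh₀, hC.le, fun h' t h0 h1 ht => ?_⟩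
    simpa [abs_of_pos h0] using h h' t h0 h1 ht
  · rintro ⟨C, h₀, hh₀, hC, h⟩
    refine ⟨C + 1, by positivity, eventually_stepFilter.2 ⟨h₀, hh₀, fun h' t h0 h1 ht => ?_⟩⟩
    refine (h h' t h0 h1 ht).trans ?_
    rw [Real.norm_of_nonneg (pow_nonneg h0.le k)]
    gcongr
    linarith

theorem IsOrd.of_bound {k : ℕ} {F : ℝ × ℝ → E} (C h₀ : ℝ) (hh₀ : 0 < h₀)
    (h : ∀ h t, 0 < h → h ≤ h₀ → t ∈ Ico t₀ t₁ → ‖F (h, t)‖ ≤ C * h ^ k) : IsOrd t₀ t₁ k F :=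
  Asymptotics.IsBigO.of_bound C (eventually_stepFilter.2 ⟨h₀, hh₀, fun h' t h0 h1 ht => by
    rw [Real.norm_of_nonneg (pow_nonneg h0.le k)]; exact h h' t h0 h1 ht⟩)

theorem IsOrd.add {k : ℕ} {F F' : ℝ × ℝ → E} (h : IsOrd t₀ t₁ k F) (h' : IsOrd t₀ t₁ k F') :
    IsOrd t₀ t₁ k fun p => F p + F' p := Asymptotics.IsBigO.add h h'

theorem IsOrd.sub {k : ℕ} {F F' : ℝ × ℝ → E} (h : IsOrd t₀ t₁ k F) (h' : IsOrd t₀ t₁ k F') :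
    IsOrd t₀ t₁ k fun p => F p - F' p := Asymptotics.IsBigO.sub h h'

theorem IsOrd.sum {ι : Type*} {s : Finset ι} {k : ℕ} {F : ι → ℝ × ℝ → E}
    (h : ∀ i ∈ s, IsOrd t₀ t₁ k (F i)) : IsOrd t₀ t₁ k fun p => ∑ i ∈ s, F i p :=
  Asymptotics.IsBigO.fun_sum h

theorem IsOrd.mono {k m : ℕ} {F : ℝ × ℝ → E} (h : IsOrd t₀ t₁ m F) (hkm : k ≤ m) :
    IsOrd t₀ t₁ k F := by
  refine Asymptotics.IsBigO.trans h (Asymptotics.IsBigO.of_bound 1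
    (eventually_stepFilter.2 ⟨1, one_pos, fun h' t h0 h1 _ => ?_⟩))
  rw [Real.norm_of_nonneg (by positivity), Real.norm_of_nonneg (by positivity), one_mul]
  exact pow_le_pow_of_le_one h0.le h1 hkm

theorem IsOrd.congr {k : ℕ} {F F' : ℝ × ℝ → E} (h : IsOrd t₀ t₁ k F)
    (h' : ∀ h t, 0 < h → t ∈ Ico t₀ t₁ → F' (h, t) = F (h, t)) : IsOrd t₀ t₁ k F' :=
  Asymptotics.IsBigO.congr' h
    (eventually_stepFilter.2 ⟨1, one_pos, fun h t h0 _ ht => (h' h t h0 ht).symm⟩)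
    EventuallyEq.rfl

theorem isOrd_of_continuous {w : ℝ → E} (hw : Continuous w) :
    IsOrd t₀ t₁ 0 fun p => w p.2 := by
  obtain ⟨C, hC⟩ := isCompact_Icc.exists_bound_of_continuousOn (hw.continuousOn (s := Icc t₀ t₁))
  exact IsOrd.of_bound C 1 one_pos fun h t _ _ ht => by
    simpa using hC t (Ico_subset_Icc_self ht)

variable [NormedSpace ℝ E] [NormedSpace ℝ E']

theorem IsOrd.const_smul {k : ℕ} {F : ℝ × ℝ → E} (h : IsOrd t₀ t₁ k F) (c : ℝ) :
    IsOrd t₀ t₁ k fun p => c • F p := Asymptotics.IsBigO.const_smul_left h c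

theorem IsOrd.clm_apply {k m : ℕ} {P : ℝ × ℝ → E →L[ℝ] E'} {F : ℝ × ℝ → E}
    (hP : IsOrd t₀ t₁ k P) (hF : IsOrd t₀ t₁ m F) : IsOrd t₀ t₁ (k + m) fun p => P p (F p) := by
  have h1 : (fun p => P p (F p)) =O[stepFilter t₀ t₁] fun p => ‖P p‖ * ‖F p‖ :=
    Asymptotics.IsBigO.of_bound 1 (Eventually.of_forall fun p => by
      simpa using (P p).le_opNorm (F p))
  have h2 := h1.trans (hP.norm_left.mul hF.norm_left)
  simpa only [IsOrd, pow_add] using h2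

theorem IsOrd.pow_smul {k : ℕ} {F : ℝ × ℝ → E} (hF : IsOrd t₀ t₁ k F) (m : ℕ) :
    IsOrd t₀ t₁ (m + k) fun p => p.1 ^ m • F p := by
  have h1 : (fun p : ℝ × ℝ => p.1 ^ m) =O[stepFilter t₀ t₁] fun p => p.1 ^ m :=
    Asymptotics.isBigO_refl _ _
  have h2 := h1.smul hF
  simpa only [IsOrd, pow_add, smul_eq_mul] using h2

theorem isOrd_iteratedDeriv {w : ℝ → E} {n k : ℕ} (hw : ContDiff ℝ n w) (hk : k ≤ n) :
    IsOrd t₀ t₁ 0 fun p => iteratedDeriv k w p.2 :=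
  isOrd_of_continuous (hw.continuous_iteratedDeriv k (by exact_mod_cast hk))

theorem isOrd_taylor {w : ℝ → E} {n m : ℕ} (hw : ContDiff ℝ n w) (hm : m ≤ n) (c : ℝ≥0) :
    IsOrd t₀ t₁ m fun p => w (p.2 + c * p.1) -
      ∑ k ∈ Finset.range m, (((c : ℝ) * p.1) ^ k / (k ! : ℝ)) • iteratedDeriv k w p.2 := by
  obtain ⟨C, hC0, hC⟩ := exists_taylor_bound m (hw.of_le (by exact_mod_cast hm)) t₀ t₁ c
  refine IsOrd.of_bound (C * (c : ℝ) ^ m) 1 one_pos fun h t h0 h1 ht => ?_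
  refine (hC t (Ico_subset_Icc_self ht) (c * h) ⟨by positivity, ?_⟩).trans (le_of_eq (by ring))
  exact mul_le_of_le_one_right (NNReal.coe_nonneg c) h1

variable {X : Type v} [NormedAddCommGroup X] [NormedSpace ℝ X] [CompleteSpace X]
  {T : ℝ → X →L[ℝ] X} (hT : IsC0Semigroup T)

theorem isOrd_opL (f : Coeff) : IsOrd t₀ t₁ 0 fun p => opL hT p.1 f := by
  obtain ⟨C, -, hC⟩ := exists_norm_opL_le hT f 1
  exact IsOrd.of_bound C 1 one_pos fun h t _ h1 _ => by simpa using hC h h1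

theorem isOrd_phiL (k : ℕ) (c : ℝ≥0) : IsOrd t₀ t₁ 0 fun p => phiL hT k (c * p.1) := by
  obtain ⟨C, -, hC⟩ := exists_norm_phiL_le hT c
  exact IsOrd.of_bound C 1 one_pos fun h t _ h1 _ => by
    simpa using hC k _ (mul_le_of_le_one_right (NNReal.coe_nonneg c) h1)

end Order

/-! ### Expansion of the exact solution -/

section Exact

variable {X : Type v} [NormedAddCommGroup X] [NormedSpace ℝ X] [CompleteSpace X]
  {T : ℝ → X →L[ℝ] X} {A : X →ₗ.[ℝ] X}
  {g : X → X} {t₀ t₁ : ℝ} {v f : ℝ → X} {G : ℝ → X →L[ℝ] X} {H : ℝ → X →L[ℝ] X →L[ℝ] X} {r K : ℝ}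

theorem integral_polynomial_smul_semigroup (hT : IsC0Semigroup T) (n : ℕ) (x : ℕ → X) {h : ℝ}
    (hh : 0 ≤ h) :
    ∫ s in (0 : ℝ)..h, T (h - s) (∑ k ∈ Finset.range n, (s ^ k / (k ! : ℝ)) • x k) =
      ∑ k ∈ Finset.range n, h ^ (k + 1) • phiL hT (k + 1) h (x k) := by
  simp only [map_sum]
  rw [intervalIntegral.integral_finsetSum]
  · exact Finset.sum_congr rfl fun k _ => integral_pow_smul_semigroup hT k hh (x k)
  · intro k _
    refine ContinuousOn.intervalIntegrable ?_
    rw [uIcc_of_le hh]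
    exact hT.continuousOn_uncurry.comp (f := fun s => (h - s, (s ^ k / (k ! : ℝ)) • x k))
      (by fun_prop) fun s hs => ⟨sub_nonneg.2 hs.2, mem_univ _⟩

/-- The Taylor polynomial of the solution satisfies the variation of constants formula up to a
term of the order of its remainder. -/
theorem SmoothProblem.taylor_eq (hT : IsC0Semigroup T) (hA : IsGenerator A T)
    (hP : SmoothProblem A g t₀ t₁ v f G H r K) {t : ℝ} (ht : t ∈ Ico t₀ t₁) {τ : ℝ} (hτ : 0 ≤ τ) :
    ∑ k ∈ Finset.range 5, (τ ^ k / (k ! : ℝ)) • iteratedDeriv k v t =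
      T τ (v t) + ∑ k ∈ Finset.range 5, τ ^ (k + 1) • phiL hT (k + 1) τ (iteratedDeriv k f t) -
        τ ^ 5 • phiL hT 5 τ (iteratedDeriv 5 v t) := by
  -- For the Taylor polynomial `p` of degree four, `A p` contains a term `s^4/4! v^(5)(t)` that `p'`
  -- lacks; the defect is put into the inhomogeneity. Only graph relations at the single time `t`
  -- are used, never the equation beyond `t₁`.
  set x : ℕ → X := fun k => iteratedDeriv k f t - if k = 4 then iteratedDeriv 5 v t else 0 with hx
  have hder : ∀ s : ℝ, HasDerivAt
      (fun s => ∑ k ∈ Finset.range 5, (s ^ k / (k ! : ℝ)) • iteratedDeriv k v t)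
      (∑ k ∈ Finset.range 4, (s ^ k / (k ! : ℝ)) • iteratedDeriv (k + 1) v t) s := by
    intro s
    have h1 : ∀ k ∈ Finset.range 5, HasDerivAt (fun s : ℝ =>
        (s ^ k / (k ! : ℝ)) • iteratedDeriv k v t)
        (((k : ℝ) * s ^ (k - 1) / (k ! : ℝ)) • iteratedDeriv k v t) s := fun k _ =>
      ((hasDerivAt_pow k s).div_const _).smul_const _
    have h2 := HasDerivAt.fun_sum h1
    rw [Finset.sum_range_succ'] at h2
    convert h2 using 1
    simp only [CharP.cast_eq_zero, zero_mul, zero_div, zero_smul, add_zero]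
    refine Finset.sum_congr rfl fun k _ => ?_
    rw [Nat.factorial_succ]
    congr 1
    push_cast
    rw [mul_div_mul_left _ _ (by positivity)]
  have key := hT.variation_of_constants hA
    (y := fun s => ∑ k ∈ Finset.range 5, (s ^ k / (k ! : ℝ)) • iteratedDeriv k v t)
    (q := fun s => ∑ k ∈ Finset.range 5, (s ^ k / (k ! : ℝ)) • x k) hτ
    (fun s _ => (hder s).continuousAt.continuousWithinAt) (by fun_prop)
    (fun s _ => (hder s).hasDerivWithinAt) (fun s _ => by
      have h1 : (∑ k ∈ Finset.range 5, (s ^ k / (k ! : ℝ)) • (iteratedDeriv k v t,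
          iteratedDeriv (k + 1) v t - iteratedDeriv k f t)) ∈ A.graph :=
        A.graph.sum_mem fun k hk => A.graph.smul_mem _
          (hP.graph k (by rw [Finset.mem_range] at hk; omega) t ht)
      convert h1 using 1
      refine Prod.ext ?_ ?_
      · simp [Prod.fst_sum]
      · simp only [hx, Finset.sum_range_succ, Finset.sum_range_zero]
        norm_num
        module)
  rw [key, integral_polynomial_smul_semigroup hT 5 x hτ, add_sub_assoc]
  congr 1
  · simp [Finset.sum_range_succ]
  · simp [Finset.sum_range_succ, hx, smul_sub]

/-- Expansion of the exact solution at the nodes of the method, also beyond the end point. -/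
theorem SmoothProblem.isOrd_node (hT : IsC0Semigroup T) (hA : IsGenerator A T)
    (hP : SmoothProblem A g t₀ t₁ v f G H r K) (c : ℝ≥0) :
    IsOrd t₀ t₁ 5 fun p => v (p.2 + c * p.1) - (v p.2 + phiF T g (c * p.1) (v p.2) +
      ((c * p.1) ^ 2 • phiL hT 2 (c * p.1) (iteratedDeriv 1 f p.2) +
       (c * p.1) ^ 3 • phiL hT 3 (c * p.1) (iteratedDeriv 2 f p.2) +
       (c * p.1) ^ 4 • phiL hT 4 (c * p.1) (iteratedDeriv 3 f p.2))) := by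
  have h1 := isOrd_taylor (t₀ := t₀) (t₁ := t₁) hP.v_smooth le_rfl c
  have h2 : IsOrd t₀ t₁ 5 fun p => p.1 ^ 5 • ((c : ℝ) ^ 5 • phiL hT 5 (c * p.1)
      (iteratedDeriv 4 f p.2 - iteratedDeriv 5 v p.2)) :=
    (((isOrd_phiL hT 5 c).clm_apply ((isOrd_iteratedDeriv hP.f_smooth (by norm_num)).sub
      (isOrd_iteratedDeriv hP.v_smooth le_rfl))).const_smul _).pow_smul 5
  refine (h1.add h2).congr fun h t h0 ht => ?_
  have hτ : 0 ≤ (c : ℝ) * h := by positivity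
  have hf : g (v t) = iteratedDeriv 0 f t := by
    rw [iteratedDeriv_zero, hP.f_eq t ⟨ht.1, by linarith [ht.2, hP.r_pos]⟩]
  simp only
  rw [hP.taylor_eq hT hA ht hτ, phiF, ← phiL_apply hT 1 hτ, hf]
  simp only [Finset.sum_range_succ, Finset.sum_range_zero, map_sub]
  module

/-- One step of the exact solution. -/
theorem SmoothProblem.exists_exact_step_bound (hT : IsC0Semigroup T) (hA : IsGenerator A T)
    (hP : SmoothProblem A g t₀ t₁ v f G H r K) : ∃ C : ℝ, 0 ≤ C ∧ ∀ h t, 0 < h → h ≤ 1 → t₀ ≤ t →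
      t + h ≤ t₁ → ‖v (t + h) - (T h (v t) +
        ∑ k ∈ Finset.range 5, h ^ (k + 1) • phiL hT (k + 1) h (iteratedDeriv k f t))‖ ≤
          C * h ^ 6 := by
  obtain ⟨C, hC0, hC⟩ := exists_taylor_bound 5 hP.f_smooth t₀ t₁ 1
  obtain ⟨M, hM0, hM⟩ := hT.exists_norm_le 1
  refine ⟨M * C, by positivity, fun h t h0 h1 ht0 hth => ?_⟩
  have hcont : ∀ q : ℝ → X, Continuous q → IntervalIntegrable (fun s => T (h - s) (q s))
      MeasureTheory.volume 0 h := by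
    intro q hq
    refine ContinuousOn.intervalIntegrable ?_
    rw [uIcc_of_le h0.le]
    exact hT.continuousOn_uncurry.comp (f := fun s => (h - s, q s))
      (by fun_prop) fun s hs => ⟨sub_nonneg.2 hs.2, mem_univ _⟩
  have hvc := hP.v_smooth.continuous
  have hfc := hP.f_smooth.continuous
  -- As `t + h ≤ t₁`, the equation itself is available. Only `f` is expanded, and integrating its
  -- `O(h^5)` remainder gives `h^6` without a sixth derivative of `v`.
  have key := hT.variation_of_constants hA (y := fun s => v (t + s)) (y' := fun s => deriv v (t + s))
    (q := fun s => f (t + s)) h0.le (by fun_prop) (by fun_prop)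
    (fun s _ => ((hP.v_smooth.differentiable (by norm_num) (t + s)).hasDerivAt.comp_const_add
      t s).hasDerivWithinAt)
    (fun s hs => by
      simpa [iteratedDeriv_one] using hP.graph 0 (by norm_num) (t + s)
        ⟨by linarith [hs.1], by linarith [hs.2]⟩)
  simp only [add_zero] at key
  rw [key, ← integral_polynomial_smul_semigroup hT 5 _ h0.le, add_sub_add_left_eq_sub,
    ← intervalIntegral.integral_sub (hcont _ (by fun_prop)) (hcont _ (by fun_prop))]
  have := intervalIntegral.norm_integral_le_of_norm_le_const (a := 0) (b := h)
    (f := fun s => T (h - s) (f (t + s)) -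
      T (h - s) (∑ k ∈ Finset.range 5, (s ^ k / (k ! : ℝ)) • iteratedDeriv k f t))
    (C := M * (C * h ^ 5)) (by
      intro s hs
      rw [uIoc_of_le h0.le] at hs
      rw [← map_sub]
      refine ((T _).le_of_opNorm_le (hM _ (by linarith [hs.2]) (by linarith [hs.1])) _).trans ?_
      refine mul_le_mul_of_nonneg_left ?_ hM0.le
      refine (hC t ⟨ht0, by linarith⟩ s ⟨hs.1.le, by linarith [hs.2]⟩).trans ?_
      exact mul_le_mul_of_nonneg_left (pow_le_pow_left₀ hs.1.le hs.2 5) hC0)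
  rw [sub_zero, abs_of_pos h0] at this
  refine this.trans (le_of_eq (by ring))

end Exact

/-! ### Expansion of the local error -/

section Local

variable {X : Type v} [NormedAddCommGroup X] [NormedSpace ℝ X]
  {A : X →ₗ.[ℝ] X} {g : X → X} {t₀ t₁ : ℝ} {v f : ℝ → X} {G : ℝ → X →L[ℝ] X}
  {H : ℝ → X →L[ℝ] X →L[ℝ] X} {r K : ℝ}

/-- The remainder is cubic in `E`, hence `O(h^6)`, so no third derivative of `g` enters the
expansion. -/
theorem SmoothProblem.isOrd_expand (hP : SmoothProblem A g t₀ t₁ v f G H r K) (c : ℝ≥0)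
    {E : ℝ × ℝ → X} (hE : IsOrd t₀ t₁ 2 E) :
    IsOrd t₀ t₁ 5 fun p => g (v (p.2 + c * p.1) + E p) - f (p.2 + c * p.1) -
      G (p.2 + c * p.1) (E p) - (1 / 2 : ℝ) • H (p.2 + c * p.1) (E p) (E p) := by
  obtain ⟨C, h₀, hh₀, hC, hE⟩ := isOrd_iff.1 hE
  have hr := hP.r_pos
  have hc : (0 : ℝ) ≤ c := c.2
  -- The last two bounds on `h` ensure `‖E‖ < r` and `c h ≤ r`, as required by `expand`.
  refine IsOrd.of_bound (K * C ^ 3) (min (min h₀ 1) (min (r / (2 * (C + 1))) (r / (c + 1))))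
    (by positivity) fun h t h0 h1 ht => ?_
  have h1a : h ≤ h₀ := h1.trans ((min_le_left _ _).trans (min_le_left _ _))
  have h1b : h ≤ 1 := h1.trans ((min_le_left _ _).trans (min_le_right _ _))
  have h1c : h ≤ r / (2 * (C + 1)) := h1.trans ((min_le_right _ _).trans (min_le_left _ _))
  have h1d : h ≤ r / (c + 1) := h1.trans ((min_le_right _ _).trans (min_le_right _ _))
  rw [le_div_iff₀ (by positivity)] at h1c h1d
  have hEb := hE h t h0 h1a ht
  have hEr : ‖E (h, t)‖ < r := by
    refine hEb.trans_lt ?_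
    have : C * h ^ 2 ≤ C * h := mul_le_mul_of_nonneg_left (by nlinarith) hC
    nlinarith
  refine (hP.expand (t + c * h) ⟨?_, ?_⟩ _ hEr).trans ?_
  · have : 0 ≤ (c : ℝ) * h := by positivity
    linarith [ht.1]
  · nlinarith [ht.2]
  · have hK := hP.K_nonneg
    calc K * ‖E (h, t)‖ ^ 3 ≤ K * (C * h ^ 2) ^ 3 := by gcongr
      _ = K * C ^ 3 * (h ^ 5 * h) := by ring
      _ ≤ K * C ^ 3 * (h ^ 5 * 1) := by gcongr
      _ = _ := by ring

/-- Expansion of `g` along the solution, at a perturbation of order `h^2`. -/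
theorem SmoothProblem.isOrd_increment (hP : SmoothProblem A g t₀ t₁ v f G H r K) (c : ℝ≥0)
    {E e₂ e₃ e₄ : ℝ × ℝ → X} (h₂ : IsOrd t₀ t₁ 0 e₂) (h₃ : IsOrd t₀ t₁ 0 e₃)
    (h₄ : IsOrd t₀ t₁ 0 e₄)
    (hE : IsOrd t₀ t₁ 5 fun p => E p - (p.1 ^ 2 • e₂ p + p.1 ^ 3 • e₃ p + p.1 ^ 4 • e₄ p)) :
    IsOrd t₀ t₁ 5 fun p => g (v (p.2 + c * p.1) + E p) - g (v p.2) -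
      (p.1 • (c : ℝ) • iteratedDeriv 1 f p.2 +
       p.1 ^ 2 • (((c : ℝ) ^ 2 / 2) • iteratedDeriv 2 f p.2 + G p.2 (e₂ p)) +
       p.1 ^ 3 • (((c : ℝ) ^ 3 / 6) • iteratedDeriv 3 f p.2 + G p.2 (e₃ p) +
         (c : ℝ) • iteratedDeriv 1 G p.2 (e₂ p)) +
       p.1 ^ 4 • (((c : ℝ) ^ 4 / 24) • iteratedDeriv 4 f p.2 + G p.2 (e₄ p) +
         (c : ℝ) • iteratedDeriv 1 G p.2 (e₃ p) +
         ((c : ℝ) ^ 2 / 2) • iteratedDeriv 2 G p.2 (e₂ p) +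
         (1 / 2 : ℝ) • H p.2 (e₂ p) (e₂ p))) := by
  have hE4 : IsOrd t₀ t₁ 4 fun p => E p - (p.1 ^ 2 • e₂ p + p.1 ^ 3 • e₃ p) :=
    ((hE.mono (by norm_num : 4 ≤ 5)).add (h₄.pow_smul 4)).congr fun h t _ _ => by abel
  have hE3 : IsOrd t₀ t₁ 3 fun p => E p - p.1 ^ 2 • e₂ p :=
    ((hE4.mono (by norm_num : 3 ≤ 4)).add (h₃.pow_smul 3)).congr fun h t _ _ => by abel
  have hE2 : IsOrd t₀ t₁ 2 E :=
    ((hE3.mono (by norm_num : 2 ≤ 3)).add (h₂.pow_smul 2)).congr fun h t _ _ => by abel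
  have hG : ∀ k ≤ 4, IsOrd t₀ t₁ 0 fun p => iteratedDeriv k G p.2 := fun k hk =>
    isOrd_iteratedDeriv hP.G_smooth hk
  have hH : IsOrd t₀ t₁ 0 fun p => H p.2 := isOrd_of_continuous hP.H_smooth.continuous
  -- `R1` is the remainder of `g`; `R2` to `R4` are the Taylor remainders in time of `f`, `G`, `H`;
  -- `R5` to `R8` replace `E` by its expansion, with just as many terms as the accompanying power of
  -- `h` demands.
  have R1 := hP.isOrd_expand c hE2
  have R2 := isOrd_taylor (t₀ := t₀) (t₁ := t₁) hP.f_smooth (le_refl 5) c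
  have R3 := (isOrd_taylor (t₀ := t₀) (t₁ := t₁) hP.G_smooth (by norm_num : 3 ≤ 4) c).clm_apply hE2
  have R4 := (((isOrd_taylor (t₀ := t₀) (t₁ := t₁) hP.H_smooth (by norm_num : 1 ≤ 3) c).clm_apply
    hE2).clm_apply hE2).const_smul (1 / 2 : ℝ)
  have R5 := (hG 0 (by norm_num)).clm_apply hE
  have R6 := (((hG 1 (by norm_num)).clm_apply hE4).const_smul (c : ℝ)).pow_smul 1
  have R7 := (((hG 2 (by norm_num)).clm_apply hE3).const_smul ((c : ℝ) ^ 2 / 2)).pow_smul 2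
  have R8 := (((hH.clm_apply hE3).clm_apply hE2).add
    ((hH.clm_apply (h₂.pow_smul 2)).clm_apply hE3)).const_smul (1 / 2 : ℝ)
  refine (((((((R1.add R2).add R3).add R4).add R5).add R6).add R7).add R8).congr fun h t h0 ht => ?_
  have hf : g (v t) = f t := (hP.f_eq t ⟨ht.1, by linarith [ht.2, hP.r_pos]⟩).symm
  simp only [Finset.sum_range_succ, Finset.sum_range_zero, iteratedDeriv_zero, hf, map_sub, map_add,
    map_smul, sub_apply, add_apply, smul_apply, zero_add, pow_zero, Nat.factorial]
  push_cast
  module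

end Local

/-! ### Operators of the coefficient functions of a method -/

section Conditions

variable {X : Type v} [NormedAddCommGroup X] [NormedSpace ℝ X] [CompleteSpace X]
  {T : ℝ → X →L[ℝ] X} (hT : IsC0Semigroup T)

theorem opL_single (k : ℕ) (σ : ℝ≥0) (a h : ℝ) :
    opL hT h (Finsupp.single (k, σ) a) = a • phiL hT k (σ * h) := by
  simp [opL_eq_sum]

theorem opL_psiCoeff (M : Method) (k i : ℕ) (h : ℝ) : opL hT h (M.psiCoeff k i) =
    ∑ j ∈ Finset.Ico 2 i, ((M.c j : ℝ) ^ (k - 1) / ((k - 1)! : ℝ)) • opL hT h (M.a i j) -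
      (M.c i : ℝ) ^ k • phiL hT k (M.c i * h) := by
  rw [Method.psiCoeff, map_sub, map_sum, opL_single]
  simp only [map_smul]

theorem opL_zero_apply (f : Coeff) (x : X) : opL hT 0 f x = Coeff.scal 0 f • x := by
  rw [opL_apply hT f le_rfl, Coeff.op, Coeff.scal, Coeff.test_eq_sum, Finsupp.sum, Finsupp.sum,
    Finset.sum_smul]
  refine Finset.sum_congr rfl fun p _ => ?_
  obtain ⟨k, σ⟩ := p
  rw [mul_smul]
  congr 1
  cases k with
  | zero => simp [phi, phiTest, hT.map_zero]
  | succ k =>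
    simp only [phi, phiTest, mul_zero, hT.map_zero, Real.exp_zero, mul_one]
    exact intervalIntegral.integral_smul_const _ _

/-- Matrices of format one already yield the scalar identity at every real `z`, which is all that
`opL_eq_zero` requires. -/
theorem sum_smul_opL_eq_phiL {M : Method} {m : ℕ} (hM : ∀ Z : Mat 1, M.QuadCond m Z) {h : ℝ}
    (hh : 0 ≤ h) (x : X) :
    ∑ i ∈ Finset.Icc 2 M.s, ((M.c i : ℝ) ^ m / (m ! : ℝ)) • opL hT h (M.b i) x =
      phiL hT (m + 1) h x := by
  have h1 := opL_eq_zero hT (f := ∑ i ∈ Finset.Icc 2 M.s, ((M.c i : ℝ) ^ m / (m ! : ℝ)) • M.b i -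
    Finsupp.single (m + 1, 1) 1) (fun z => by
      rw [map_sub, ← (hM (z • 1)).scal (x := EuclideanSpace.single 0 1) (by simp) (by simp)]
      simp) hh
  rw [map_sub, opL_single, sub_eq_zero, NNReal.coe_one, one_mul, one_smul] at h1
  rw [← h1]
  simp [sum_apply]

end Conditions

/-! ### Expansion of the stages -/

section Expansion

variable {X : Type v} [NormedAddCommGroup X] [NormedSpace ℝ X] [CompleteSpace X]
  {T : ℝ → X →L[ℝ] X} (hT : IsC0Semigroup T) (M : Method) (f : ℝ → X) (G : ℝ → X →L[ℝ] X)
  (H : ℝ → X →L[ℝ] X →L[ℝ] X)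

/-- The coefficient of `h^2` in the error of the `i`-th stage. -/
def stageErr₂ (i : ℕ) (p : ℝ × ℝ) : X := opL hT p.1 (M.psiCoeff 2 i) (iteratedDeriv 1 f p.2)

/-- The coefficient of `h^3` in the error of the `i`-th stage. -/
def stageErr₃ (i : ℕ) (p : ℝ × ℝ) : X := opL hT p.1 (M.psiCoeff 3 i) (iteratedDeriv 2 f p.2) +
  ∑ j ∈ Finset.Ico 2 i, opL hT p.1 (M.a i j) (G p.2 (stageErr₂ hT M f j p))

/-- The coefficient of `h^4` in the error of the `i`-th stage. -/
def stageErr₄ (i : ℕ) (p : ℝ × ℝ) : X := opL hT p.1 (M.psiCoeff 4 i) (iteratedDeriv 3 f p.2) +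
  ∑ j ∈ Finset.Ico 2 i, opL hT p.1 (M.a i j) (G p.2 (stageErr₃ hT M f G j p) +
    (M.c j : ℝ) • iteratedDeriv 1 G p.2 (stageErr₂ hT M f j p))

/-- The coefficient of `h` in `g(U_{ni}) - g(u(t_n))`. -/
def incr₁ (i : ℕ) (p : ℝ × ℝ) : X := (M.c i : ℝ) • iteratedDeriv 1 f p.2

/-- The coefficient of `h^2` in `g(U_{ni}) - g(u(t_n))`. -/
def incr₂ (i : ℕ) (p : ℝ × ℝ) : X :=
  ((M.c i : ℝ) ^ 2 / 2) • iteratedDeriv 2 f p.2 + G p.2 (stageErr₂ hT M f i p)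

/-- The coefficient of `h^3` in `g(U_{ni}) - g(u(t_n))`. -/
def incr₃ (i : ℕ) (p : ℝ × ℝ) : X :=
  ((M.c i : ℝ) ^ 3 / 6) • iteratedDeriv 3 f p.2 + G p.2 (stageErr₃ hT M f G i p) +
    (M.c i : ℝ) • iteratedDeriv 1 G p.2 (stageErr₂ hT M f i p)

/-- The coefficient of `h^4` in `g(U_{ni}) - g(u(t_n))`. -/
def incr₄ (i : ℕ) (p : ℝ × ℝ) : X :=
  ((M.c i : ℝ) ^ 4 / 24) • iteratedDeriv 4 f p.2 + G p.2 (stageErr₄ hT M f G i p) +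
    (M.c i : ℝ) • iteratedDeriv 1 G p.2 (stageErr₃ hT M f G i p) +
    ((M.c i : ℝ) ^ 2 / 2) • iteratedDeriv 2 G p.2 (stageErr₂ hT M f i p) +
    (1 / 2 : ℝ) • H p.2 (stageErr₂ hT M f i p) (stageErr₂ hT M f i p)

/-- The definition displays the `ψ` that the order conditions annihilate, while this form is the one
produced by the recursion for the stages. The same holds for the next two lemmas. -/
theorem stageErr₂_eq (i : ℕ) (p : ℝ × ℝ) : stageErr₂ hT M f i p =
    ∑ j ∈ Finset.Ico 2 i, opL hT p.1 (M.a i j) (incr₁ M f j p) -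
      (M.c i : ℝ) ^ 2 • phiL hT 2 (M.c i * p.1) (iteratedDeriv 1 f p.2) := by
  simp [stageErr₂, opL_psiCoeff, incr₁, sum_apply]

theorem stageErr₃_eq (i : ℕ) (p : ℝ × ℝ) : stageErr₃ hT M f G i p =
    ∑ j ∈ Finset.Ico 2 i, opL hT p.1 (M.a i j) (incr₂ hT M f G j p) -
      (M.c i : ℝ) ^ 3 • phiL hT 3 (M.c i * p.1) (iteratedDeriv 2 f p.2) := by
  simp only [stageErr₃, opL_psiCoeff, incr₂, sum_apply, sub_apply, smul_apply, map_add, map_smul,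
    Finset.sum_add_distrib, Nat.factorial]
  norm_num
  abel

theorem stageErr₄_eq (i : ℕ) (p : ℝ × ℝ) : stageErr₄ hT M f G i p =
    ∑ j ∈ Finset.Ico 2 i, opL hT p.1 (M.a i j) (incr₃ hT M f G j p) -
      (M.c i : ℝ) ^ 4 • phiL hT 4 (M.c i * p.1) (iteratedDeriv 3 f p.2) := by
  simp only [stageErr₄, opL_psiCoeff, incr₃, sum_apply, sub_apply, smul_apply, map_add, map_smul,
    Finset.sum_add_distrib, Nat.factorial]
  norm_num
  abel

variable {M f G H} {A : X →ₗ.[ℝ] X} {g : X → X} {t₀ t₁ : ℝ} {v : ℝ → X} {r K : ℝ}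

theorem SmoothProblem.isOrd_stageErr₂ (hP : SmoothProblem A g t₀ t₁ v f G H r K) (i : ℕ) :
    IsOrd t₀ t₁ 0 (stageErr₂ hT M f i) :=
  (isOrd_opL hT _).clm_apply (isOrd_iteratedDeriv hP.f_smooth (by norm_num))

theorem SmoothProblem.isOrd_stageErr₃ (hP : SmoothProblem A g t₀ t₁ v f G H r K) (i : ℕ) :
    IsOrd t₀ t₁ 0 (stageErr₃ hT M f G i) :=
  ((isOrd_opL hT _).clm_apply (isOrd_iteratedDeriv hP.f_smooth (by norm_num))).add
    (IsOrd.sum fun j _ => (isOrd_opL hT _).clm_apply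
      ((isOrd_of_continuous hP.G_smooth.continuous).clm_apply (hP.isOrd_stageErr₂ hT j)))

theorem SmoothProblem.isOrd_stageErr₄ (hP : SmoothProblem A g t₀ t₁ v f G H r K) (i : ℕ) :
    IsOrd t₀ t₁ 0 (stageErr₄ hT M f G i) :=
  ((isOrd_opL hT _).clm_apply (isOrd_iteratedDeriv hP.f_smooth (by norm_num))).add
    (IsOrd.sum fun j _ => (isOrd_opL hT _).clm_apply
      (((isOrd_of_continuous hP.G_smooth.continuous).clm_apply (hP.isOrd_stageErr₃ hT j)).add
        (((isOrd_iteratedDeriv hP.G_smooth (by norm_num)).clm_apply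
          (hP.isOrd_stageErr₂ hT j)).const_smul _)))

theorem SmoothProblem.isOrd_incr₄ (hP : SmoothProblem A g t₀ t₁ v f G H r K) (i : ℕ) :
    IsOrd t₀ t₁ 0 (incr₄ hT M f G H i) :=
  (((((isOrd_iteratedDeriv hP.f_smooth (by norm_num)).const_smul _).add
    ((isOrd_of_continuous hP.G_smooth.continuous).clm_apply (hP.isOrd_stageErr₄ hT i))).add
    (((isOrd_iteratedDeriv hP.G_smooth (by norm_num)).clm_apply
      (hP.isOrd_stageErr₃ hT i)).const_smul _)).add
    (((isOrd_iteratedDeriv hP.G_smooth (by norm_num)).clm_apply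
      (hP.isOrd_stageErr₂ hT i)).const_smul _)).add
    ((((isOrd_of_continuous hP.H_smooth.continuous).clm_apply (hP.isOrd_stageErr₂ hT i)).clm_apply
      (hP.isOrd_stageErr₂ hT i)).const_smul _)

/-- The link in the induction over the stages: later stages use earlier ones only through these
increments of `g`. -/
theorem SmoothProblem.isOrd_incr_of_stage (hP : SmoothProblem A g t₀ t₁ v f G H r K) {i : ℕ}
    (hi : IsOrd t₀ t₁ 5 fun p => stage M T g p.1 (v p.2) i - v (p.2 + M.c i * p.1) -
      (p.1 ^ 2 • stageErr₂ hT M f i p + p.1 ^ 3 • stageErr₃ hT M f G i p +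
        p.1 ^ 4 • stageErr₄ hT M f G i p)) :
    IsOrd t₀ t₁ 5 fun p => g (stage M T g p.1 (v p.2) i) - g (v p.2) -
      (p.1 • incr₁ M f i p + p.1 ^ 2 • incr₂ hT M f G i p + p.1 ^ 3 • incr₃ hT M f G i p +
        p.1 ^ 4 • incr₄ hT M f G H i p) := by
  refine (hP.isOrd_increment (M.c i) (hP.isOrd_stageErr₂ hT i) (hP.isOrd_stageErr₃ hT i)
    (hP.isOrd_stageErr₄ hT i) hi).congr fun h t _ _ => ?_
  simp only [add_sub_cancel]
  rfl

/-- Expansion of the internal stages, started on the exact solution. -/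
theorem SmoothProblem.isOrd_stage (hA : IsGenerator A T)
    (hP : SmoothProblem A g t₀ t₁ v f G H r K) (i : ℕ) :
    IsOrd t₀ t₁ 5 fun p => stage M T g p.1 (v p.2) i - v (p.2 + M.c i * p.1) -
      (p.1 ^ 2 • stageErr₂ hT M f i p + p.1 ^ 3 • stageErr₃ hT M f G i p +
        p.1 ^ 4 • stageErr₄ hT M f G i p) := by
  induction i using Nat.strong_induction_on with
  | _ i ih =>
  -- The recursion carries a factor `h`, so the increments are needed up to `h^3` only; their `h^4`
  -- terms go into the remainder `R2`.
  have R1 : IsOrd t₀ t₁ 5 fun p => p.1 ^ 1 • ∑ j ∈ Finset.Ico 2 i, opL hT p.1 (M.a i j)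
      (g (stage M T g p.1 (v p.2) j) - g (v p.2) -
      (p.1 • incr₁ M f j p + p.1 ^ 2 • incr₂ hT M f G j p + p.1 ^ 3 • incr₃ hT M f G j p +
        p.1 ^ 4 • incr₄ hT M f G H j p)) :=
    ((IsOrd.sum fun j hj => (isOrd_opL hT (M.a i j)).clm_apply
      (hP.isOrd_incr_of_stage hT (ih j (Finset.mem_Ico.1 hj).2))).pow_smul 1).mono (by norm_num)
  have R2 : IsOrd t₀ t₁ 5 fun p => p.1 ^ 5 • ∑ j ∈ Finset.Ico 2 i, opL hT p.1 (M.a i j)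
      (incr₄ hT M f G H j p) :=
    (IsOrd.sum fun j _ => (isOrd_opL hT (M.a i j)).clm_apply (hP.isOrd_incr₄ hT j)).pow_smul 5
  refine ((R1.add R2).sub (hP.isOrd_node hT hA (M.c i))).congr fun h t h0 ht => ?_
  rw [stage_eq, stageErr₂_eq, stageErr₃_eq, stageErr₄_eq]
  simp only [← opL_apply hT _ h0.le, map_sub, map_add, map_smul, Finset.sum_sub_distrib,
    Finset.sum_add_distrib, ← Finset.smul_sum]
  module

theorem SmoothProblem.isOrd_incr (hA : IsGenerator A T)
    (hP : SmoothProblem A g t₀ t₁ v f G H r K) (i : ℕ) :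
    IsOrd t₀ t₁ 5 fun p => g (stage M T g p.1 (v p.2) i) - g (v p.2) -
      (p.1 • incr₁ M f i p + p.1 ^ 2 • incr₂ hT M f G i p + p.1 ^ 3 • incr₃ hT M f G i p +
        p.1 ^ 4 • incr₄ hT M f G H i p) :=
  hP.isOrd_incr_of_stage hT (hP.isOrd_stage hT hA i)

/-! ### Cancellations from the order conditions -/

section OrderConditions

variable (f G H) {p : ℝ × ℝ}

theorem sum_incr₁ (hM : M.FullConditions) (hp : 0 ≤ p.1) :
    ∑ i ∈ Finset.Icc 2 M.s, opL hT p.1 (M.b i) (incr₁ M f i p) =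
      phiL hT 2 p.1 (iteratedDeriv 1 f p.2) := by
  rw [← sum_smul_opL_eq_phiL hT (hM.cond1 1) hp]
  simp [incr₁]

theorem sum_incr₂ (hM : M.FullConditions) (hp : 0 ≤ p.1) :
    ∑ i ∈ Finset.Icc 2 M.s, opL hT p.1 (M.b i) (incr₂ hT M f G i p) =
      phiL hT 3 p.1 (iteratedDeriv 2 f p.2) := by
  have h1 := sum_opL_comp_opL_eq_zero hT hp _ _ _ hM.scal_cond3 (G p.2) (iteratedDeriv 1 f p.2)
  rw [← sum_smul_opL_eq_phiL hT (hM.cond2 1) hp]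
  simp only [incr₂, stageErr₂, map_add, map_smul, Finset.sum_add_distrib]
  rw [h1]
  simp [Nat.factorial]

theorem sum_incr₃ (hM : M.FullConditions) (hp : 0 ≤ p.1) :
    ∑ i ∈ Finset.Icc 2 M.s, opL hT p.1 (M.b i) (incr₃ hT M f G i p) =
      phiL hT 4 p.1 (iteratedDeriv 3 f p.2) := by
  have h1 := sum_opL_comp_opL_eq_zero hT hp _ _ _ hM.scal_cond5 (G p.2) (iteratedDeriv 2 f p.2)
  have h2 := sum_opL_comp_sum_opL_comp_opL_eq_zero hT hp _ _ _ _ _ hM.scal_cond6 (G p.2) (G p.2)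
    (iteratedDeriv 1 f p.2)
  have h3 := sum_opL_comp_opL_eq_zero hT hp _ _ _ hM.scal_cond7 (iteratedDeriv 1 G p.2)
    (iteratedDeriv 1 f p.2)
  rw [← sum_smul_opL_eq_phiL hT (hM.cond4 1) hp]
  simp only [incr₃, stageErr₃, stageErr₂, map_add, map_smul, Finset.sum_add_distrib]
  simp only [map_smul, smul_apply] at h3
  rw [h1, h2, h3]
  simp [Nat.factorial]

/-- Since `b_i(0)` acts as a number, `G` and its time derivatives can be pulled out of the sums
(`hz`). Each elementary term then vanishes by its own condition, and only the quadrature term with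
the fourth derivative of `f` survives. -/
theorem sum_incr₄ (hW : M.WeakConditions) (hp : 0 ≤ p.1) :
    ∑ i ∈ Finset.Icc 2 M.s, opL hT 0 (M.b i) (incr₄ hT M f G H i p) =
      opL hT 0 (Finsupp.single (5, 1) 1) (iteratedDeriv 4 f p.2) := by
  have hz : ∀ (J : X →L[ℝ] X) (y : ℕ → X),
      ∑ i ∈ Finset.Icc 2 M.s, Coeff.scal 0 (M.b i) • y i = 0 →
      ∑ i ∈ Finset.Icc 2 M.s, Coeff.scal 0 (M.b i) • J (y i) = 0 := fun J y hy => by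
    simpa using congrArg J hy
  have c8 : ∑ i ∈ Finset.Icc 2 M.s, Coeff.scal 0 (M.b i) •
      (((M.c i : ℝ) ^ 4 / 24) • iteratedDeriv 4 f p.2) =
      opL hT 0 (Finsupp.single (5, 1) 1) (iteratedDeriv 4 f p.2) := by
    rw [opL_zero_apply, ← (hW.cond8 1).scal (x := EuclideanSpace.single 0 1) (by simp) (by simp),
      Finset.sum_smul]
    refine Finset.sum_congr rfl fun i _ => ?_
    rw [smul_smul, mul_comm]
    norm_num [Nat.factorial]
  have c9 : ∑ i ∈ Finset.Icc 2 M.s, Coeff.scal 0 (M.b i) •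
      opL hT p.1 (M.psiCoeff 4 i) (iteratedDeriv 3 f p.2) = 0 := by
    simpa [sum_apply] using congrArg (fun P : X →L[ℝ] X => P (iteratedDeriv 3 f p.2))
      (sum_smul_opL_eq_zero hT hp _ _ _ hW.scal_cond9)
  have c13 : ∑ i ∈ Finset.Icc 2 M.s, Coeff.scal 0 (M.b i) • (M.c i : ℝ) •
      opL hT p.1 (M.psiCoeff 3 i) (iteratedDeriv 2 f p.2) = 0 := by
    simpa [sum_apply, mul_smul] using congrArg (fun P : X →L[ℝ] X => P (iteratedDeriv 2 f p.2))
      (sum_smul_opL_eq_zero hT hp _ _ _ hW.scal_cond13)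
  have c16 : ∑ i ∈ Finset.Icc 2 M.s, Coeff.scal 0 (M.b i) • (M.c i : ℝ) ^ 2 •
      opL hT p.1 (M.psiCoeff 2 i) (iteratedDeriv 1 f p.2) = 0 := by
    simpa only [sum_apply, mul_smul, smul_apply, zero_apply] using
      congrArg (fun P : X →L[ℝ] X => P (iteratedDeriv 1 f p.2))
      (sum_smul_opL_eq_zero hT hp _ _ _ hW.scal_cond16)
  have hpair : ∀ (r : ℕ → ℝ) (w : ℕ → Coeff), (∀ z₁ z₂, ∑ i ∈ Finset.Icc 2 M.s,
      ∑ j ∈ Finset.Ico 2 i, Coeff.scal z₁ (r i • M.a i j) * Coeff.scal z₂ (w j) = 0) →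
      ∀ (J : X →L[ℝ] X) (x : X), ∑ i ∈ Finset.Icc 2 M.s, r i •
        ∑ j ∈ Finset.Ico 2 i, opL hT p.1 (M.a i j) (J (opL hT p.1 (w j) x)) = 0 := by
    intro r w hrw J x
    have := sum_opL_comp_opL_eq_zero hT hp ((Finset.Icc 2 M.s).sigma fun i => Finset.Ico 2 i)
      (fun q => r q.1 • M.a q.1 q.2) (fun q => w q.2)
      (fun z₁ z₂ => by rw [Finset.sum_sigma]; exact hrw z₁ z₂) J x
    rw [Finset.sum_sigma] at this
    simpa only [map_smul, smul_apply, ← Finset.smul_sum] using this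
  have c10 := hpair _ _ hW.scal_cond10 (G p.2) (iteratedDeriv 2 f p.2)
  have c12 := hpair _ _ hW.scal_cond12 (iteratedDeriv 1 G p.2) (iteratedDeriv 1 f p.2)
  have c14 := hpair _ _ hW.scal_cond14 (G p.2) (iteratedDeriv 1 f p.2)
  have c11 : ∑ i ∈ Finset.Icc 2 M.s, Coeff.scal 0 (M.b i) • ∑ j ∈ Finset.Ico 2 i,
      opL hT p.1 (M.a i j) (G p.2 (∑ k ∈ Finset.Ico 2 j, opL hT p.1 (M.a j k)
        (G p.2 (opL hT p.1 (M.psiCoeff 2 k) (iteratedDeriv 1 f p.2))))) = 0 := by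
    have := sum_opL_comp_sum_opL_comp_opL_eq_zero hT hp
      ((Finset.Icc 2 M.s).sigma fun i => Finset.Ico 2 i) (fun q => Finset.Ico 2 q.2)
      (fun q => Coeff.scal 0 (M.b q.1) • M.a q.1 q.2) (fun q k => M.a q.2 k)
      (fun q k => M.psiCoeff 2 k)
      (fun z₁ z₂ z₃ => by rw [Finset.sum_sigma]; exact hW.scal_cond11 z₁ z₂ z₃) (G p.2) (G p.2)
      (iteratedDeriv 1 f p.2)
    rw [Finset.sum_sigma] at this
    simpa only [map_smul, smul_apply, ← Finset.smul_sum] using this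
  have c15 := sum_smul_bilin_opL_eq_zero hT hp _ _ _ hW.scal_cond15 (H p.2) (iteratedDeriv 1 f p.2)
    (iteratedDeriv 1 f p.2)
  simp only [map_smul, smul_apply, mul_smul] at c12 c14
  have d9 := hz (G p.2) _ c9
  have d10 := hz (G p.2) _ c10
  have d11 := hz (G p.2) _ c11
  have d12 := hz (G p.2) _ c12
  have d13 := hz (iteratedDeriv 1 G p.2) _ c13
  have d14 := hz (iteratedDeriv 1 G p.2) _ c14
  have d16 := hz ((1 / 2 : ℝ) • iteratedDeriv 2 G p.2) _ c16
  have d15 := congrArg (fun x => (1 / 2 : ℝ) • x) c15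
  simp only [Finset.smul_sum, smul_comm (1 / 2 : ℝ) (Coeff.scal 0 _), smul_zero] at d15
  have tot := congrArg₂ (· + ·) d9 (congrArg₂ (· + ·) d10 (congrArg₂ (· + ·) d11
    (congrArg₂ (· + ·) d12 (congrArg₂ (· + ·) d13 (congrArg₂ (· + ·) d14
      (congrArg₂ (· + ·) d15 d16))))))
  simp only [add_zero, ← Finset.sum_add_distrib] at tot
  rw [← c8, ← sub_eq_zero, ← Finset.sum_sub_distrib, ← tot]
  refine Finset.sum_congr rfl fun i _ => ?_
  simp only [opL_zero_apply hT (M.b _), incr₄, stageErr₄, stageErr₃, stageErr₂, map_add, map_smul,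
    smul_apply, Finset.sum_add_distrib]
  module

end OrderConditions

/-- The principal part of the local error. -/
def localErr (M : Method) (f : ℝ → X) (G : ℝ → X →L[ℝ] X) (H : ℝ → X →L[ℝ] X →L[ℝ] X)
    (p : ℝ × ℝ) : X :=
  ∑ i ∈ Finset.Icc 2 M.s, (opL hT p.1 (M.b i) - opL hT 0 (M.b i)) (incr₄ hT M f G H i p) -
    (opL hT p.1 (Finsupp.single (5, 1) 1) - opL hT 0 (Finsupp.single (5, 1) 1))
      (iteratedDeriv 4 f p.2)

/-- Expansion of one step of the method, started on the exact solution. -/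
theorem SmoothProblem.isOrd_step (hA : IsGenerator A T)
    (hP : SmoothProblem A g t₀ t₁ v f G H r K) (hM : M.FullConditions) (hW : M.WeakConditions) :
    IsOrd t₀ t₁ 6 fun p => step M T g p.1 (v p.2) - (T p.1 (v p.2) +
      ∑ k ∈ Finset.range 5, p.1 ^ (k + 1) • phiL hT (k + 1) p.1 (iteratedDeriv k f p.2)) -
        p.1 ^ 5 • localErr hT M f G H p := by
  have R1 : IsOrd t₀ t₁ 6 fun p => p.1 ^ 1 • ∑ i ∈ Finset.Icc 2 M.s, opL hT p.1 (M.b i)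
      (g (stage M T g p.1 (v p.2) i) - g (v p.2) -
      (p.1 • incr₁ M f i p + p.1 ^ 2 • incr₂ hT M f G i p + p.1 ^ 3 • incr₃ hT M f G i p +
        p.1 ^ 4 • incr₄ hT M f G H i p)) :=
    (IsOrd.sum fun i _ => (isOrd_opL hT (M.b i)).clm_apply (hP.isOrd_incr hT hA i)).pow_smul 1
  refine R1.congr fun h t h0 ht => ?_
  have hf : g (v t) = f t := (hP.f_eq t ⟨ht.1, by linarith [ht.2, hP.r_pos]⟩).symm
  -- `s1` to `s3` match the exact expansion up to `h^4`; `s4` matches the part of the `h^5` term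
  -- with coefficients frozen at `0`, and `localErr` is left over.
  have s1 := sum_incr₁ hT f (p := (h, t)) hM h0.le
  have s2 := sum_incr₂ hT f G (p := (h, t)) hM h0.le
  have s3 := sum_incr₃ hT f G (p := (h, t)) hM h0.le
  have s4 := sum_incr₄ hT f G H (p := (h, t)) hW h0.le
  simp only [step, phiF, localErr, ← opL_apply hT _ h0.le, ← phiL_apply hT 1 h0.le, map_sub,
    map_add, map_smul, Finset.sum_sub_distrib, Finset.sum_add_distrib, ← Finset.smul_sum, sub_apply,
    Finset.sum_range_succ, Finset.sum_range_zero, iteratedDeriv_zero, s4, hf]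
  simp only at s1 s2 s3
  rw [s1, s2, s3, opL_single hT 5 1 1 h, NNReal.coe_one, one_mul, one_smul]
  module

end Expansion

/-! ### Lipschitz dependence on time -/

section BddLip

variable {E E' : Type*} [NormedAddCommGroup E] [NormedAddCommGroup E'] {t₀ t₁ : ℝ}

/-- `F(h, t)` is bounded and Lipschitz continuous in `t ∈ [t₀, t₁]`, uniformly in `h ∈ (0, 1]`. -/
def IsBddLip (t₀ t₁ : ℝ) (F : ℝ × ℝ → E) : Prop :=
  ∃ C : ℝ, 0 ≤ C ∧ ∀ h, 0 < h → h ≤ 1 → ∀ t ∈ Icc t₀ t₁,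
    ‖F (h, t)‖ ≤ C ∧ ∀ t' ∈ Icc t₀ t₁, ‖F (h, t) - F (h, t')‖ ≤ C * |t - t'|

theorem IsBddLip.add {F F' : ℝ × ℝ → E} (hF : IsBddLip t₀ t₁ F) (hF' : IsBddLip t₀ t₁ F') :
    IsBddLip t₀ t₁ fun p => F p + F' p := by
  obtain ⟨C, hC0, hC⟩ := hF
  obtain ⟨C', hC0', hC'⟩ := hF'
  refine ⟨C + C', by positivity, fun h h0 h1 t ht => ⟨?_, fun t' ht' => ?_⟩⟩
  · exact (norm_add_le _ _).trans (add_le_add (hC h h0 h1 t ht).1 (hC' h h0 h1 t ht).1)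
  · rw [add_sub_add_comm, add_mul]
    exact (norm_add_le _ _).trans
      (add_le_add ((hC h h0 h1 t ht).2 t' ht') ((hC' h h0 h1 t ht).2 t' ht'))

theorem IsBddLip.sum {ι : Type*} {s : Finset ι} {F : ι → ℝ × ℝ → E}
    (hF : ∀ i ∈ s, IsBddLip t₀ t₁ (F i)) : IsBddLip t₀ t₁ fun p => ∑ i ∈ s, F i p := by
  classical
  induction s using Finset.induction_on with
  | empty => exact ⟨0, le_rfl, by simp⟩
  | insert i s hi ih =>
    simp only [Finset.sum_insert hi]
    exact (hF i (Finset.mem_insert_self i s)).add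
      (ih fun j hj => hF j (Finset.mem_insert_of_mem hj))

variable [NormedSpace ℝ E] [NormedSpace ℝ E']

theorem IsBddLip.clm_apply {P : ℝ × ℝ → E →L[ℝ] E'} {F : ℝ × ℝ → E} (hP : IsBddLip t₀ t₁ P)
    (hF : IsBddLip t₀ t₁ F) : IsBddLip t₀ t₁ fun p => P p (F p) := by
  obtain ⟨C, hC0, hC⟩ := hP
  obtain ⟨C', hC0', hC'⟩ := hF
  refine ⟨2 * (C * C'), by positivity, fun h h0 h1 t ht => ⟨?_, fun t' ht' => ?_⟩⟩
  · have := (P (h, t)).le_of_opNorm_le_of_le (hC h h0 h1 t ht).1 (hC' h h0 h1 t ht).1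
    have h2 : 0 ≤ C * C' := by positivity
    linarith
  · have h2 := (P (h, t)).le_of_opNorm_le_of_le (hC h h0 h1 t ht).1 ((hC' h h0 h1 t ht).2 t' ht')
    have h3 := (P (h, t) - P (h, t')).le_of_opNorm_le_of_le ((hC h h0 h1 t ht).2 t' ht')
      (hC' h h0 h1 t' ht').1
    have h4 : P (h, t) (F (h, t)) - P (h, t') (F (h, t')) =
        P (h, t) (F (h, t) - F (h, t')) + (P (h, t) - P (h, t')) (F (h, t')) := by
      simp
    rw [h4]
    refine (norm_add_le _ _).trans ?_
    linarith

theorem IsBddLip.const_smul {F : ℝ × ℝ → E} (hF : IsBddLip t₀ t₁ F) (c : ℝ) :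
    IsBddLip t₀ t₁ fun p => c • F p := by
  obtain ⟨C, hC0, hC⟩ := hF
  refine ⟨|c| * C, by positivity, fun h h0 h1 t ht => ⟨?_, fun t' ht' => ?_⟩⟩
  · rw [norm_smul, Real.norm_eq_abs]
    exact mul_le_mul_of_nonneg_left (hC h h0 h1 t ht).1 (abs_nonneg c)
  · rw [← smul_sub, norm_smul, Real.norm_eq_abs, mul_assoc]
    exact mul_le_mul_of_nonneg_left ((hC h h0 h1 t ht).2 t' ht') (abs_nonneg c)

theorem isBddLip_iteratedDeriv {w : ℝ → E} {n k : ℕ} (hw : ContDiff ℝ n w) (hk : k < n) :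
    IsBddLip t₀ t₁ fun p => iteratedDeriv k w p.2 := by
  obtain ⟨C, hC⟩ := isCompact_Icc.exists_bound_of_continuousOn
    ((hw.continuous_iteratedDeriv k (by exact_mod_cast hk.le)).continuousOn (s := Icc t₀ t₁))
  obtain ⟨C', hC'⟩ := isCompact_Icc.exists_bound_of_continuousOn
    ((hw.continuous_iteratedDeriv (k + 1) (by exact_mod_cast hk)).continuousOn (s := Icc t₀ t₁))
  refine ⟨max (max C C') 0, le_max_right _ _, fun h _ _ t ht => ⟨?_, fun t' ht' => ?_⟩⟩
  · exact (hC t ht).trans ((le_max_left _ _).trans (le_max_left _ _))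
  · exact (convex_Icc t₀ t₁).norm_image_sub_le_of_norm_hasDerivWithin_le
      (fun s _ => (hw.hasDerivAt_iteratedDeriv hk s).hasDerivWithinAt)
      (fun s hs => (hC' s hs).trans ((le_max_right _ _).trans (le_max_left _ _))) ht' ht

theorem isBddLip_of_contDiff {w : ℝ → E} {n : ℕ} (hw : ContDiff ℝ n w) (hn : 0 < n) :
    IsBddLip t₀ t₁ fun p => w p.2 := by
  simpa using isBddLip_iteratedDeriv (t₀ := t₀) (t₁ := t₁) hw hn

variable {X : Type v} [NormedAddCommGroup X] [NormedSpace ℝ X] [CompleteSpace X]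
  {T : ℝ → X →L[ℝ] X} (hT : IsC0Semigroup T)

theorem isBddLip_opL (f : Coeff) : IsBddLip t₀ t₁ fun p => opL hT p.1 f := by
  obtain ⟨C, hC0, hC⟩ := exists_norm_opL_le hT f 1
  refine ⟨C, hC0.le, fun h _ h1 t _ => ⟨hC h h1, fun t' _ => ?_⟩⟩
  simp only [sub_self, norm_zero]
  positivity

variable {A : X →ₗ.[ℝ] X} {g : X → X} {v f : ℝ → X} {G : ℝ → X →L[ℝ] X}
  {H : ℝ → X →L[ℝ] X →L[ℝ] X} {r K : ℝ} {M : Method}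

/-- `f`, `G` and `H` enter with derivatives of order at most four, two and zero, so each has a
further bounded derivative. Abel summation needs this Lipschitz bound. -/
theorem SmoothProblem.isBddLip_incr₄ (hP : SmoothProblem A g t₀ t₁ v f G H r K) (i : ℕ) :
    IsBddLip t₀ t₁ (incr₄ hT M f G H i) := by
  have hf : ∀ k < 5, IsBddLip t₀ t₁ fun p => iteratedDeriv k f p.2 := fun k hk =>
    isBddLip_iteratedDeriv hP.f_smooth hk
  have hG : ∀ k < 4, IsBddLip t₀ t₁ fun p => iteratedDeriv k G p.2 := fun k hk =>
    isBddLip_iteratedDeriv hP.G_smooth hk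
  have hG0 : IsBddLip t₀ t₁ fun p => G p.2 := isBddLip_of_contDiff hP.G_smooth (by norm_num)
  have hH : IsBddLip t₀ t₁ fun p => H p.2 := isBddLip_of_contDiff hP.H_smooth (by norm_num)
  have h₂ : ∀ i, IsBddLip t₀ t₁ (stageErr₂ hT M f i) := fun i =>
    (isBddLip_opL hT _).clm_apply (hf 1 (by norm_num))
  have h₃ : ∀ i, IsBddLip t₀ t₁ (stageErr₃ hT M f G i) := fun i =>
    ((isBddLip_opL hT _).clm_apply (hf 2 (by norm_num))).add
      (IsBddLip.sum fun j _ => (isBddLip_opL hT _).clm_apply (hG0.clm_apply (h₂ j)))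
  have h₄ : ∀ i, IsBddLip t₀ t₁ (stageErr₄ hT M f G i) := fun i =>
    ((isBddLip_opL hT _).clm_apply (hf 3 (by norm_num))).add
      (IsBddLip.sum fun j _ => (isBddLip_opL hT _).clm_apply ((hG0.clm_apply (h₃ j)).add
        (((hG 1 (by norm_num)).clm_apply (h₂ j)).const_smul _)))
  exact (((((hf 4 (by norm_num)).const_smul _).add (hG0.clm_apply (h₄ i))).add
    (((hG 1 (by norm_num)).clm_apply (h₃ i)).const_smul _)).add
    (((hG 2 (by norm_num)).clm_apply (h₂ i)).const_smul _)).add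
    (((hH.clm_apply (h₂ i)).clm_apply (h₂ i)).const_smul _)

/-- By Abel summation, the factor `f(hA) - f(0)` in front of a slowly varying term compensates
the summation over the time steps. -/
theorem IsAnalyticSemigroup.exists_convolution_bound (hT : IsAnalyticSemigroup T) (f : Coeff)
    {w : ℝ × ℝ → X} (hw : IsBddLip t₀ t₁ w) : ∃ h₀ C : ℝ, 0 < h₀ ∧ 0 ≤ C ∧
      ∀ h, 0 < h → h ≤ h₀ → ∀ n : ℕ, t₀ + n * h ≤ t₁ →
      ‖∑ j ∈ Finset.range n, T (((n - 1 - j : ℕ) : ℝ) * h)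
        ((opL hT.1 h f - opL hT.1 0 f) (w (h, t₀ + j * h)))‖ ≤ C := by
  obtain ⟨h₁, C, hh₁, hC0, hC⟩ := hT.exists_sum_opL_sub_bound (t₁ - t₀) f
  obtain ⟨L, hL0, hL⟩ := hw
  refine ⟨min h₁ 1, C * L + C * (L * |t₁ - t₀|), by positivity, by positivity,
    fun h h0 hh n hn => ?_⟩
  have hh1 : h ≤ h₁ := hh.trans (min_le_left _ _)
  have hh2 : h ≤ 1 := hh.trans (min_le_right _ _)
  have hmem : ∀ j : ℕ, j ≤ n → t₀ + j * h ∈ Icc t₀ t₁ := fun j hj => by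
    have h3 : (j : ℝ) * h ≤ n * h := by gcongr
    have h4 : 0 ≤ (j : ℝ) * h := by positivity
    exact ⟨by linarith, by linarith⟩
  -- Abel summation leaves the variation of `w` along the grid, at most `n` increments of size `L
  -- h`.
  have habel := norm_sum_convolution_sub_le
    (fun j : ℕ => (T (j * h)).comp (opL hT.1 h f - opL hT.1 0 f)) (C := C) n (fun m hm x => by
      have h3 : (m : ℝ) * h ≤ n * h := by gcongr
      exact hC h h0 hh1 m (by linarith) x) (fun j => w (h, t₀ + j * h))
  have hsum : ∑ j ∈ Finset.range n,
      ‖w (h, t₀ + ((j + 1 : ℕ) : ℝ) * h) - w (h, t₀ + j * h)‖ ≤ L * |t₁ - t₀| := by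
    have h3 : ∀ j ∈ Finset.range n,
        ‖w (h, t₀ + ((j + 1 : ℕ) : ℝ) * h) - w (h, t₀ + j * h)‖ ≤ L * h := by
      intro j hj
      have hjn := Finset.mem_range.1 hj
      have h4 := (hL h h0 hh2 _ (hmem (j + 1) hjn)).2 _ (hmem j hjn.le)
      rwa [show t₀ + ((j + 1 : ℕ) : ℝ) * h - (t₀ + j * h) = h by push_cast; ring,
        abs_of_pos h0] at h4
    refine (Finset.sum_le_sum h3).trans ?_
    rw [Finset.sum_const, Finset.card_range, nsmul_eq_mul]
    have h5 : (n : ℝ) * h ≤ |t₁ - t₀| := by linarith [le_abs_self (t₁ - t₀)]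
    nlinarith
  have h0b : ‖∑ j ∈ Finset.range n,
      T (j * h) ((opL hT.1 h f - opL hT.1 0 f) (w (h, t₀ + ((0 : ℕ) : ℝ) * h)))‖ ≤ C * L :=
    (hC h h0 hh1 n (by linarith) _).trans
      (mul_le_mul_of_nonneg_left (hL h h0 hh2 _ (hmem 0 (Nat.zero_le _))).1 hC0.le)
  have htri := norm_le_norm_add_norm_sub' (∑ j ∈ Finset.range n, T (((n - 1 - j : ℕ) : ℝ) * h)
        ((opL hT.1 h f - opL hT.1 0 f) (w (h, t₀ + j * h))))
    (∑ j ∈ Finset.range n,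
      T (j * h) ((opL hT.1 h f - opL hT.1 0 f) (w (h, t₀ + ((0 : ℕ) : ℝ) * h))))
  refine htri.trans (add_le_add h0b ?_)
  exact habel.trans (mul_le_mul_of_nonneg_left hsum hC0.le)

/-- The propagated principal parts of the local errors stay bounded. -/
theorem SmoothProblem.exists_sum_localErr_bound (hT : IsAnalyticSemigroup T)
    (hP : SmoothProblem A g t₀ t₁ v f G H r K) : ∃ h₀ C : ℝ, 0 < h₀ ∧ 0 ≤ C ∧
      ∀ h, 0 < h → h ≤ h₀ → ∀ n : ℕ, t₀ + n * h ≤ t₁ →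
      ‖∑ j ∈ Finset.range n, T (((n - 1 - j : ℕ) : ℝ) * h)
        (localErr hT.1 M f G H (h, t₀ + j * h))‖ ≤ C := by
  choose h₁ C₁ hh₁ hC₁ H₁ using fun i =>
    hT.exists_convolution_bound (M.b i) (hP.isBddLip_incr₄ (M := M) hT.1 i)
  obtain ⟨h₂, C₂, hh₂, hC₂, H₂⟩ := hT.exists_convolution_bound (Finsupp.single (5, 1) 1)
    (isBddLip_iteratedDeriv (t₀ := t₀) (t₁ := t₁) hP.f_smooth (by norm_num : 4 < 5))
  obtain ⟨h₃, hh₃, hle⟩ : ∃ h₃ > 0, ∀ i ∈ Finset.Icc 2 M.s, h₃ ≤ h₁ i := by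
    have : ∀ᶠ h in 𝓝[>] (0 : ℝ), ∀ i ∈ Finset.Icc 2 M.s, h ≤ h₁ i := by
      rw [Finset.eventually_all]
      exact fun i _ => nhdsWithin_le_nhds (ge_mem_nhds (hh₁ i))
    obtain ⟨h, hh, hh0⟩ := (this.and self_mem_nhdsWithin).exists
    exact ⟨h, hh0, hh⟩
  refine ⟨min h₃ h₂, ∑ i ∈ Finset.Icc 2 M.s, C₁ i + C₂, by positivity,
    add_nonneg (Finset.sum_nonneg fun i _ => hC₁ i) hC₂, fun h h0 hh n hn => ?_⟩
  simp only [localErr, map_sub, map_sum, Finset.sum_sub_distrib]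
  rw [Finset.sum_comm]
  refine (norm_sub_le _ _).trans (add_le_add ((norm_sum_le _ _).trans
    (Finset.sum_le_sum fun i hi => ?_)) ?_)
  · exact H₁ i h h0 (hh.trans ((min_le_left _ _).trans (hle i hi))) n hn
  · exact H₂ h h0 (hh.trans (min_le_right _ _)) n hn

end BddLip

/-! ### Stability and convergence -/

section Stability

open Asymptotics

variable {X : Type v} [NormedAddCommGroup X] {t₀ t₁ : ℝ}

theorem _root_.Asymptotics.IsBigO.clm_apply_bounded {α E F : Type*} [NormedAddCommGroup E]
    [NormedSpace ℝ E] [NormedAddCommGroup F] {l : Filter α} {P : α → E →L[ℝ] E} {w : α → E}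
    {y : α → F} (hP : P =O[l] fun _ => (1 : ℝ)) (hw : w =O[l] y) :
    (fun q => P q (w q)) =O[l] y := by
  have h1 : (fun q => P q (w q)) =O[l] fun q => ‖P q‖ * ‖w q‖ :=
    IsBigO.of_bound 1 (Eventually.of_forall fun q => by simpa using (P q).le_opNorm (w q))
  have h2 := h1.trans (hP.norm_left.mul hw.norm_norm)
  simp only [one_mul] at h2
  exact h2.of_norm_right

/-- Triples `((h, t), e)` of a step size, a time and a perturbation `e → 0`. -/
def perturbFilter (X : Type*) [NormedAddCommGroup X] (t₀ t₁ : ℝ) : Filter ((ℝ × ℝ) × X) :=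
  stepFilter t₀ t₁ ×ˢ 𝓝 0

theorem IsOrd.isBigO_perturbFilter {E : Type*} [NormedAddCommGroup E] {F : ℝ × ℝ → E}
    (hF : IsOrd t₀ t₁ 0 F) : (fun q => F q.1) =O[perturbFilter X t₀ t₁] fun _ => (1 : ℝ) := by
  have h1 := IsBigO.comp_tendsto hF (tendsto_fst : Tendsto Prod.fst (perturbFilter X t₀ t₁) _)
  simp only [Function.comp_def, pow_zero] at h1
  exact h1

theorem IsOrd.tendsto_zero {E : Type*} [NormedAddCommGroup E] {F : ℝ × ℝ → E}
    (hF : IsOrd t₀ t₁ 1 F) : Tendsto F (stepFilter t₀ t₁) (𝓝 0) := by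
  refine IsBigO.trans_tendsto hF ?_
  have h1 : Tendsto (fun p : ℝ × ℝ => p.1) (stepFilter t₀ t₁) (𝓝 0) :=
    (tendsto_fst : Tendsto Prod.fst (stepFilter t₀ t₁) _).mono_right nhdsWithin_le_nhds
  simpa using h1

theorem eventually_mem_Ico_perturbFilter :
    ∀ᶠ q in perturbFilter X t₀ t₁, q.1.2 ∈ Ico t₀ t₁ ∧ 0 < q.1.1 := by
  have h1 : ∀ᶠ p in stepFilter t₀ t₁, p.2 ∈ Ico t₀ t₁ ∧ 0 < p.1 :=
    eventually_stepFilter.2 ⟨1, one_pos, fun h t h0 _ ht => ⟨ht, h0⟩⟩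
  exact (tendsto_fst : Tendsto Prod.fst (perturbFilter X t₀ t₁) _).eventually h1

variable [NormedSpace ℝ X] {A : X →ₗ.[ℝ] X} {g : X → X} {v f : ℝ → X} {G : ℝ → X →L[ℝ] X}
  {H : ℝ → X →L[ℝ] X →L[ℝ] X} {r K : ℝ} {M : Method}

/-- `g` is Lipschitz continuous along perturbations of the solution. -/
theorem SmoothProblem.isBigO_sub (hP : SmoothProblem A g t₀ t₁ v f G H r K)
    {S : (ℝ × ℝ) × X → X} {S₀ : ℝ × ℝ → X}
    (hS₀ : Tendsto (fun p => S₀ p - v p.2) (stepFilter t₀ t₁) (𝓝 0))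
    (hS : (fun q => S q - S₀ q.1) =O[perturbFilter X t₀ t₁] Prod.snd) :
    (fun q => g (S q) - g (S₀ q.1)) =O[perturbFilter X t₀ t₁] Prod.snd := by
  have h1 : Tendsto (fun q : (ℝ × ℝ) × X => S₀ q.1 - v q.1.2) (perturbFilter X t₀ t₁) (𝓝 0) :=
    hS₀.comp tendsto_fst
  have h2 : Tendsto (fun q => S q - S₀ q.1) (perturbFilter X t₀ t₁) (𝓝 0) :=
    hS.trans_tendsto tendsto_snd
  have h3 := h2.add h1
  rw [add_zero] at h3
  refine IsBigO.trans (IsBigO.of_bound K ?_) hS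
  filter_upwards [h1.eventually (Metric.ball_mem_nhds 0 hP.r_pos),
    h3.eventually (Metric.ball_mem_nhds 0 hP.r_pos), eventually_mem_Ico_perturbFilter]
    with q hq1 hq2 hq3
  refine hP.lip q.1.2 (Ico_subset_Icc_self hq3.1) _ ?_ _ ?_
  · rw [mem_ball_iff_norm]
    simpa using hq2
  · rw [mem_ball_iff_norm]
    simpa using hq1

theorem SmoothProblem.isBigO_sub_self (hP : SmoothProblem A g t₀ t₁ v f G H r K) :
    (fun q => g (v q.1.2 + q.2) - g (v q.1.2)) =O[perturbFilter X t₀ t₁] Prod.snd :=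
  hP.isBigO_sub (S := fun q => v q.1.2 + q.2) (S₀ := fun p => v p.2)
    (by simpa using tendsto_const_nhds)
    (by simpa using isBigO_refl _ _)

variable [CompleteSpace X] {T : ℝ → X →L[ℝ] X}

/-- Places the stages in the ball around `v t` on which `g` is Lipschitz. -/
theorem SmoothProblem.tendsto_stage (hT : IsC0Semigroup T) (hA : IsGenerator A T)
    (hP : SmoothProblem A g t₀ t₁ v f G H r K) (i : ℕ) :
    Tendsto (fun p => stage M T g p.1 (v p.2) i - v p.2) (stepFilter t₀ t₁) (𝓝 0) := by
  refine IsOrd.tendsto_zero ?_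
  have h1 := (hP.isOrd_stage (M := M) hT hA i).mono (by norm_num : 1 ≤ 5)
  have h2 := ((hP.isOrd_stageErr₂ (M := M) hT i).pow_smul 2).mono (by norm_num : 1 ≤ 2)
  have h3 := ((hP.isOrd_stageErr₃ (M := M) hT i).pow_smul 3).mono (by norm_num : 1 ≤ 3)
  have h4 := ((hP.isOrd_stageErr₄ (M := M) hT i).pow_smul 4).mono (by norm_num : 1 ≤ 4)
  have h5 := isOrd_taylor (t₀ := t₀) (t₁ := t₁) hP.v_smooth (by norm_num : 1 ≤ 5) (M.c i)
  refine ((((h1.add h2).add h3).add h4).add h5).congr fun h t _ _ => ?_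
  simp
  abel

/-- The unbounded part contributes exactly `e^{chA} e`; all the rest carries a factor `c h`. -/
theorem phiF_add_sub (hT : IsC0Semigroup T) (c h : ℝ) (hc : 0 ≤ c) (hh : 0 ≤ h) (w e : X) :
    w + e + phiF T g (c * h) (w + e) - (w + phiF T g (c * h) w) =
      phiL hT 0 (c * h) e + (c * h) • phiL hT 1 (c * h) (g (w + e) - g w) := by
  have hch : 0 ≤ c * h := by positivity
  rw [phiF, phiF, ← phiL_apply hT 1 hch, ← phiL_apply hT 1 hch, phiL_apply hT 0 hch e, map_sub,
    map_add]
  simp only [phi]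
  module

/-- The internal stages depend Lipschitz continuously on the initial value. -/
theorem SmoothProblem.isBigO_stage_sub (hT : IsC0Semigroup T) (hA : IsGenerator A T)
    (hP : SmoothProblem A g t₀ t₁ v f G H r K) (i : ℕ) :
    (fun q => stage M T g q.1.1 (v q.1.2 + q.2) i - stage M T g q.1.1 (v q.1.2) i)
      =O[perturbFilter X t₀ t₁] Prod.snd := by
  induction i using Nat.strong_induction_on with
  | _ i ih =>
  have hg0 := hP.isBigO_sub_self
  have hb : IsOrd t₀ t₁ 0 fun p => p.1 • ContinuousLinearMap.id ℝ X :=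
    IsOrd.of_bound ‖ContinuousLinearMap.id ℝ X‖ 1 one_pos fun h t h0 h1 _ => by
      rw [norm_smul, Real.norm_of_nonneg h0.le, pow_zero, mul_one]
      exact mul_le_of_le_one_left (norm_nonneg _) h1
  have R1 : (fun q : (ℝ × ℝ) × X => phiL hT 0 (M.c i * q.1.1) q.2)
      =O[perturbFilter X t₀ t₁] Prod.snd :=
    (isOrd_phiL hT 0 (M.c i)).isBigO_perturbFilter.clm_apply_bounded (isBigO_refl _ _)
  have R2 := hb.isBigO_perturbFilter.clm_apply_bounded
    (((isOrd_phiL hT 1 (M.c i)).isBigO_perturbFilter.clm_apply_bounded hg0).const_smul_left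
      (M.c i : ℝ))
  have R3 := hb.isBigO_perturbFilter.clm_apply_bounded
    (IsBigO.fun_sum (s := Finset.Ico 2 i) fun j hj =>
      (isOrd_opL hT (M.a i j)).isBigO_perturbFilter.clm_apply_bounded
        ((hP.isBigO_sub (hP.tendsto_stage hT hA j) (ih j (Finset.mem_Ico.1 hj).2)).sub hg0))
  refine ((R1.add R2).add R3).congr' ?_ EventuallyEq.rfl
  filter_upwards [eventually_mem_Ico_perturbFilter] with q hq
  rw [stage_eq, stage_eq]
  have h1 := phiF_add_sub (g := g) hT (M.c i) q.1.1 (NNReal.coe_nonneg _) hq.2.le (v q.1.2) q.2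
  rw [add_sub_add_comm, h1]
  simp only [← opL_apply hT _ hq.2.le, map_sub, Finset.sum_sub_distrib, smul_apply,
    ContinuousLinearMap.id_apply, Pi.smul_apply]
  module

/-- One step of the method depends Lipschitz continuously on the initial value, up to the
propagation of the perturbation by the semigroup. -/
theorem SmoothProblem.exists_step_sub_bound (hT : IsC0Semigroup T) (hA : IsGenerator A T)
    (hP : SmoothProblem A g t₀ t₁ v f G H r K) : ∃ L h₀ ε : ℝ, 0 ≤ L ∧ 0 < h₀ ∧ 0 < ε ∧
      ∀ h t e, 0 < h → h ≤ h₀ → t ∈ Ico t₀ t₁ → ‖e‖ ≤ ε →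
      ‖step M T g h (v t + e) - step M T g h (v t) - T h e‖ ≤ L * h * ‖e‖ := by
  have hg0 := hP.isBigO_sub_self
  have R1 := (isOrd_phiL hT 1 1).isBigO_perturbFilter.clm_apply_bounded hg0
  have R2 := IsBigO.fun_sum (s := Finset.Icc 2 M.s) fun i _ =>
      (isOrd_opL hT (M.b i)).isBigO_perturbFilter.clm_apply_bounded
        ((hP.isBigO_sub (hP.tendsto_stage (M := M) hT hA i) (hP.isBigO_stage_sub hT hA i)).sub hg0)
  obtain ⟨L, hL0, hL⟩ := (R1.add R2).exists_nonneg
  rw [IsBigOWith, perturbFilter, eventually_prod_iff] at hL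
  obtain ⟨pa, hpa, pb, hpb, hL⟩ := hL
  obtain ⟨h₀, hh₀, hpa⟩ := eventually_stepFilter.1 hpa
  obtain ⟨ε, hε, hpb⟩ := Metric.eventually_nhds_iff.1 hpb
  refine ⟨L, h₀, ε / 2, hL0, hh₀, by positivity, fun h t e h0 h1 ht he => ?_⟩
  have hLe := hL (hpa h t h0 h1 ht) (hpb (y := e) (by rw [dist_zero_right]; linarith))
  simp only at hLe
  have h2 := phiF_add_sub (g := g) hT 1 h zero_le_one h0.le (v t) e
  have h3 : phiL hT 0 h e = T h e := phiL_apply hT 0 h0.le e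
  rw [one_mul, h3] at h2
  -- The term `T h e` is kept exactly, because `‖T h‖` need not be `1 + O(h)` and a norm bound would
  -- compound over the steps. The rest has a factor `h`.
  have h4 : step M T g h (v t + e) - step M T g h (v t) - T h e = h • (phiL hT 1 ((1 : ℝ≥0) * h)
      (g (v t + e) - g (v t)) + ∑ i ∈ Finset.Icc 2 M.s, opL hT h (M.b i)
        (g (stage M T g h (v t + e) i) - g (stage M T g h (v t) i) -
          (g (v t + e) - g (v t)))) := by
    rw [step, step, add_sub_add_comm, h2]
    simp only [← opL_apply hT _ h0.le, map_sub, Finset.sum_sub_distrib, NNReal.coe_one, one_mul]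
    module
  rw [h4, norm_smul, Real.norm_of_nonneg h0.le]
  calc h * _ ≤ h * (L * ‖e‖) := mul_le_mul_of_nonneg_left hLe h0.le
    _ = _ := by ring

end Stability

/-! ### Error recursion, discrete Gronwall lemma and convergence -/

section Convergence

/-- Discrete Gronwall lemma, for an estimate that is only available as long as the sequence stays
below a threshold `ε`. -/
theorem discrete_gronwall_of_le {e : ℕ → ℝ} {a b ε : ℝ} {N : ℕ} (ha : 0 ≤ a) (hb : 0 ≤ b)
    (hε : a * (1 + b) ^ N ≤ ε)
    (he : ∀ n ≤ N, (∀ j < n, e j ≤ ε) → e n ≤ a + b * ∑ j ∈ Finset.range n, e j) (n : ℕ)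
    (hn : n ≤ N) : e n ≤ a * (1 + b) ^ n := by
  induction n using Nat.strong_induction_on with
  | _ n ih =>
  -- The bound to be proved keeps the earlier terms below the threshold, which makes the estimate
  -- for `e n` available.
  have h1 : ∀ j < n, e j ≤ ε := fun j hj => by
    refine (ih j hj (by omega)).trans (le_trans ?_ hε)
    exact mul_le_mul_of_nonneg_left (pow_le_pow_right₀ (by linarith) (by omega)) ha
  have h2 : ∀ n : ℕ, a + b * ∑ j ∈ Finset.range n, a * (1 + b) ^ j = a * (1 + b) ^ n := by
    intro n
    induction n with
    | zero => simp
    | succ n ih => rw [Finset.sum_range_succ, mul_add, ← add_assoc, ih]; ring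
  rw [← h2 n]
  refine (he n hn h1).trans ?_
  have h3 : ∑ j ∈ Finset.range n, e j ≤ ∑ j ∈ Finset.range n, a * (1 + b) ^ j :=
    Finset.sum_le_sum fun j hj =>
      ih j (Finset.mem_range.1 hj) (by have := Finset.mem_range.1 hj; omega)
  gcongr

variable {X : Type v} [NormedAddCommGroup X] [NormedSpace ℝ X] {T : ℝ → X →L[ℝ] X}

/-- Unrolling collects the propagators into `T (m h)`, bounded by one constant, whereas `‖T h‖ ^ m`
could blow up. -/
theorem IsC0Semigroup.eq_sum_of_recursion (hT : IsC0Semigroup T) {h : ℝ} (hh : 0 ≤ h)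
    {e d : ℕ → X} (n : ℕ) (h0 : e 0 = 0) (he : ∀ j < n, e (j + 1) = T h (e j) + d j) :
    e n = ∑ j ∈ Finset.range n, T (((n - 1 - j : ℕ) : ℝ) * h) (d j) := by
  induction n with
  | zero => simpa using h0
  | succ n ih =>
    rw [he n n.lt_succ_self, ih fun j hj => he j (hj.trans n.lt_succ_self), map_sum,
      Finset.sum_range_succ]
    congr 1
    · refine Finset.sum_congr rfl fun j hj => ?_
      have hj' := Finset.mem_range.1 hj
      have h1 := hT.map_add h (((n - 1 - j : ℕ) : ℝ) * h) hh (by positivity)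
      have h2 : h + ((n - 1 - j : ℕ) : ℝ) * h = ((n + 1 - 1 - j : ℕ) : ℝ) * h := by
        rw [show n + 1 - 1 - j = (n - 1 - j) + 1 by omega]
        push_cast
        ring
      rw [h2] at h1
      rw [h1]
      rfl
    · simp [hT.map_zero]

variable [CompleteSpace X] {A : X →ₗ.[ℝ] X} {g : X → X} {t₀ t₁ : ℝ} {v f : ℝ → X}
  {G : ℝ → X →L[ℝ] X} {H : ℝ → X →L[ℝ] X →L[ℝ] X} {r K : ℝ} {M : Method}

/-- Stability of a step, its expansion on the exact solution and the exact step combined. The term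
with `localErr` is left unestimated, since its norm alone would cost a power of `h`. -/
theorem SmoothProblem.exists_error_recursion (hT : IsC0Semigroup T) (hA : IsGenerator A T)
    (hP : SmoothProblem A g t₀ t₁ v f G H r K) (hM : M.FullConditions) (hW : M.WeakConditions) :
    ∃ L C h₀ ε : ℝ, 0 ≤ L ∧ 0 ≤ C ∧ 0 < h₀ ∧ 0 < ε ∧ ∀ h t e, 0 < h → h ≤ h₀ → t₀ ≤ t →
      t + h ≤ t₁ → ‖e‖ ≤ ε →
      ‖step M T g h (v t + e) - v (t + h) - T h e - h ^ 5 • localErr hT M f G H (h, t)‖ ≤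
        L * h * ‖e‖ + C * h ^ 6 := by
  obtain ⟨L, h₁, ε, hL, hh₁, hε, HL⟩ := hP.exists_step_sub_bound (M := M) hT hA
  obtain ⟨C₂, h₂, hh₂, hC₂, H₂⟩ := isOrd_iff.1 (hP.isOrd_step hT hA hM hW)
  obtain ⟨C₃, hC₃, H₃⟩ := hP.exists_exact_step_bound hT hA
  refine ⟨L, C₂ + C₃, min (min h₁ h₂) 1, ε, hL, by positivity, by positivity, hε,
    fun h t e h0 hh ht hth he => ?_⟩
  have ht' : t ∈ Ico t₀ t₁ := ⟨ht, by linarith⟩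
  have e1 := HL h t e h0 (hh.trans ((min_le_left _ _).trans (min_le_left _ _))) ht' he
  have e2 := H₂ h t h0 (hh.trans ((min_le_left _ _).trans (min_le_right _ _))) ht'
  have e3 := H₃ h t h0 (hh.trans (min_le_right _ _)) ht hth
  simp only at e2
  set P := T h (v t) + ∑ k ∈ Finset.range 5, h ^ (k + 1) • phiL hT (k + 1) h (iteratedDeriv k f t)
  have h4 : step M T g h (v t + e) - v (t + h) - T h e - h ^ 5 • localErr hT M f G H (h, t) =
      (step M T g h (v t + e) - step M T g h (v t) - T h e) +
      (step M T g h (v t) - P - h ^ 5 • localErr hT M f G H (h, t)) - (v (t + h) - P) := by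
    abel
  rw [h4, add_mul, ← add_assoc]
  exact (norm_sub_le _ _).trans (add_le_add ((norm_add_le _ _).trans (add_le_add e1 e2)) e3)

/-- Convergence of order five along a smooth extension of the solution. -/
theorem SmoothProblem.exists_convergence (hT : IsAnalyticSemigroup T) (hA : IsGenerator A T)
    (hP : SmoothProblem A g t₀ t₁ v f G H r K) (ht : t₀ < t₁) (hM : M.FullConditions)
    (hW : M.WeakConditions) :
    ∃ C h₀ : ℝ, 0 < h₀ ∧ ∀ h : ℝ, 0 < h → h ≤ h₀ → ∀ n : ℕ, t₀ + n * h ≤ t₁ →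
      ‖numSol M T g h (v t₀) n - v (t₀ + n * h)‖ ≤ C * h ^ 5 := by
  obtain ⟨L, C, h₁, ε, hL, hC, hh₁, hε, Hrec⟩ := hP.exists_error_recursion hT.1 hA hM hW
  obtain ⟨h₂, C', hh₂, hC', Hloc⟩ := hP.exists_sum_localErr_bound (M := M) hT
  obtain ⟨B, hB0, hB⟩ := hT.1.exists_norm_le (t₁ - t₀)
  set R := t₁ - t₀ with hR
  have hR0 : 0 < R := sub_pos.2 ht
  -- `C'` stems from the summed principal parts, `B C R` from the `O(h^6)` remainders of at most `R
  -- / h` steps, and `b₀` is the Gronwall rate.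
  set a₀ := C' + B * C * R with ha₀
  set b₀ := B * L with hb₀
  have ha₀' : 0 ≤ a₀ := by positivity
  have hb₀' : 0 ≤ b₀ := by positivity
  set C₀ := a₀ * Real.exp (b₀ * R) with hC₀
  have hC₀' : 0 ≤ C₀ := by positivity
  -- The last two bounds give `C₀ h ^ 5 ≤ C₀ h ≤ ε`, so the error never leaves the region where the
  -- recursion is valid.
  refine ⟨C₀, min (min h₁ h₂) (min 1 (ε / (C₀ + 1))), by positivity, fun h h0 hh N hN => ?_⟩
  have hh1 : h ≤ h₁ := hh.trans ((min_le_left _ _).trans (min_le_left _ _))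
  have hh2 : h ≤ h₂ := hh.trans ((min_le_left _ _).trans (min_le_right _ _))
  have hh3 : h ≤ 1 := hh.trans ((min_le_right _ _).trans (min_le_left _ _))
  have hh4 : h ≤ ε / (C₀ + 1) := hh.trans ((min_le_right _ _).trans (min_le_right _ _))
  rw [le_div_iff₀ (by positivity)] at hh4
  have hNR : (N : ℝ) * h ≤ R := by linarith
  set e : ℕ → X := fun n => numSol M T g h (v t₀) n - v (t₀ + n * h) with he
  set w : ℕ → X := fun j => localErr hT.1 M f G H (h, t₀ + j * h) with hw
  set ρ : ℕ → X := fun j => e (j + 1) - T h (e j) - h ^ 5 • w j with hρ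
  have hle : ∀ n ≤ N, (n : ℝ) * h ≤ N * h := fun n hn => by gcongr
  have hpow : ∀ n ≤ N, a₀ * h ^ 5 * (1 + b₀ * h) ^ n ≤ C₀ * h ^ 5 := by
    intro n hn
    have h1 : (1 + b₀ * h) ^ n ≤ Real.exp (b₀ * R) := by
      calc (1 + b₀ * h) ^ n ≤ Real.exp (b₀ * h) ^ n := by
            gcongr
            linarith [Real.add_one_le_exp (b₀ * h)]
        _ = Real.exp (b₀ * (n * h)) := by rw [← Real.exp_nat_mul]; ring_nf
        _ ≤ Real.exp (b₀ * R) := by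
            have := (hle n hn).trans hNR
            gcongr
    calc a₀ * h ^ 5 * (1 + b₀ * h) ^ n ≤ a₀ * h ^ 5 * Real.exp (b₀ * R) := by gcongr
      _ = C₀ * h ^ 5 := by rw [hC₀]; ring
  have hsmall : C₀ * h ^ 5 ≤ ε := by
    have h1 : h ^ 5 ≤ h := by
      calc h ^ 5 = h ^ 4 * h := by ring
        _ ≤ 1 * h := by
          gcongr
          exact pow_le_one₀ h0.le hh3
        _ = h := one_mul h
    have h2 : C₀ * h ^ 5 ≤ C₀ * h := mul_le_mul_of_nonneg_left h1 hC₀'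
    linarith
  have hρb : ∀ j < N, ‖e j‖ ≤ ε → ‖ρ j‖ ≤ L * h * ‖e j‖ + C * h ^ 6 := by
    intro j hj hej
    have h1 := hle (j + 1) hj
    push_cast at h1
    have h2 := Hrec h (t₀ + j * h) (e j) h0 hh1 (by
      have : 0 ≤ (j : ℝ) * h := by positivity
      linarith) (by linarith) hej
    have h3 : ρ j = step M T g h (v (t₀ + j * h) + e j) - v (t₀ + j * h + h) - T h (e j) -
        h ^ 5 • localErr hT.1 M f G H (h, t₀ + j * h) := by
      have h4 : v (t₀ + j * h) + e j = numSol M T g h (v t₀) j := by simp [he]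
      rw [h4]
      simp only [hρ, he, hw, numSol]
      rw [show t₀ + ((j + 1 : ℕ) : ℝ) * h = t₀ + j * h + h by push_cast; ring]
    rwa [h3]
  have hmain : ∀ n ≤ N, (∀ j < n, ‖e j‖ ≤ ε) →
      ‖e n‖ ≤ a₀ * h ^ 5 + b₀ * h * ∑ j ∈ Finset.range n, ‖e j‖ := by
    intro n hn hj
    have h1 := hT.1.eq_sum_of_recursion h0.le (e := e) (d := fun j => h ^ 5 • w j + ρ j) n
      (by simp [he, numSol]) (fun j _ => by simp [hρ])
    have hnR := (hle n hn).trans hNR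
    have h2 := Hloc h h0 hh2 n (by linarith)
    have h3 : ‖∑ j ∈ Finset.range n, T (((n - 1 - j : ℕ) : ℝ) * h) (ρ j)‖ ≤
        ∑ j ∈ Finset.range n, B * (L * h * ‖e j‖ + C * h ^ 6) := by
      refine norm_sum_le_of_le _ fun j hjn => ?_
      have hjn' := Finset.mem_range.1 hjn
      refine (T _).le_of_opNorm_le_of_le (hB _ (by positivity) ?_)
        (hρb j (hjn'.trans_le hn) (hj j hjn'))
      exact (hle (n - 1 - j) (by omega)).trans hNR
    have h4 : ∑ j ∈ Finset.range n, B * (L * h * ‖e j‖ + C * h ^ 6) ≤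
        B * C * R * h ^ 5 + b₀ * h * ∑ j ∈ Finset.range n, ‖e j‖ := by
      rw [← Finset.mul_sum, Finset.sum_add_distrib, ← Finset.mul_sum, Finset.sum_const,
        Finset.card_range, nsmul_eq_mul]
      have h5 : B * C * h ^ 5 * (n * h) ≤ B * C * h ^ 5 * R := by gcongr
      have h6 : B * (L * h * ∑ j ∈ Finset.range n, ‖e j‖ + n * (C * h ^ 6)) =
          b₀ * h * ∑ j ∈ Finset.range n, ‖e j‖ + B * C * h ^ 5 * (n * h) := by
        rw [hb₀]; ring
      rw [h6]
      linarith
    have h7 : e n = h ^ 5 • ∑ j ∈ Finset.range n, T (((n - 1 - j : ℕ) : ℝ) * h) (w j) +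
        ∑ j ∈ Finset.range n, T (((n - 1 - j : ℕ) : ℝ) * h) (ρ j) := by
      rw [h1, Finset.smul_sum, ← Finset.sum_add_distrib]
      simp
    have h8 : ‖h ^ 5 • ∑ j ∈ Finset.range n, T (((n - 1 - j : ℕ) : ℝ) * h) (w j)‖ ≤
        C' * h ^ 5 := by
      rw [norm_smul, Real.norm_of_nonneg (by positivity), mul_comm]
      gcongr
    rw [h7]
    refine (norm_add_le _ _).trans ?_
    have h9 : a₀ * h ^ 5 = C' * h ^ 5 + B * C * R * h ^ 5 := by rw [ha₀]; ring
    linarith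
  exact (discrete_gronwall_of_le (e := fun n => ‖e n‖) (a := a₀ * h ^ 5) (b := b₀ * h)
    (by positivity) (by positivity) ((hpow N le_rfl).trans hsmall) hmain N le_rfl).trans
      (hpow N le_rfl)

end Convergence

end

end ExpRK

/-- The generator is closed, so a smooth extension of the solution with the required graph relations
exists. It agrees with `u` at all grid times up to `t₁`, and the scheme depends on it only through
the initial value. -/
theorem theorem4p1 {X : Type*} [NormedAddCommGroup X] [NormedSpace ℝ X] [CompleteSpace X]
    (A : X →ₗ.[ℝ] X) (T : ℝ → X →L[ℝ] X)
    (hT : ExpRK.IsAnalyticSemigroup T) (hA : ExpRK.IsGenerator A T)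
    (g : X → X) (t₀ t₁ : ℝ) (ht : t₀ < t₁) (u : ℝ → X)
    (hu : ExpRK.IsSolution A g t₀ t₁ u) (hreg : ExpRK.IsRegular g t₀ t₁ u)
    (M : ExpRK.Method) (hfull : M.FullConditions) (hweak : M.WeakConditions) :
    ∃ C h₀ : ℝ, 0 < h₀ ∧ ∀ h : ℝ, 0 < h → h ≤ h₀ → ∀ n : ℕ, t₀ + n * h ≤ t₁ →
      ‖ExpRK.numSol M T g h (u t₀) n - u (t₀ + n * h)‖ ≤ C * h ^ 5 := by
  obtain ⟨v, f, G, H, r, K, hP, hvu⟩ :=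
    ExpRK.exists_smoothProblem (hA.isClosed_graph hT.1) ht hu hreg
  obtain ⟨C, h₀, hh₀, hC⟩ := hP.exists_convergence hT hA ht hfull hweak
  refine ⟨C, h₀, hh₀, fun h h0 hh n hn => ?_⟩
  have hn0 : 0 ≤ (n : ℝ) * h := by positivity
  rw [← hvu (left_mem_Icc.2 ht.le), ← hvu ⟨by linarith, hn⟩]
  exact hC h h0 hh n hn
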